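/- Let $k$ be a field and let $\mathcal D=(G,\chi,z,\lambda,q)$ consist of a finite group $G$, a character $\chi\colon G\to k^\times$, a central element $z\in G$, and scalars $\lambda\in k$, $q\in k^\times$, such that, with $p:=\chi(z)$, the scalar $qp$ is a root of unity of order $n>1$, and $\chi^n=1$ if $\lambda(z^n-1_G)\neq 0$ in the group algebra $k[G]$. Assume $(p,q)\ne(1,-1)$. Let $H=H_{\mathcal D}$ be the associated braided Hopf algebra: as an algebra it is generated by $G$ and $x$ subject to $x^n=\lambda(z^n-1_G)$ and $xg=\chi(g)gx$; it has basis $\{gx^i: g\in G,\ 0\le i<n\}$; its coalgebra structure is $\Delta(gx^i)=\sum_{j=0}^i\binom{i}{j}_{qp}gx^j\otimes gz^jx^{i-j}$, $\epsilon(gx^i)=\delta_{i0}$ $(0\le i<n)$; its braid is $c(gx^i\otimes hx^j)=q^{ij}\,hx^j\otimes gx^i$. Let $(B,s)$ be a right $H$-comodule algebra: $B$ is a $k$-algebra; $s\colon H\otimes B\to B\otimes H$ is a left transposition, i.e. a bijective linear map compatible with the unit, multiplication, counit, comultiplication and braid of $H$ and with the unit and multiplication of $B$; and $\nu\colon B\to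 B\otimes H$ is a coassociative counitary coaction such that $(\nu\otimes H)s=(B\otimes c)(s\otimes H)(H\otimes\nu)$, $\nu\mu_B=(\mu_B\otimes\mu_H)(B\otimes s\otimes H)(\nu\otimes\nu)$ and $\nu(1)=1\otimes 1$. Let $C:=\{b\in B:\nu(b)=b\otimes 1\}$ be the algebra of coinvariants. Write $\nu(b)=\sum_{g\in G,\,0\le i<n}U^g_i(b)\otimes gx^i$, put $U:=\sum_{g}U^g_1$, and let $\alpha(b)$ be the coefficient of $x$ in $s(x\otimes b)$ (in fact $s(x\otimes b)=\alpha(b)\otimes x$). For $g\in G$ and $\zeta\in\mathrm{Aut}(G)$ let $$B_{g,\zeta}:=\{b\in B: s(h\otimes b)=b\otimes\zeta(h)\ \text{for all }h\in G,\ \ U^g_0(b)=b\}.$$ Let $\mathrm{Aut}_{\chi,z}(G)$ be the group of automorphisms $\zeta$ of $G$ with $\zeta(z)=z$ and $\chi\circ\zeta=\chi$. For a left transposition $t\colon H\otimes A\to A\otimes H$ on an algebra $A$, a weak action of $H$ on $(A,t)$ is a linear map $\rho\colon H\otimes A\to A$ with $\rho(1\otimes a)=a$, $\rho(h\otimes 1)=\epsilon(h)1$,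 $t(H\otimes\rho)=(\rho\otimes H)(H\otimes t)(c\otimes A)$ and $\rho(H\otimes\mu_A)=\mu_A(\rho\otimes\rho)(H\otimes t\otimes A)(\Delta\otimes A\otimes A)$. A linear map $\sigma\colon H\otimes H\to A$ is normal if $\sigma(1\otimes h)=\sigma(h\otimes 1)=\epsilon(h)1$, and compatible with $t$ if $t(H\otimes\sigma)=(\sigma\otimes H)(H\otimes c)(c\otimes H)$. With $X:=(\rho\otimes H)(H\otimes t)(\Delta\otimes A)$ and $F:=(\sigma\otimes\mu_H)(H\otimes c\otimes H)(\Delta\otimes\Delta)$, it is a cocycle if $\mu_A(A\otimes\sigma)(X\otimes H)(H\otimes F)=\mu_A(A\otimes\sigma)(F\otimes H)$, and satisfies the twisted module condition if $\mu_A(A\otimes\sigma)(X\otimes H)(H\otimes X)=\mu_A(A\otimes\rho)(F\otimes A)$. Let $b_x\in B$ and let $(b_g)_{g\in G}$ be a family of units of $B$ with $b_1=1_B$, such that (a) $b_g\in B_{g,\mathrm{id}}\cap\ker U$ for all $g$; (b) $b_x\in B_{z,\mathrm{id}}$ and $U(b_x)=1_B$; (c) $\alpha(b_x)=q\,b_x$;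 (d) $\alpha(b_g)=b_g$ for all $g$. Then: (1) $B$ is a free left $C$-module with basis $\{b_gb_x^i: g\in G,\ 0\le i<n\}$. (2) For every $g\in G$, $b_g^{|g|}$ is a unit of $C$ and $(b_xb_g-\chi(g)b_gb_x)b_g^{-1}b_z^{-1}\in C$. If $x^n=0$ in $H$, then $b_x^n\,b_z^{|z|-n}\in C$. (Here $|g|$ is the order of $g$; the exponent $|z|-n$ may be negative.) (3) The linear map $\gamma\colon H\to B$ with $\gamma(gx^i)=b_gb_x^i$ $(0\le i<n)$ is a cleft map: it is $H$-colinear, satisfies $(\gamma\otimes H)c=s(H\otimes\gamma)$, and has a convolution inverse $\gamma^{-1}$; in particular the extension $C\hookrightarrow B$ is cleft. The map $s$ restricts to a left transposition $s_C\colon H\otimes C\to C\otimes H$, and there is a weak action $\rho=(\rightharpoonup)\colon H\otimes C\to C$ of $H$ on $(C,s_C)$, determined by $\rho=\mu_B(\mu_B\otimes B)(\gamma\otimes C\otimes\gamma^{-1})(H\otimes s_C)(\Delta\otimes C)$. For $0\le i<n$, $g\in G$, $\zeta\in\mathrm{Aut}_{\chi,z}(G)$ and $c\in C\cap B_{1_G,\zeta}\cap\ker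 U$, $$gx^i\rightharpoonup c=\sum_{j=0}^i(-1)^j(qp)^{\frac{j(j-1)}2}\binom ij_{qp}\,b_gb_x^{i-j}\,\alpha^j(c)\,b_x^j\,b_{\zeta(g)z^i}^{-1}.$$ (4) There is a normal cocycle $\sigma\colon H\otimes H\to C$, compatible with $s_C$ and satisfying the twisted module condition with respect to $\rho$, determined by $\sigma=\mu_B(\mu_B\otimes\gamma^{-1})(\gamma\otimes\gamma\otimes\mu_H)(H\otimes c\otimes H)(\Delta\otimes\Delta)$. For $g,h\in G$ and $0\le m,r<n$, with $\xi_{ij}:=m+r-i-j$ and $K_{ij}(e):=(-1)^e\binom mi_{qp}\binom rj_{qp}(qp)^{\frac{e(e-1)}2+(m-i)j}\chi(h)^{m-i}$, $$\begin{aligned}\sigma(gx^m\otimes hx^r)={}&\sum_{\substack{0\le i\le m,\ 0\le j\le r\\ \xi_{ij}<n}}K_{ij}(\xi_{ij})\,b_gb_x^ib_hb_x^{m+r-i}b_{ghz^{m+r}}^{-1}\\&+\lambda\sum_{\substack{0\le i\le m,\ 0\le j\le r\\ \xi_{ij}\ge n}}K_{ij}(\xi_{ij}-n)\,b_gb_x^ib_hb_x^{m+r-i-n}b_{ghz^{m+r}}^{-1}\\&-\lambda\sum_{\substack{0\le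 i\le m,\ 0\le j\le r\\ \xi_{ij}\ge n}}K_{ij}(\xi_{ij}-n)\,b_gb_x^ib_hb_x^{m+r-i-n}b_{ghz^{m+r-n}}^{-1}.\end{aligned}$$ -/

import Mathlib

open scoped TensorProduct

/-! ### Gaussian binomial coefficients -/

/-- The Gaussian binomial coefficient, evaluated at an element `q` of a commutative ring. -/
def gaussBinom {R : Type*} [CommRing R] (q : R) : ℕ → ℕ → R
  | _, 0 => 1
  | 0, _ + 1 => 0
  | i + 1, j + 1 => q ^ (i - j) * gaussBinom q i j + gaussBinom q i (j + 1)

namespace GaussAux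

variable {R : Type*} [CommRing R]

lemma zero_right (q : R) (i : ℕ) : gaussBinom q i 0 = 1 := by
  cases i <;> rfl

lemma eq_zero (q : R) : ∀ i j : ℕ, i < j → gaussBinom q i j = 0
  | 0, j + 1, _ => rfl
  | i + 1, j + 1, h => by
    have h' : i < j := by omega
    rw [gaussBinom, eq_zero q i j h', eq_zero q i (j + 1) (by omega)]
    simp

lemma self (q : R) : ∀ i : ℕ, gaussBinom q i i = 1
  | 0 => rfl
  | i + 1 => by
    rw [gaussBinom, self q i, eq_zero q i (i + 1) (by omega)]
    simp

/-- The `q`-factorial. -/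
def qFac (q : R) : ℕ → R
  | 0 => 1
  | i + 1 => qFac q i * ∑ j ∈ Finset.range (i + 1), q ^ j

lemma mul_qFac (q : R) : ∀ m a b : ℕ, a + b = m →
    gaussBinom q m a * (qFac q a * qFac q b) = qFac q m
  | m, 0, b, h => by
    obtain rfl : b = m := by omega
    simp [zero_right, qFac]
  | m, a + 1, 0, h => by
    obtain rfl : a + 1 = m := by omega
    simp [self, qFac]
  | m, a + 1, b + 1, h => by
    obtain rfl : m = (a + b + 1) + 1 := by omega
    have h1 := mul_qFac q (a + b + 1) a (b + 1) (by omega)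
    have h2 := mul_qFac q (a + b + 1) (a + 1) b (by omega)
    have e : a + b + 1 - a = b + 1 := by omega
    have hs : ∑ j ∈ Finset.range (a + b + 1 + 1), q ^ j
        = ∑ j ∈ Finset.range (b + 1), q ^ j + q ^ (b + 1) * ∑ j ∈ Finset.range (a + 1), q ^ j := by
      rw [show a + b + 1 + 1 = (b + 1) + (a + 1) by omega, Finset.sum_range_add, Finset.mul_sum]
      simp [pow_add]
    rw [gaussBinom, e]
    simp only [qFac, hs] at h1 h2 ⊢
    linear_combination (q ^ (b + 1) * ∑ j ∈ Finset.range (a + 1), q ^ j) * h1 +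
      (∑ j ∈ Finset.range (b + 1), q ^ j) * h2

lemma map_gaussBinom {S : Type*} [CommRing S] (f : R →+* S) (q : R) :
    ∀ i j : ℕ, f (gaussBinom q i j) = gaussBinom (f q) i j
  | i, 0 => by simp [zero_right]
  | 0, j + 1 => by simp [gaussBinom]
  | i + 1, j + 1 => by
    simp [gaussBinom, map_gaussBinom f q i j, map_gaussBinom f q i (j + 1)]

lemma map_qFac {S : Type*} [CommRing S] (f : R →+* S) (q : R) :
    ∀ i : ℕ, f (qFac q i) = qFac (f q) i
  | 0 => by simp [qFac]
  | i + 1 => by simp [qFac, map_qFac f q i]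

lemma qFac_X_ne_zero (i : ℕ) : qFac (Polynomial.X : Polynomial ℤ) i ≠ 0 := by
  intro h
  have h2 : ∀ i : ℕ, qFac (1 : ℤ) i ≠ 0 := by
    intro i
    induction i with
    | zero => simp [qFac]
    | succ i ih =>
      simp only [qFac, one_pow, Finset.sum_const, Finset.card_range]
      exact mul_ne_zero ih (by simp; omega)
  apply h2 i
  have := congrArg (Polynomial.evalRingHom (1 : ℤ)) h
  rwa [map_qFac, map_zero, Polynomial.coe_evalRingHom, Polynomial.eval_X] at this

lemma trinomial (q : R) (a b c : ℕ) :
    gaussBinom q (a + b + c) (a + b) * gaussBinom q (a + b) a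
      = gaussBinom q (a + b + c) a * gaussBinom q (b + c) b := by
  have key : gaussBinom (Polynomial.X : Polynomial ℤ) (a + b + c) (a + b) *
        gaussBinom Polynomial.X (a + b) a
      = gaussBinom Polynomial.X (a + b + c) a * gaussBinom Polynomial.X (b + c) b := by
    have h1 := mul_qFac (Polynomial.X : Polynomial ℤ) (a + b + c) (a + b) c rfl
    have h2 := mul_qFac (Polynomial.X : Polynomial ℤ) (a + b) a b rfl
    have h3 := mul_qFac (Polynomial.X : Polynomial ℤ) (a + b + c) a (b + c) (by omega)
    have h4 := mul_qFac (Polynomial.X : Polynomial ℤ) (b + c) b c rfl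
    apply mul_right_cancel₀ (mul_ne_zero (mul_ne_zero (qFac_X_ne_zero a) (qFac_X_ne_zero b))
      (qFac_X_ne_zero c))
    rw [← h2] at h1
    rw [← h4] at h3
    linear_combination h1 - h3
  have := congrArg (Polynomial.eval₂RingHom (Int.castRingHom R) q) key
  rw [map_mul, map_mul, map_gaussBinom, map_gaussBinom, map_gaussBinom, map_gaussBinom,
    Polynomial.coe_eval₂RingHom, Polynomial.eval₂_X] at this
  exact this

end GaussAux

/-! ### Braided notions over a braided bialgebra `(H, c)` -/

namespace Braided

open Coalgebra LinearMap TensorProduct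

section Maps

variable {k : Type*} [Field k]
variable {P Q R S V W X Y A H : Type*}
variable [AddCommGroup P] [Module k P] [AddCommGroup Q] [Module k Q]
variable [AddCommGroup R] [Module k R] [AddCommGroup S] [Module k S]
variable [AddCommGroup V] [Module k V] [AddCommGroup W] [Module k W]
variable [AddCommGroup X] [Module k X] [AddCommGroup Y] [Module k Y]
variable [AddCommGroup H] [Module k H]

/-- `X ⊗ f ⊗ Y`, bracketed as `(X ⊗ P) ⊗ (Q ⊗ Y) → (X ⊗ R) ⊗ (S ⊗ Y)`. -/
noncomputable def midMap (f : P ⊗[k] Q →ₗ[k] R ⊗[k] S) :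
    (X ⊗[k] P) ⊗[k] (Q ⊗[k] Y) →ₗ[k] (X ⊗[k] R) ⊗[k] (S ⊗[k] Y) :=
  (TensorProduct.assoc k X R (S ⊗[k] Y)).symm.toLinearMap ∘ₗ
    ((TensorProduct.assoc k R S Y).toLinearMap ∘ₗ f.rTensor Y ∘ₗ
      (TensorProduct.assoc k P Q Y).symm.toLinearMap).lTensor X ∘ₗ
    (TensorProduct.assoc k X P (Q ⊗[k] Y)).toLinearMap

/-- `(s ⊗ H) ∘ (H ⊗ s) : H ⊗ H ⊗ V → V ⊗ H ⊗ H`. -/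
noncomputable def passTwo (s : H ⊗[k] V →ₗ[k] V ⊗[k] H) :
    (H ⊗[k] H) ⊗[k] V →ₗ[k] V ⊗[k] (H ⊗[k] H) :=
  (TensorProduct.assoc k V H H).toLinearMap ∘ₗ s.rTensor H ∘ₗ
    (TensorProduct.assoc k H V H).symm.toLinearMap ∘ₗ s.lTensor H ∘ₗ
    (TensorProduct.assoc k H H V).toLinearMap

/-- `(V ⊗ t) ∘ (s ⊗ W) : H ⊗ V ⊗ W → V ⊗ W ⊗ H`. -/
noncomputable def passPair (s : H ⊗[k] V →ₗ[k] V ⊗[k] H) (t : H ⊗[k] W →ₗ[k] W ⊗[k] H) :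
    H ⊗[k] (V ⊗[k] W) →ₗ[k] (V ⊗[k] W) ⊗[k] H :=
  (TensorProduct.assoc k V W H).symm.toLinearMap ∘ₗ t.lTensor V ∘ₗ
    (TensorProduct.assoc k V H W).toLinearMap ∘ₗ s.rTensor W ∘ₗ
    (TensorProduct.assoc k H V W).symm.toLinearMap

/-- `μ_A ∘ (A ⊗ f) ∘ (t ⊗ W) : P ⊗ Q ⊗ W → A`. -/
noncomputable def slide [Ring A] [Algebra k A] (t : P ⊗[k] Q →ₗ[k] A ⊗[k] R)
    (f : R ⊗[k] W →ₗ[k] A) : P ⊗[k] (Q ⊗[k] W) →ₗ[k] A :=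
  mul' k A ∘ₗ f.lTensor A ∘ₗ (TensorProduct.assoc k A R W).toLinearMap ∘ₗ t.rTensor W ∘ₗ
    (TensorProduct.assoc k P Q W).symm.toLinearMap

@[simp] lemma midMap_tmul (f : P ⊗[k] Q →ₗ[k] R ⊗[k] S) (a : X) (p : P) (q : Q) (b : Y) :
    midMap f ((a ⊗ₜ[k] p) ⊗ₜ[k] (q ⊗ₜ[k] b))
      = (TensorProduct.assoc k X R (S ⊗[k] Y)).symm
          (a ⊗ₜ[k] (TensorProduct.assoc k R S Y) (f (p ⊗ₜ[k] q) ⊗ₜ[k] b)) := by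
  simp [midMap]

end Maps

section Bialgebra

variable {k H V A : Type*} [Field k] [Ring H] [Algebra k H] [Coalgebra k H]
variable [AddCommGroup V] [Module k V] [Ring A] [Algebra k A]

/-- `(V, s)` is a left `H`-space: `s` is bijective and compatible with the unit, the multiplication,
the counit, the comultiplication and the braid `c` of `H`. -/
structure IsLeftSpace (c : H ⊗[k] H →ₗ[k] H ⊗[k] H) (s : H ⊗[k] V →ₗ[k] V ⊗[k] H) : Prop where
  bijective : Function.Bijective s
  unit : ∀ v : V, s (1 ⊗ₜ[k] v) = v ⊗ₜ[k] 1
  mul : s ∘ₗ (mul' k H).rTensor V = (mul' k H).lTensor V ∘ₗ passTwo s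
  counit : (TensorProduct.rid k V).toLinearMap ∘ₗ (counit (R := k) (A := H)).lTensor V ∘ₗ s
    = (TensorProduct.lid k V).toLinearMap ∘ₗ (counit (R := k) (A := H)).rTensor V
  comul : (comul (R := k) (A := H)).lTensor V ∘ₗ s
    = passTwo s ∘ₗ (comul (R := k) (A := H)).rTensor V
  braid : passTwo s ∘ₗ c.rTensor V = c.lTensor V ∘ₗ passTwo s

/-- `s` is a left transposition of `H` on the algebra `A`: moreover `s` is compatible with the unit and
the multiplication of `A`. -/
structure IsLeftTransposition (c : H ⊗[k] H →ₗ[k] H ⊗[k] H) (s : H ⊗[k] A →ₗ[k] A ⊗[k] H) : Prop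
    extends IsLeftSpace c s where
  alg_unit : ∀ h : H, s (h ⊗ₜ[k] 1) = 1 ⊗ₜ[k] h
  alg_mul : s ∘ₗ (mul' k A).lTensor H = (mul' k A).rTensor H ∘ₗ passPair s s

/-- `(V, s)` with the coaction `ν` is a right `H`-comodule. -/
structure IsComodule (c : H ⊗[k] H →ₗ[k] H ⊗[k] H) (s : H ⊗[k] V →ₗ[k] V ⊗[k] H)
    (ν : V →ₗ[k] V ⊗[k] H) : Prop where
  coassoc : (TensorProduct.assoc k V H H).toLinearMap ∘ₗ ν.rTensor H ∘ₗ ν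
    = (comul (R := k) (A := H)).lTensor V ∘ₗ ν
  counit : (TensorProduct.rid k V).toLinearMap ∘ₗ (counit (R := k) (A := H)).lTensor V ∘ₗ ν
    = LinearMap.id
  compat : ν.rTensor H ∘ₗ s = passPair s c ∘ₗ ν.lTensor H

/-- The multiplication of `A ⊗_s H`. -/
noncomputable def twMul (s : H ⊗[k] A →ₗ[k] A ⊗[k] H) :
    (A ⊗[k] H) ⊗[k] (A ⊗[k] H) →ₗ[k] A ⊗[k] H :=
  TensorProduct.map (mul' k A) (mul' k H) ∘ₗ midMap s

/-- `(A, s)` with the coaction `ν` is a right `H`-comodule algebra. -/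
structure IsComoduleAlgebra (c : H ⊗[k] H →ₗ[k] H ⊗[k] H) (s : H ⊗[k] A →ₗ[k] A ⊗[k] H)
    (ν : A →ₗ[k] A ⊗[k] H) : Prop where
  transposition : IsLeftTransposition c s
  comodule : IsComodule c s ν
  mul : ν ∘ₗ mul' k A = twMul s ∘ₗ TensorProduct.map ν ν
  one : ν 1 = 1 ⊗ₜ[k] 1

lemma twMul_coinv (s : H ⊗[k] A →ₗ[k] A ⊗[k] H) (hs : ∀ v : A, s (1 ⊗ₜ[k] v) = v ⊗ₜ[k] 1)
    (a b : A) : twMul s ((a ⊗ₜ[k] 1) ⊗ₜ[k] (b ⊗ₜ[k] 1)) = (a * b) ⊗ₜ[k] 1 := by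
  simp [twMul, hs]

/-- The algebra of coinvariants of a right `H`-comodule algebra. -/
noncomputable def coinvariants {c : H ⊗[k] H →ₗ[k] H ⊗[k] H} {s : H ⊗[k] A →ₗ[k] A ⊗[k] H}
    {ν : A →ₗ[k] A ⊗[k] H} (hA : IsComoduleAlgebra c s ν) : Subalgebra k A where
  carrier := {a | ν a = a ⊗ₜ[k] 1}
  mul_mem' := by
    intro a b ha hb
    have h := LinearMap.congr_fun hA.mul (a ⊗ₜ[k] b)
    simp only [LinearMap.comp_apply, mul'_apply, TensorProduct.map_tmul] at h
    simp only [Set.mem_ofPred_eq] at ha hb ⊢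
    rw [h, ha, hb, twMul_coinv s hA.transposition.unit]
  add_mem' := by
    intro a b ha hb
    simp only [Set.mem_ofPred_eq] at ha hb ⊢
    rw [map_add, ha, hb, TensorProduct.add_tmul]
  algebraMap_mem' := by
    intro r
    simp only [Set.mem_ofPred_eq, Algebra.algebraMap_eq_smul_one, map_smul, hA.one,
      TensorProduct.smul_tmul']

/-- A cleft map `γ : (H, c) → (A, s)` of a right `H`-comodule algebra: a morphism of right `H`-comodules
(colinear and compatible with `c` and `s`) that is convolution invertible. -/
structure IsCleftMap (c : H ⊗[k] H →ₗ[k] H ⊗[k] H) (s : H ⊗[k] A →ₗ[k] A ⊗[k] H)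
    (ν : A →ₗ[k] A ⊗[k] H) (γ : H →ₗ[k] A) : Prop where
  colinear : ν ∘ₗ γ = γ.rTensor H ∘ₗ comul
  compat : γ.rTensor H ∘ₗ c = s ∘ₗ γ.lTensor H
  convInvertible : IsUnit (WithConv.toConv γ)

/-- `ρ` is a weak action of `H` on `(A, s)`. -/
structure IsWeakAction (c : H ⊗[k] H →ₗ[k] H ⊗[k] H) (s : H ⊗[k] A →ₗ[k] A ⊗[k] H)
    (ρ : H ⊗[k] A →ₗ[k] A) : Prop where
  transposition : IsLeftTransposition c s
  one_act : ∀ a : A, ρ (1 ⊗ₜ[k] a) = a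
  compat : s ∘ₗ ρ.lTensor H = ρ.rTensor H ∘ₗ passPair c s
  act_mul : ρ ∘ₗ (mul' k A).lTensor H
    = mul' k A ∘ₗ TensorProduct.map ρ ρ ∘ₗ midMap s ∘ₗ (comul (R := k) (A := H)).rTensor (A ⊗[k] A)
  act_one : ∀ h : H, ρ (h ⊗ₜ[k] 1) = algebraMap k A (counit h)

/-- `Δ_{H ⊗^c H} = (H ⊗ c ⊗ H) ∘ (Δ ⊗ Δ)`. -/
noncomputable def comulTwo (c : H ⊗[k] H →ₗ[k] H ⊗[k] H) :
    H ⊗[k] H →ₗ[k] (H ⊗[k] H) ⊗[k] (H ⊗[k] H) :=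
  midMap c ∘ₗ TensorProduct.map (comul (R := k) (A := H)) (comul (R := k) (A := H))

/-- `(ρ ⊗ H) ∘ (H ⊗ s) ∘ (Δ ⊗ A) : H ⊗ A → A ⊗ H`. -/
noncomputable def crossAct (s : H ⊗[k] A →ₗ[k] A ⊗[k] H) (ρ : H ⊗[k] A →ₗ[k] A) :
    H ⊗[k] A →ₗ[k] A ⊗[k] H :=
  ρ.rTensor H ∘ₗ (TensorProduct.assoc k H A H).symm.toLinearMap ∘ₗ s.lTensor H ∘ₗ
    (TensorProduct.assoc k H H A).toLinearMap ∘ₗ (comul (R := k) (A := H)).rTensor A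

/-- `(σ ⊗ μ_H) ∘ Δ_{H ⊗^c H} : H ⊗ H → A ⊗ H`. -/
noncomputable def crossCoc (c : H ⊗[k] H →ₗ[k] H ⊗[k] H) (σ : H ⊗[k] H →ₗ[k] A) :
    H ⊗[k] H →ₗ[k] A ⊗[k] H :=
  TensorProduct.map σ (mul' k H) ∘ₗ comulTwo c

/-- `σ : H ⊗ H → A` is a normal cocycle, compatible with `s`, that satisfies the twisted module
condition with respect to the weak action `ρ`. Braiding `H` past `σ(H ⊗ H)` and `ρ(H ⊗ A)` is written
with `s`; by the compatibility of `σ` and `ρ` with `s` this is the same as braiding it past each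
argument separately. -/
structure IsCocycle (c : H ⊗[k] H →ₗ[k] H ⊗[k] H) (s : H ⊗[k] A →ₗ[k] A ⊗[k] H)
    (ρ : H ⊗[k] A →ₗ[k] A) (σ : H ⊗[k] H →ₗ[k] A) : Prop where
  normal_left : ∀ h : H, σ (1 ⊗ₜ[k] h) = algebraMap k A (counit h)
  normal_right : ∀ h : H, σ (h ⊗ₜ[k] 1) = algebraMap k A (counit h)
  compat : s ∘ₗ σ.lTensor H = σ.rTensor H ∘ₗ passPair c c
  cocycle : slide (crossAct s ρ) σ ∘ₗ (crossCoc c σ).lTensor H = slide (crossCoc c σ) σ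
  twisted : slide (crossAct s ρ) σ ∘ₗ (crossAct s ρ).lTensor H = slide (crossCoc c σ) ρ

/-- `μ ∘ (μ ⊗ A) ∘ (γ ⊗ A ⊗ γ') ∘ (H ⊗ s) ∘ (Δ ⊗ A) : H ⊗ A → A`. -/
noncomputable def cleftAct (s : H ⊗[k] A →ₗ[k] A ⊗[k] H) (γ γ' : H →ₗ[k] A) :
    H ⊗[k] A →ₗ[k] A :=
  mul' k A ∘ₗ TensorProduct.map γ (mul' k A ∘ₗ γ'.lTensor A ∘ₗ s) ∘ₗ
    (TensorProduct.assoc k H H A).toLinearMap ∘ₗ (comul (R := k) (A := H)).rTensor A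

/-- `μ ∘ (μ ⊗ γ') ∘ (γ ⊗ γ ⊗ μ_H) ∘ Δ_{H ⊗^c H} : H ⊗ H → A`. -/
noncomputable def cleftCoc (c : H ⊗[k] H →ₗ[k] H ⊗[k] H) (γ γ' : H →ₗ[k] A) :
    H ⊗[k] H →ₗ[k] A :=
  mul' k A ∘ₗ TensorProduct.map (mul' k A ∘ₗ TensorProduct.map γ γ) (γ' ∘ₗ mul' k H) ∘ₗ comulTwo c

/-- `ρ` and `σ` are the weak action of `H` on the coinvariants `C` of `(A, s)` and the cocycle with
values in `C` that are associated with the cleft map `γ` with convolution inverse `γ'`; `sC` is the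
transposition of `H` on `C` induced by `s`. -/
structure IsAssociated {c : H ⊗[k] H →ₗ[k] H ⊗[k] H} {s : H ⊗[k] A →ₗ[k] A ⊗[k] H}
    {ν : A →ₗ[k] A ⊗[k] H} (hA : IsComoduleAlgebra c s ν) (γ γ' : H →ₗ[k] A)
    (sC : H ⊗[k] coinvariants hA →ₗ[k] coinvariants hA ⊗[k] H)
    (ρ : H ⊗[k] coinvariants hA →ₗ[k] coinvariants hA)
    (σ : H ⊗[k] H →ₗ[k] coinvariants hA) : Prop where
  conv_left : WithConv.toConv γ' * WithConv.toConv γ = 1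
  conv_right : WithConv.toConv γ * WithConv.toConv γ' = 1
  restrict : (coinvariants hA).val.toLinearMap.rTensor H ∘ₗ sC
    = s ∘ₗ (coinvariants hA).val.toLinearMap.lTensor H
  act : (coinvariants hA).val.toLinearMap ∘ₗ ρ
    = cleftAct s γ γ' ∘ₗ (coinvariants hA).val.toLinearMap.lTensor H
  coc : (coinvariants hA).val.toLinearMap ∘ₗ σ = cleftCoc c γ γ'

end Bialgebra

end Braided

/-! ### The braided Hopf algebra of a datum -/

/-- A datum `(G, χ, z, λ, q)`: `G` is a group, `χ` a character, `z` a central element, `λ = lam` a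
scalar, `q` a non-zero scalar, such that `q χ(z)` is a root of unity of order `n > 1`, and `χ ^ n = 1`
whenever `λ (z ^ n - 1) ≠ 0` in the group algebra. -/
structure HopfDatum (k G : Type*) [Field k] [Group G] where
  χ : G →* kˣ
  z : G
  lam : k
  q : kˣ
  n : ℕ
  one_lt_n : 1 < n
  z_central : z ∈ Subgroup.center G
  prim : IsPrimitiveRoot (q * χ z) n
  chi_pow : lam • (MonoidAlgebra.of k G (z ^ n) - 1) ≠ 0 → χ ^ n = 1

namespace HopfDatum

variable {k G : Type*} [Field k] [Group G] (D : HopfDatum k G)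

/-- The scalar `q p = q χ(z)`. -/
def qp : k := ((D.q * D.χ D.z : kˣ) : k)

/-- The underlying space of the braided Hopf algebra `H_D`: it has basis `g x ^ i` with
`g ∈ G`, `0 ≤ i < n`. -/
def H (D : HopfDatum k G) : Type _ := (G × Fin D.n) →₀ k

noncomputable instance : AddCommGroup D.H := inferInstanceAs (AddCommGroup ((G × Fin D.n) →₀ k))

noncomputable instance : Module k D.H := inferInstanceAs (Module k ((G × Fin D.n) →₀ k))

/-- The basis `g x ^ i` of `H_D`. -/
noncomputable def basis : Module.Basis (G × Fin D.n) k D.H := Module.Basis.ofRepr (LinearEquiv.refl k _)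

/-- The element `g x ^ m` of `H_D` for an arbitrary exponent `m`, rewritten in the basis by means of
`x ^ n = λ (z ^ n - 1)`. -/
noncomputable def mon (g : G) (m : ℕ) : D.H :=
  if h : m < D.n then D.basis (g, ⟨m, h⟩)
  else D.lam • (mon (g * D.z ^ D.n) (m - D.n) - mon g (m - D.n))
termination_by m
decreasing_by all_goals (have := D.one_lt_n; omega)

lemma mon_lt (g : G) (i : Fin D.n) : D.mon g i = D.basis (g, i) := by
  rw [mon]; simp

lemma mon_add (g : G) (m : ℕ) :
    D.mon g (m + D.n) = D.lam • (D.mon (g * D.z ^ D.n) m - D.mon g m) := by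
  rw [mon]; simp

/-- The multiplication of `H_D`: `g x ^ i · h x ^ j = χ(h) ^ i g h x ^ (i + j)`. -/
noncomputable def mulMap : D.H →ₗ[k] D.H →ₗ[k] D.H :=
  D.basis.constr k fun a => D.basis.constr k fun b =>
    ((D.χ b.1 : k) ^ (a.2 : ℕ)) • D.mon (a.1 * b.1) (a.2 + b.2)

lemma mulMap_basis (a b : G × Fin D.n) : D.mulMap (D.basis a) (D.basis b)
    = ((D.χ b.1 : k) ^ (a.2 : ℕ)) • D.mon (a.1 * b.1) (a.2 + b.2) := by
  simp [mulMap]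

lemma cases_chi : D.lam = 0 ∨ D.z ^ D.n = 1 ∨ D.χ ^ D.n = 1 := by
  by_cases h1 : D.lam = 0
  · exact Or.inl h1
  by_cases h2 : D.z ^ D.n = 1
  · exact Or.inr (Or.inl h2)
  · refine Or.inr (Or.inr (D.chi_pow ?_))
    refine smul_ne_zero h1 (sub_ne_zero.2 ?_)
    rw [← map_one (MonoidAlgebra.of k G)]
    exact fun h => h2 (MonoidAlgebra.of_injective h)

lemma z_comm (g : G) : g * D.z ^ D.n = D.z ^ D.n * g :=
  (Subgroup.mem_center_iff.1 (Subgroup.pow_mem _ D.z_central _) g)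

lemma chi_pow_apply (h : D.χ ^ D.n = 1) (g : G) : (D.χ g : k) ^ D.n = 1 := by
  have := congrArg Units.val (DFunLike.congr_fun h g)
  simpa using this

lemma mulMap_basis_mon (a : G × Fin D.n) (h : G) (l : ℕ) : D.mulMap (D.basis a) (D.mon h l)
    = ((D.χ h : k) ^ (a.2 : ℕ)) • D.mon (a.1 * h) (a.2 + l) := by
  induction l using Nat.strong_induction_on generalizing h with
  | _ l ih =>
    by_cases hl : l < D.n
    · have := D.mulMap_basis a (h, ⟨l, hl⟩)
      rwa [← D.mon_lt h] at this
    · obtain ⟨m, rfl⟩ : ∃ m, l = m + D.n := ⟨l - D.n, by omega⟩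
      have hm : m < m + D.n := by have := D.one_lt_n; omega
      rw [← add_assoc, mon_add, mon_add, map_smul, map_sub, ih m hm, ih m hm, ← mul_assoc]
      rcases D.cases_chi with h0 | h0 | h0
      · simp [h0]
      · simp [h0]
      · have hz : (D.χ (D.z ^ D.n) : k) = 1 := by
          rw [map_pow, Units.val_pow_eq_pow_val, D.chi_pow_apply h0]
        rw [map_mul, Units.val_mul, hz, mul_one, ← smul_sub, smul_comm]

lemma mulMap_mon (g h : G) (m l : ℕ) : D.mulMap (D.mon g m) (D.mon h l)
    = ((D.χ h : k) ^ m) • D.mon (g * h) (m + l) := by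
  induction m using Nat.strong_induction_on generalizing g with
  | _ m ih =>
    by_cases hl : m < D.n
    · have := D.mulMap_basis_mon (g, ⟨m, hl⟩) h l
      rwa [← mon_lt] at this
    · obtain ⟨m, rfl⟩ : ∃ m', m = m' + D.n := ⟨m - D.n, by omega⟩
      have hm : m < m + D.n := by have := D.one_lt_n; omega
      rw [mon_add, show m + D.n + l = m + l + D.n by omega, mon_add, map_smul, map_sub,
        LinearMap.smul_apply, LinearMap.sub_apply, ih m hm, ih m hm, mul_assoc g, ← z_comm,
        ← mul_assoc]
      rcases D.cases_chi with h0 | h0 | h0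
      · simp [h0]
      · simp [h0]
      · rw [pow_add, D.chi_pow_apply h0, mul_one, ← smul_sub, smul_comm]

lemma mulMap_assoc (a b c : D.H) :
    D.mulMap (D.mulMap a b) c = D.mulMap a (D.mulMap b c) := by
  have : D.mulMap.compr₂ D.mulMap
      = (LinearMap.lcomp k _ D.mulMap) ∘ₗ (LinearMap.llcomp k D.H D.H D.H) ∘ₗ D.mulMap := by
    refine D.basis.ext fun a => D.basis.ext fun b => D.basis.ext fun c => ?_
    obtain ⟨g, i⟩ := a
    obtain ⟨h, j⟩ := b
    obtain ⟨f, l⟩ := c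
    simp only [LinearMap.compr₂_apply, LinearMap.comp_apply, LinearMap.lcomp_apply,
      LinearMap.llcomp_apply]
    rw [← D.mon_lt g, ← D.mon_lt h, ← D.mon_lt f]
    simp only [mulMap_mon, map_smul, LinearMap.smul_apply, smul_smul, map_mul, Units.val_mul,
      mul_pow, pow_add, mul_assoc, add_assoc]
    congr 1
    ring
  exact LinearMap.congr_fun (LinearMap.congr_fun (LinearMap.congr_fun this a) b) c

lemma mulMap_one (a : D.H) : D.mulMap a (D.mon 1 0) = a := by
  have : D.mulMap.flip (D.mon 1 0) = LinearMap.id := by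
    refine D.basis.ext fun a => ?_
    rw [← mon_lt]
    simp [mulMap_mon]
  exact LinearMap.congr_fun this a

lemma one_mulMap (a : D.H) : D.mulMap (D.mon 1 0) a = a := by
  have : D.mulMap (D.mon 1 0) = LinearMap.id := by
    refine D.basis.ext fun a => ?_
    rw [← mon_lt]
    simp [mulMap_mon]
  exact LinearMap.congr_fun this a

noncomputable instance : Ring D.H :=
  { (inferInstance : AddCommGroup D.H) with
    mul := fun a b => D.mulMap a b
    one := D.mon 1 0
    left_distrib := fun a b c => map_add (D.mulMap a) b c
    right_distrib := fun a b c => LinearMap.map_add₂ D.mulMap a b c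
    zero_mul := fun a => LinearMap.map_zero₂ D.mulMap a
    mul_zero := fun a => map_zero (D.mulMap a)
    mul_assoc := D.mulMap_assoc
    one_mul := D.one_mulMap
    mul_one := D.mulMap_one }

lemma mul_def (a b : D.H) : a * b = D.mulMap a b := rfl

lemma one_def : (1 : D.H) = D.mon 1 0 := rfl

noncomputable instance : Algebra k D.H :=
  Algebra.ofModule (fun r a b => LinearMap.map_smul₂ D.mulMap r a b)
    (fun r a b => map_smul (D.mulMap a) r b)

/-- The image of the group element `g` in `H_D`. -/
noncomputable def grp (g : G) : D.H := D.mon g 0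

/-- The generator `x` of `H_D`. -/
noncomputable def x : D.H := D.mon 1 1

lemma x_pow (i : ℕ) : D.x ^ i = D.mon 1 i := by
  induction i with
  | zero => rw [pow_zero, one_def]
  | succ i ih => rw [pow_succ, ih, x, mul_def, mulMap_mon]; simp

lemma grp_mul_x_pow (g : G) (i : ℕ) : D.grp g * D.x ^ i = D.mon g i := by
  rw [x_pow, grp, mul_def, mulMap_mon]; simp

lemma grp_mul_x_pow_fin (g : G) (i : Fin D.n) : D.grp g * D.x ^ (i : ℕ) = D.basis (g, i) := by
  rw [grp_mul_x_pow, mon_lt]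

lemma grp_mul (g h : G) : D.grp g * D.grp h = D.grp (g * h) := by
  rw [grp, grp, grp, mul_def, mulMap_mon]; simp

lemma grp_one : D.grp 1 = 1 := rfl

lemma x_mul_grp (g : G) : D.x * D.grp g = (D.χ g : k) • (D.grp g * D.x) := by
  rw [x, grp, mul_def, mul_def, mulMap_mon, mulMap_mon]; simp

lemma x_pow_n : D.x ^ D.n = D.lam • (D.grp (D.z ^ D.n) - 1) := by
  have := D.mon_add 1 0
  rw [x_pow, grp, one_def]
  simpa using this

/-- The comultiplication of `H_D`:
`Δ(g x ^ i) = ∑ j ≤ i, binom(i, j)_{qp} g x ^ j ⊗ g z ^ j x ^ (i - j)`. -/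
noncomputable def comulMap : D.H →ₗ[k] D.H ⊗[k] D.H :=
  D.basis.constr k fun a => ∑ j ∈ Finset.range ((a.2 : ℕ) + 1),
    gaussBinom D.qp a.2 j • (D.mon a.1 j ⊗ₜ[k] D.mon (a.1 * D.z ^ j) (a.2 - j))

/-- The counit of `H_D`. -/
noncomputable def counitMap : D.H →ₗ[k] k :=
  D.basis.constr k fun a => if (a.2 : ℕ) = 0 then 1 else 0

lemma comulMap_mon (g : G) (i : ℕ) (hi : i < D.n) : D.comulMap (D.mon g i)
    = ∑ j ∈ Finset.range (i + 1),
      gaussBinom D.qp i j • (D.mon g j ⊗ₜ[k] D.mon (g * D.z ^ j) (i - j)) := by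
  have := D.mon_lt g ⟨i, hi⟩
  simp only at this
  rw [this, comulMap, Module.Basis.constr_basis]

lemma counitMap_mon (g : G) (i : ℕ) (hi : i < D.n) :
    D.counitMap (D.mon g i) = if i = 0 then 1 else 0 := by
  have := D.mon_lt g ⟨i, hi⟩
  simp only at this
  rw [this, counitMap, Module.Basis.constr_basis]

noncomputable instance : CoalgebraStruct k D.H where
  comul := D.comulMap
  counit := D.counitMap

lemma comul_mon (g : G) (i : ℕ) (hi : i < D.n) : Coalgebra.comul (R := k) (D.mon g i)
    = ∑ j ∈ Finset.range (i + 1),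
      gaussBinom D.qp i j • (D.mon g j ⊗ₜ[k] D.mon (g * D.z ^ j) (i - j)) :=
  D.comulMap_mon g i hi

lemma counit_mon (g : G) (i : ℕ) (hi : i < D.n) :
    Coalgebra.counit (R := k) (D.mon g i) = if i = 0 then 1 else 0 :=
  D.counitMap_mon g i hi

noncomputable instance : Coalgebra k D.H where
  coassoc := by
    refine D.basis.ext fun a => ?_
    obtain ⟨g, i, hi⟩ := a
    rw [← mon_lt]
    simp only [LinearMap.comp_apply, LinearEquiv.coe_coe, D.comul_mon g i hi, map_sum, map_smul,
      LinearMap.rTensor_tmul, LinearMap.lTensor_tmul]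
    have h1 : ∀ j ∈ Finset.range (i + 1), gaussBinom D.qp i j •
        (TensorProduct.assoc k D.H D.H D.H) (Coalgebra.comul (D.mon g j) ⊗ₜ[k]
          D.mon (g * D.z ^ j) (i - j))
        = ∑ l ∈ Finset.range (j + 1), (gaussBinom D.qp i j * gaussBinom D.qp j l) •
          (D.mon g l ⊗ₜ[k] (D.mon (g * D.z ^ l) (j - l) ⊗ₜ[k] D.mon (g * D.z ^ j) (i - j))) := by
      intro j hj
      rw [Finset.mem_range] at hj
      rw [D.comul_mon g j (by omega), TensorProduct.sum_tmul, map_sum, Finset.smul_sum]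
      refine Finset.sum_congr rfl fun l _ => ?_
      rw [← TensorProduct.smul_tmul', map_smul, TensorProduct.assoc_tmul, smul_smul]
    have h2 : ∀ l ∈ Finset.range (i + 1), gaussBinom D.qp i l •
        (D.mon g l ⊗ₜ[k] Coalgebra.comul (R := k) (D.mon (g * D.z ^ l) (i - l)))
        = ∑ m ∈ Finset.range (i - l + 1), (gaussBinom D.qp i l * gaussBinom D.qp (i - l) m) •
          (D.mon g l ⊗ₜ[k] (D.mon (g * D.z ^ l) m ⊗ₜ[k]
            D.mon (g * D.z ^ (l + m)) (i - l - m))) := by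
      intro l hl
      rw [Finset.mem_range] at hl
      rw [D.comul_mon _ _ (by omega), TensorProduct.tmul_sum, Finset.smul_sum]
      refine Finset.sum_congr rfl fun m _ => ?_
      rw [TensorProduct.tmul_smul, smul_smul, mul_assoc g, ← pow_add]
    rw [Finset.sum_congr rfl h1, Finset.sum_congr rfl h2, Finset.sum_sigma', Finset.sum_sigma']
    refine Finset.sum_bij' (fun p _ => ⟨p.2, p.1 - p.2⟩) (fun p _ => ⟨p.1 + p.2, p.1⟩) ?_ ?_ ?_ ?_ ?_
    · rintro ⟨j, l⟩ h
      simp only [Finset.mem_sigma, Finset.mem_range] at h ⊢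
      omega
    · rintro ⟨l, m⟩ h
      simp only [Finset.mem_sigma, Finset.mem_range] at h ⊢
      omega
    · rintro ⟨j, l⟩ h
      simp only [Finset.mem_sigma, Finset.mem_range] at h
      simp only [Sigma.mk.injEq, heq_eq_eq, and_true]
      omega
    · rintro ⟨l, m⟩ h
      simp
    · rintro ⟨j, l⟩ h
      simp only [Finset.mem_sigma, Finset.mem_range] at h
      obtain ⟨m, rfl⟩ : ∃ m, j = l + m := ⟨j - l, by omega⟩
      obtain ⟨c, rfl⟩ : ∃ c, i = l + m + c := ⟨i - (l + m), by omega⟩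
      have e1 : l + m - l = m := by omega
      have e2 : l + m + c - l = m + c := by omega
      have e3 : l + m + c - (l + m) = c := by omega
      have e4 : m + c - m = c := by omega
      simp only [e1, e2, e3, e4, GaussAux.trinomial]
  rTensor_counit_comp_comul := by
    refine D.basis.ext fun a => ?_
    obtain ⟨g, i, hi⟩ := a
    rw [← mon_lt]
    simp only [LinearMap.comp_apply, D.comul_mon g i hi, map_sum, map_smul,
      LinearMap.rTensor_tmul, TensorProduct.mk_apply]
    rw [Finset.sum_eq_single 0]
    · rw [D.counit_mon g 0 (by omega)]
      simp [GaussAux.zero_right]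
    · intro j hj hj0
      rw [Finset.mem_range] at hj
      rw [D.counit_mon g j (by omega)]
      simp [hj0]
    · simp
  lTensor_counit_comp_comul := by
    refine D.basis.ext fun a => ?_
    obtain ⟨g, i, hi⟩ := a
    rw [← mon_lt]
    simp only [LinearMap.comp_apply, D.comul_mon g i hi, map_sum, map_smul,
      LinearMap.lTensor_tmul, LinearMap.flip_apply, TensorProduct.mk_apply]
    rw [Finset.sum_eq_single i]
    · rw [D.counit_mon _ _ (by omega)]
      simp [GaussAux.self]
    · intro j hj hj0
      rw [Finset.mem_range] at hj
      rw [D.counit_mon _ _ (by omega), if_neg (by omega)]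
      simp
    · simp

/-- The braid of `H_D`: `c_q(g x ^ i ⊗ h x ^ j) = q ^ (i j) h x ^ j ⊗ g x ^ i`. -/
noncomputable def braid : D.H ⊗[k] D.H →ₗ[k] D.H ⊗[k] D.H :=
  TensorProduct.lift (D.basis.constr k fun a => D.basis.constr k fun b =>
    ((D.q : k) ^ ((a.2 : ℕ) * b.2)) • (D.basis b ⊗ₜ[k] D.basis a))

/-! ### The data attached to a right `H_D`-comodule algebra -/

section Comodule

variable {B : Type*} [AddCommGroup B] [Module k B]

/-- The component `U_i^g` of the coaction: `ν(b) = ∑ U_i^g(b) ⊗ g x ^ i`. -/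
noncomputable def coactComp (ν : B →ₗ[k] B ⊗[k] D.H) (g : G) (i : Fin D.n) : B →ₗ[k] B :=
  (TensorProduct.rid k B).toLinearMap ∘ₗ (D.basis.coord (g, i)).lTensor B ∘ₗ ν

/-- The map `U = ∑_g U_1^g`: for `b` of degree `g`, `U(b)` is the coefficient of `g z⁻¹ x` in the
coaction of `b`. -/
noncomputable def U [Fintype G] (ν : B →ₗ[k] B ⊗[k] D.H) : B →ₗ[k] B :=
  ∑ g : G, D.coactComp ν g ⟨1, D.one_lt_n⟩

/-- The map `α`, that is the coefficient of `x` in `s(x ⊗ b) = α(b) ⊗ x`. -/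
noncomputable def α (s : D.H ⊗[k] B →ₗ[k] B ⊗[k] D.H) : B →ₗ[k] B :=
  (TensorProduct.rid k B).toLinearMap ∘ₗ (D.basis.coord (1, ⟨1, D.one_lt_n⟩)).lTensor B ∘ₗ s ∘ₗ
    TensorProduct.mk k D.H B D.x

/-- The homogeneous component `B_{g, ζ}`: the `b` with `s(h ⊗ b) = b ⊗ ζ(h)` for all `h ∈ G`, that are
fixed by the idempotent `U_0^g`. -/
def component (s : D.H ⊗[k] B →ₗ[k] B ⊗[k] D.H) (ν : B →ₗ[k] B ⊗[k] D.H) (g : G) (ζ : G ≃* G) :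
    Submodule k B where
  carrier := {b | (∀ h : G, s (D.grp h ⊗ₜ[k] b) = b ⊗ₜ[k] D.grp (ζ h)) ∧
    D.coactComp ν g ⟨0, by have := D.one_lt_n; omega⟩ b = b}
  add_mem' := by
    rintro a b ⟨ha, ha'⟩ ⟨hb, hb'⟩
    exact ⟨fun h => by rw [TensorProduct.tmul_add, map_add, ha, hb, TensorProduct.add_tmul],
      by rw [map_add, ha', hb']⟩
  zero_mem' := ⟨fun h => by simp, map_zero _⟩
  smul_mem' := by
    rintro r a ⟨ha, ha'⟩
    exact ⟨fun h => by rw [TensorProduct.tmul_smul, map_smul, ha, TensorProduct.smul_tmul'],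
      by rw [map_smul, ha']⟩

end Comodule

/-- The group of automorphisms `ζ` of `G` with `ζ(z) = z` and `χ ∘ ζ = χ`. -/
def autGroup : Subgroup (MulAut G) where
  carrier := {ζ | ζ D.z = D.z ∧ ∀ g : G, D.χ (ζ g) = D.χ g}
  mul_mem' := by
    rintro ζ φ ⟨h1, h2⟩ ⟨h3, h4⟩
    exact ⟨by rw [MulAut.mul_apply, h3, h1], fun g => by rw [MulAut.mul_apply, h2, h4]⟩
  one_mem' := ⟨rfl, fun _ => rfl⟩
  inv_mem' := by
    rintro ζ ⟨h1, h2⟩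
    refine ⟨?_, fun g => ?_⟩
    · conv_lhs => rw [← h1]
      exact MulAut.inv_apply_self G ζ D.z
    · rw [← h2 (ζ⁻¹ g), MulAut.apply_inv_self]

section Cleft

variable {B : Type*} [Ring B] [Algebra k B]

/-- The linear map `γ : H_D → B` with `γ(g x ^ i) = b_g b_x ^ i`, for `0 ≤ i < n`. -/
noncomputable def gamma (bg : G → Bˣ) (bx : B) : D.H →ₗ[k] B :=
  D.basis.constr k fun a => (bg a.1 : B) * bx ^ (a.2 : ℕ)

end Cleft

/-- The scalar `(-1) ^ e binom(s, i)_{qp} binom(r, j)_{qp} (qp) ^ (e (e - 1) / 2 + (s - i) j) χ(h) ^ (s - i)`. -/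
def cocCoeff (h : G) (s r i j e : ℕ) : k :=
  (-1) ^ e * gaussBinom D.qp s i * gaussBinom D.qp r j *
    D.qp ^ (e * (e - 1) / 2 + (s - i) * j) * (D.χ h : k) ^ (s - i)

end HopfDatum

/-! The computation takes place in the twisted tensor product B ⊗_s H (`Smash`). There ν is an
algebra morphism (`coact`), and moving h across b is the product (1 ⊗ h)(b ⊗ 1) = s(h ⊗ b).

The hypotheses on b_g and b_x only describe how group elements pass them, one coefficient of s(x ⊗
b), and a few coefficients of ν. These data determine s and ν on b_g and b_x. Compatibility of s
with Δ forces s(x ⊗ b) into B ⊗ P, where P is the space of solutions of Δu = 1 ⊗ u + u ⊗ z, spanned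
by x and 1 - z (`eq_of_comul_eq`). The relation xz = p zx, the braid, the injectivity of s and (p,
q) ≠ (1, -1) remove the component along 1 - z (`eq_zero_of_apply_x`). For ν, coassociativity gives
relations among the U^g_i in which the Gaussian binomials of upper index below n are nonzero. Hence
ν(b_g) = b_g ⊗ g and ν(b_x) = b_x ⊗ z + 1 ⊗ x (`coact_eq`).

Put X = 1 ⊗ x and Y = b_x ⊗ z. Then XY = qp YX, and the q-binomial expansion of (Y + X)^i is the
colinearity of γ (`coact_bx_pow`). The alternating sum of Gaussian binomials shows that γ'(gx^i) =
(-1)^i (qp)^(i(i-1)/2) b_x^i b_{gz^i}⁻¹ is the convolution inverse (`isCleftPair`).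

The rest holds for any such pair (γ, γ'). The map π(a) = a₀ γ'(a₁) projects B on C, and c ⊗ h ↦ c
γ(h) is a bijection C ⊗ H → B with inverse (π ⊗ H)ν, which is the freeness statement. Put ρ(h ⊗ c) =
π(γ(h) c) and σ(h ⊗ l) = π(γ(h) γ(l)). The maps X and F of the statement then write γ(h) c and γ(h)
γ(l) in the form ∑ c' γ(h'). Consequently the weak action, cocycle and twisted module identities are
π applied to the associativity of B. Expanding Δ gives the explicit formulas; the λ-terms come from
γ' on powers x^ξ with n ≤ ξ < 2n. -/

namespace Braided

open Coalgebra LinearMap TensorProduct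

/-! ### Elementwise calculus of the twisted multiplication -/

section Elementwise

variable {k H V W A : Type*} [Field k] [Ring H] [Algebra k H]
variable [AddCommGroup V] [Module k V] [AddCommGroup W] [Module k W] [Ring A] [Algebra k A]

lemma passTwo_tmul (s : H ⊗[k] V →ₗ[k] V ⊗[k] H) (h l : H) (v : V) :
    passTwo s ((h ⊗ₜ l) ⊗ₜ v) = TensorProduct.assoc k V H H
      (s.rTensor H ((TensorProduct.assoc k H V H).symm (h ⊗ₜ s (l ⊗ₜ v)))) := by
  simp [passTwo]

lemma passPair_tmul (s : H ⊗[k] V →ₗ[k] V ⊗[k] H) (t : H ⊗[k] W →ₗ[k] W ⊗[k] H)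
    (h : H) (v : V) (w : W) :
    passPair s t (h ⊗ₜ (v ⊗ₜ w)) = (TensorProduct.assoc k V W H).symm
      (t.lTensor V (TensorProduct.assoc k V H W (s (h ⊗ₜ v) ⊗ₜ w))) := by
  simp [passPair]

lemma twMul_tmul (s : H ⊗[k] A →ₗ[k] A ⊗[k] H) (a b : A) (h l : H) :
    twMul s ((a ⊗ₜ h) ⊗ₜ (b ⊗ₜ l)) = (a ⊗ₜ 1) * s (h ⊗ₜ b) * (1 ⊗ₜ l) := by
  simp only [twMul, LinearMap.comp_apply, midMap_tmul]
  induction s (h ⊗ₜ b) using TensorProduct.induction_on with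
  | zero => simp
  | tmul x y => simp
  | add x y hx hy => simp only [tmul_add, add_tmul, map_add, mul_add, add_mul, hx, hy]

/-- With `twMul_mul_right`, this shows that the twisted product is left linear over A and right
linear over H, so outer factors can be pulled out and only the crossing of the inner ones matters.
-/
lemma twMul_mul_left (s : H ⊗[k] A →ₗ[k] A ⊗[k] H) (a : A) (t u : A ⊗[k] H) :
    twMul s (((a ⊗ₜ 1) * t) ⊗ₜ u) = (a ⊗ₜ 1) * twMul s (t ⊗ₜ u) := by
  induction t using TensorProduct.induction_on with
  | zero => simp
  | add x y hx hy => simp only [add_tmul, map_add, mul_add, hx, hy]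
  | tmul b h =>
    induction u using TensorProduct.induction_on with
    | zero => simp
    | add x y hx hy => simp only [tmul_add, map_add, mul_add, hx, hy]
    | tmul d l =>
      rw [Algebra.TensorProduct.tmul_mul_tmul, one_mul, twMul_tmul, twMul_tmul, ← mul_assoc,
        ← mul_assoc, Algebra.TensorProduct.tmul_mul_tmul, one_mul]

lemma twMul_mul_right (s : H ⊗[k] A →ₗ[k] A ⊗[k] H) (l : H) (t u : A ⊗[k] H) :
    twMul s (t ⊗ₜ (u * (1 ⊗ₜ l))) = twMul s (t ⊗ₜ u) * (1 ⊗ₜ l) := by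
  induction u using TensorProduct.induction_on with
  | zero => simp
  | add x y hx hy => simp only [tmul_add, map_add, add_mul, hx, hy]
  | tmul b h =>
    induction t using TensorProduct.induction_on with
    | zero => simp
    | add x y hx hy => simp only [add_tmul, map_add, add_mul, hx, hy]
    | tmul d m =>
      rw [Algebra.TensorProduct.tmul_mul_tmul, mul_one, twMul_tmul, twMul_tmul, mul_assoc,
        mul_assoc, mul_assoc, Algebra.TensorProduct.tmul_mul_tmul, one_mul]

variable [Coalgebra k H] {c : H ⊗[k] H →ₗ[k] H ⊗[k] H} {s : H ⊗[k] A →ₗ[k] A ⊗[k] H}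

lemma IsLeftSpace.apply_mul (hs : IsLeftSpace c s) (h l : H) (a : A) :
    s ((h * l) ⊗ₜ a) = twMul s ((1 ⊗ₜ h) ⊗ₜ s (l ⊗ₜ a)) := by
  have := LinearMap.congr_fun hs.mul ((h ⊗ₜ l) ⊗ₜ a)
  simp only [LinearMap.comp_apply, rTensor_tmul, mul'_apply, passTwo_tmul] at this
  rw [this]
  induction s (l ⊗ₜ a) using TensorProduct.induction_on with
  | zero => simp
  | add x y hx hy => simp only [tmul_add, map_add, hx, hy]
  | tmul b m =>
    rw [twMul_tmul, ← Algebra.TensorProduct.one_def, one_mul, TensorProduct.assoc_symm_tmul, rTensor_tmul]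
    induction s (h ⊗ₜ b) using TensorProduct.induction_on with
    | zero => simp
    | add x y hx hy => simp only [add_tmul, map_add, add_mul, hx, hy]
    | tmul d n => simp

lemma IsLeftTransposition.apply_alg_mul (hs : IsLeftTransposition c s) (h : H) (a b : A) :
    s (h ⊗ₜ (a * b)) = twMul s (s (h ⊗ₜ a) ⊗ₜ (b ⊗ₜ 1)) := by
  have := LinearMap.congr_fun hs.alg_mul (h ⊗ₜ (a ⊗ₜ b))
  simp only [LinearMap.comp_apply, lTensor_tmul, mul'_apply, passPair_tmul] at this
  rw [this]
  induction s (h ⊗ₜ a) using TensorProduct.induction_on with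
  | zero => simp
  | add x y hx hy => simp only [add_tmul, map_add, hx, hy]
  | tmul d m =>
    rw [twMul_tmul, ← Algebra.TensorProduct.one_def, mul_one, TensorProduct.assoc_tmul, lTensor_tmul]
    induction s (m ⊗ₜ b) using TensorProduct.induction_on with
    | zero => simp
    | add x y hx hy => simp only [tmul_add, map_add, mul_add, hx, hy]
    | tmul d n => simp

/-- For a ⊗ h, b ⊗ l, d ⊗ m both bracketings equal (a ⊗ 1) · (s(h ⊗ b) · s(l ⊗ d)) · (1 ⊗ m), the
middle product being the twisted one. One side needs the compatibility of s with the product of H,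
the other that with the product of A. -/
lemma IsLeftTransposition.twMul_assoc (hs : IsLeftTransposition c s) (t u v : A ⊗[k] H) :
    twMul s (twMul s (t ⊗ₜ u) ⊗ₜ v) = twMul s (t ⊗ₜ twMul s (u ⊗ₜ v)) := by
  induction t using TensorProduct.induction_on with
  | zero => simp
  | add x y hx hy => simp only [add_tmul, map_add, hx, hy]
  | tmul a h =>
  induction u using TensorProduct.induction_on with
  | zero => simp
  | add x y hx hy => simp only [add_tmul, tmul_add, map_add, hx, hy]
  | tmul b l =>
  induction v using TensorProduct.induction_on with
  | zero => simp
  | add x y hx hy => simp only [tmul_add, map_add, hx, hy]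
  | tmul d m =>
  rw [twMul_tmul, twMul_tmul, mul_assoc, twMul_mul_left]
  have h1 : ∀ t : A ⊗[k] H, twMul s ((t * (1 ⊗ₜ l)) ⊗ₜ (d ⊗ₜ m))
      = twMul s (t ⊗ₜ s (l ⊗ₜ d)) * (1 ⊗ₜ m) := by
    intro t
    induction t using TensorProduct.induction_on with
    | zero => simp
    | add x y hx hy => simp only [add_tmul, map_add, add_mul, hx, hy]
    | tmul b' h' =>
      rw [Algebra.TensorProduct.tmul_mul_tmul, mul_one, twMul_tmul, hs.apply_mul,
        ← twMul_mul_left, Algebra.TensorProduct.tmul_mul_tmul, mul_one, one_mul]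
  have h2 : ∀ u : A ⊗[k] H, twMul s ((a ⊗ₜ h) ⊗ₜ ((b ⊗ₜ 1) * u))
      = (a ⊗ₜ 1) * twMul s (s (h ⊗ₜ b) ⊗ₜ u) := by
    intro u
    induction u using TensorProduct.induction_on with
    | zero => simp
    | add x y hx hy => simp only [tmul_add, map_add, mul_add, hx, hy]
    | tmul b' h' =>
      rw [Algebra.TensorProduct.tmul_mul_tmul, one_mul, twMul_tmul, hs.apply_alg_mul,
        mul_assoc, ← twMul_mul_right, Algebra.TensorProduct.tmul_mul_tmul, mul_one, one_mul]
  rw [h1, mul_assoc, ← twMul_mul_right, ← h2]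

end Elementwise

/-! ### The twisted tensor product as an algebra, and the coaction as an algebra morphism -/

section Smash

variable {k H A : Type*} [Field k] [Ring H] [Algebra k H] [Coalgebra k H] [Ring A] [Algebra k A]
variable {c : H ⊗[k] H →ₗ[k] H ⊗[k] H} {s : H ⊗[k] A →ₗ[k] A ⊗[k] H}

/-- The twisted tensor product `A ⊗_s H`, with the multiplication `twMul s`. -/
def Smash (_hs : IsLeftTransposition c s) : Type _ := A ⊗[k] H

namespace Smash

variable (hs : IsLeftTransposition c s)

noncomputable instance : AddCommGroup (Smash hs) := inferInstanceAs (AddCommGroup (A ⊗[k] H))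

noncomputable instance : Module k (Smash hs) := inferInstanceAs (Module k (A ⊗[k] H))

lemma one_twMul (hs : IsLeftTransposition c s) (t : A ⊗[k] H) : twMul s ((1 ⊗ₜ 1) ⊗ₜ t) = t := by
  induction t using TensorProduct.induction_on with
  | zero => simp
  | add x y hx hy => simp only [tmul_add, map_add, hx, hy]
  | tmul b h => rw [twMul_tmul, hs.unit]; simp

lemma twMul_one (hs : IsLeftTransposition c s) (t : A ⊗[k] H) : twMul s (t ⊗ₜ (1 ⊗ₜ 1)) = t := by
  induction t using TensorProduct.induction_on with
  | zero => simp
  | add x y hx hy => simp only [add_tmul, map_add, hx, hy]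
  | tmul b h => rw [twMul_tmul, hs.alg_unit]; simp

noncomputable instance : Ring (Smash hs) :=
  { (inferInstance : AddCommGroup (Smash hs)) with
    mul := fun t u => TensorProduct.curry (twMul s) t u
    one := (1 ⊗ₜ[k] 1 : A ⊗[k] H)
    left_distrib := fun t u v => map_add (TensorProduct.curry (twMul s) t) u v
    right_distrib := fun t u v => LinearMap.map_add₂ (TensorProduct.curry (twMul s)) t u v
    zero_mul := fun t => LinearMap.map_zero₂ (TensorProduct.curry (twMul s)) t
    mul_zero := fun t => map_zero (TensorProduct.curry (twMul s) t)
    mul_assoc := fun t u v => hs.twMul_assoc t u v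
    one_mul := one_twMul hs
    mul_one := twMul_one hs }

noncomputable instance : Algebra k (Smash hs) :=
  Algebra.ofModule
    (fun r t u => LinearMap.map_smul₂ (TensorProduct.curry (twMul s)) r t u)
    (fun r t u => map_smul (TensorProduct.curry (twMul s) t) r u)

/-- The element `a ⊗ h` of `A ⊗_s H`. -/
noncomputable def of : A ⊗[k] H ≃ₗ[k] Smash hs := LinearEquiv.refl k _

lemma of_mul (t u : A ⊗[k] H) : of hs t * of hs u = of hs (twMul s (t ⊗ₜ u)) := rfl

/-- The inclusion of `A` in `A ⊗_s H`. -/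
noncomputable def inl : A →ₐ[k] Smash hs :=
  AlgHom.ofLinearMap ((of hs).toLinearMap ∘ₗ (TensorProduct.mk k A H).flip 1) rfl fun a b => by
    change of hs ((a * b) ⊗ₜ 1) = of hs (a ⊗ₜ 1) * of hs (b ⊗ₜ 1)
    rw [of_mul, twMul_coinv s hs.unit]

/-- The inclusion of `H` in `A ⊗_s H`, as a linear map. -/
noncomputable def inr : H →ₗ[k] Smash hs := (of hs).toLinearMap ∘ₗ TensorProduct.mk k A H 1

lemma inl_apply (a : A) : inl hs a = of hs (a ⊗ₜ 1) := rfl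

lemma inr_apply (h : H) : inr hs h = of hs (1 ⊗ₜ h) := rfl

lemma inl_mul_inr (a : A) (h : H) : inl hs a * inr hs h = of hs (a ⊗ₜ h) := by
  rw [inl_apply, inr_apply, of_mul, twMul_tmul, hs.unit]
  simp

lemma inr_mul_inl (h : H) (a : A) : inr hs h * inl hs a = of hs (s (h ⊗ₜ a)) := by
  rw [inl_apply, inr_apply, of_mul, twMul_tmul]
  simp [← Algebra.TensorProduct.one_def]

lemma inr_mul_inr (h l : H) : inr hs h * inr hs l = inr hs (h * l) := by
  rw [inr_apply, inr_apply, inr_apply, of_mul, twMul_tmul, hs.alg_unit]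
  simp

end Smash

/-- The coaction of a comodule algebra, as a morphism of algebras to `A ⊗_s H`. -/
noncomputable def IsComoduleAlgebra.coact {ν : A →ₗ[k] A ⊗[k] H} (hA : IsComoduleAlgebra c s ν) :
    A →ₐ[k] Smash hA.transposition :=
  AlgHom.ofLinearMap ((Smash.of hA.transposition).toLinearMap ∘ₗ ν) (by
    change Smash.of _ (ν 1) = 1
    rw [hA.one]; rfl) fun a b => by
    have := LinearMap.congr_fun hA.mul (a ⊗ₜ b)
    exact congrArg (Smash.of hA.transposition) this

lemma IsComoduleAlgebra.coact_apply {ν : A →ₗ[k] A ⊗[k] H} (hA : IsComoduleAlgebra c s ν) (a : A) :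
    hA.coact a = Smash.of hA.transposition (ν a) := rfl

lemma IsComoduleAlgebra.mem_coinvariants {ν : A →ₗ[k] A ⊗[k] H} (hA : IsComoduleAlgebra c s ν)
    {a : A} : a ∈ coinvariants hA ↔ ν a = a ⊗ₜ 1 := Iff.rfl

end Smash

end Braided

namespace Braided

open Coalgebra LinearMap TensorProduct

/-! ### Naturality of the braiding operators -/

section Naturality

variable {k H V W V' W' A A' : Type*} [Field k] [Ring H] [Algebra k H]
variable [AddCommGroup V] [Module k V] [AddCommGroup W] [Module k W]
variable [AddCommGroup V'] [Module k V'] [AddCommGroup W'] [Module k W']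
variable [Ring A] [Algebra k A] [Ring A'] [Algebra k A']

lemma passPair_natural {s : H ⊗[k] V →ₗ[k] V ⊗[k] H} {t : H ⊗[k] W →ₗ[k] W ⊗[k] H}
    {s' : H ⊗[k] V' →ₗ[k] V' ⊗[k] H} {t' : H ⊗[k] W' →ₗ[k] W' ⊗[k] H}
    {f : V →ₗ[k] V'} {g : W →ₗ[k] W'}
    (hf : f.rTensor H ∘ₗ s = s' ∘ₗ f.lTensor H) (hg : g.rTensor H ∘ₗ t = t' ∘ₗ g.lTensor H) :
    (TensorProduct.map f g).rTensor H ∘ₗ passPair s t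
      = passPair s' t' ∘ₗ (TensorProduct.map f g).lTensor H := by
  refine TensorProduct.ext' fun h x => ?_
  induction x using TensorProduct.induction_on with
  | zero => simp
  | add x y hx hy => simp only [tmul_add, map_add, hx, hy]
  | tmul v w =>
    have h1 := LinearMap.congr_fun hf (h ⊗ₜ v)
    simp only [LinearMap.comp_apply, lTensor_tmul, TensorProduct.map_tmul, passPair_tmul] at h1 ⊢
    rw [← h1]
    induction s (h ⊗ₜ v) using TensorProduct.induction_on with
    | zero => simp
    | add x y hx hy => simp only [add_tmul, map_add, hx, hy]
    | tmul v' h' =>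
      have h2 := LinearMap.congr_fun hg (h' ⊗ₜ w)
      simp only [LinearMap.comp_apply, lTensor_tmul, rTensor_tmul,
        TensorProduct.assoc_tmul] at h2 ⊢
      rw [← h2]
      induction t (h' ⊗ₜ w) using TensorProduct.induction_on with
      | zero => simp
      | add x y hx hy => simp only [tmul_add, map_add, hx, hy]
      | tmul w' m => simp

lemma passTwo_natural {s : H ⊗[k] V →ₗ[k] V ⊗[k] H} {s' : H ⊗[k] V' →ₗ[k] V' ⊗[k] H}
    {f : V →ₗ[k] V'} (hf : f.rTensor H ∘ₗ s = s' ∘ₗ f.lTensor H) :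
    f.rTensor (H ⊗[k] H) ∘ₗ passTwo s = passTwo s' ∘ₗ f.lTensor (H ⊗[k] H) := by
  refine TensorProduct.ext_threefold fun h l v => ?_
  have h1 := LinearMap.congr_fun hf (l ⊗ₜ v)
  simp only [LinearMap.comp_apply, lTensor_tmul, passTwo_tmul] at h1 ⊢
  rw [← h1]
  induction s (l ⊗ₜ v) using TensorProduct.induction_on with
  | zero => simp
  | add x y hx hy => simp only [tmul_add, map_add, hx, hy]
  | tmul v' l' =>
    have h2 := LinearMap.congr_fun hf (h ⊗ₜ v')
    simp only [LinearMap.comp_apply, lTensor_tmul, rTensor_tmul,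
      TensorProduct.assoc_symm_tmul] at h2 ⊢
    rw [← h2]
    induction s (h ⊗ₜ v') using TensorProduct.induction_on with
    | zero => simp
    | add x y hx hy => simp only [add_tmul, map_add, hx, hy]
    | tmul w' m => simp

lemma slide_tmul {P Q R W : Type*} [AddCommGroup P] [Module k P] [AddCommGroup Q] [Module k Q]
    [AddCommGroup R] [Module k R] [AddCommGroup W] [Module k W] (t : P ⊗[k] Q →ₗ[k] A ⊗[k] R)
    (f : R ⊗[k] W →ₗ[k] A) (p : P) (q : Q) (w : W) :
    slide t f (p ⊗ₜ (q ⊗ₜ w)) = mul' k A (f.lTensor A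
      (TensorProduct.assoc k A R W (t (p ⊗ₜ q) ⊗ₜ w))) := by
  simp [slide]

variable [Coalgebra k H]

lemma crossAct_natural {s : H ⊗[k] A →ₗ[k] A ⊗[k] H} {s' : H ⊗[k] A' →ₗ[k] A' ⊗[k] H}
    {ρ : H ⊗[k] A →ₗ[k] A} {ρ' : H ⊗[k] A' →ₗ[k] A'} {f : A →ₗ[k] A'}
    (hs : f.rTensor H ∘ₗ s = s' ∘ₗ f.lTensor H) (hρ : f ∘ₗ ρ = ρ' ∘ₗ f.lTensor H) :
    f.rTensor H ∘ₗ crossAct s ρ = crossAct s' ρ' ∘ₗ f.lTensor H := by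
  refine TensorProduct.ext' fun h a => ?_
  simp only [crossAct, LinearMap.comp_apply, lTensor_tmul, rTensor_tmul, LinearEquiv.coe_coe]
  induction comul (R := k) h using TensorProduct.induction_on with
  | zero => simp
  | add x y hx hy => simp only [add_tmul, map_add, hx, hy]
  | tmul h₁ h₂ =>
    have h1 := LinearMap.congr_fun hs (h₂ ⊗ₜ a)
    simp only [LinearMap.comp_apply, lTensor_tmul, TensorProduct.assoc_tmul] at h1 ⊢
    rw [← h1]
    induction s (h₂ ⊗ₜ a) using TensorProduct.induction_on with
    | zero => simp
    | add x y hx hy => simp only [tmul_add, map_add, hx, hy]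
    | tmul a' l =>
      have h2 := LinearMap.congr_fun hρ (h₁ ⊗ₜ a')
      simp only [LinearMap.comp_apply, lTensor_tmul, rTensor_tmul,
        TensorProduct.assoc_symm_tmul] at h2 ⊢
      rw [h2]

end Naturality

/-! ### Cleft maps and the projection on the coinvariants -/

section Cleft

variable {k H A : Type*} [Field k] [Ring H] [Algebra k H] [Coalgebra k H] [Ring A] [Algebra k A]
variable {c : H ⊗[k] H →ₗ[k] H ⊗[k] H} {s : H ⊗[k] A →ₗ[k] A ⊗[k] H}
variable {ν : A →ₗ[k] A ⊗[k] H} {γ γ' : H →ₗ[k] A}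

/-- `γ` is a normalized cleft map with convolution inverse `γ'`, which is also compatible with
the braid. -/
structure IsCleftPair (c : H ⊗[k] H →ₗ[k] H ⊗[k] H) (s : H ⊗[k] A →ₗ[k] A ⊗[k] H)
    (ν : A →ₗ[k] A ⊗[k] H) (γ γ' : H →ₗ[k] A) : Prop where
  conv_left : WithConv.toConv γ' * WithConv.toConv γ = 1
  conv_right : WithConv.toConv γ * WithConv.toConv γ' = 1
  colinear : ν ∘ₗ γ = γ.rTensor H ∘ₗ comul
  compat : γ.rTensor H ∘ₗ c = s ∘ₗ γ.lTensor H
  compat_inv : γ'.rTensor H ∘ₗ c = s ∘ₗ γ'.lTensor H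
  map_one : γ 1 = 1
  map_one_inv : γ' 1 = 1

/-- The map `a ↦ a₀ γ'(a₁)`. -/
noncomputable def cleftProj (ν : A →ₗ[k] A ⊗[k] H) (γ' : H →ₗ[k] A) : A →ₗ[k] A :=
  mul' k A ∘ₗ γ'.lTensor A ∘ₗ ν

/-- The map `a ⊗ h ↦ a γ(h)`. -/
noncomputable def mulRight (γ : H →ₗ[k] A) : A ⊗[k] H →ₗ[k] A := mul' k A ∘ₗ γ.lTensor A

/-- The map `h ⊗ a ↦ γ(h) a`. -/
noncomputable def mulLeft (γ : H →ₗ[k] A) : H ⊗[k] A →ₗ[k] A := mul' k A ∘ₗ γ.rTensor A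

/-- The map `h ⊗ l ↦ γ(h) γ(l)`. -/
noncomputable def mulBoth (γ : H →ₗ[k] A) : H ⊗[k] H →ₗ[k] A := mul' k A ∘ₗ TensorProduct.map γ γ

@[simp] lemma mulRight_tmul (γ : H →ₗ[k] A) (a : A) (h : H) : mulRight γ (a ⊗ₜ h) = a * γ h := by
  simp [mulRight]

@[simp] lemma mulLeft_tmul (γ : H →ₗ[k] A) (a : A) (h : H) : mulLeft γ (h ⊗ₜ a) = γ h * a := by
  simp [mulLeft]

@[simp] lemma mulBoth_tmul (γ : H →ₗ[k] A) (h l : H) : mulBoth γ (h ⊗ₜ l) = γ h * γ l := by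
  simp [mulBoth]

lemma cleftProj_apply (ν : A →ₗ[k] A ⊗[k] H) (γ' : H →ₗ[k] A) (a : A) :
    cleftProj ν γ' a = mulRight γ' (ν a) := rfl

namespace IsCleftPair

lemma conv_left_apply (hγ : IsCleftPair c s ν γ γ') (h : H) :
    mul' k A (TensorProduct.map γ' γ (comul h)) = algebraMap k A (counit h) :=
  LinearMap.congr_fun (congrArg WithConv.ofConv hγ.conv_left) h

lemma conv_right_apply (hγ : IsCleftPair c s ν γ γ') (h : H) :
    mul' k A (TensorProduct.map γ γ' (comul h)) = algebraMap k A (counit h) :=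
  LinearMap.congr_fun (congrArg WithConv.ofConv hγ.conv_right) h

/-- Colinearity of γ, read as a factorization in the convolution algebra of maps H → A ⊗_s H. -/
lemma coact_comp (hA : IsComoduleAlgebra c s ν) (hγ : IsCleftPair c s ν γ γ') :
    WithConv.toConv (hA.coact.toLinearMap ∘ₗ γ)
      = WithConv.toConv ((Smash.inl hA.transposition).toLinearMap ∘ₗ γ)
        * WithConv.toConv (Smash.inr hA.transposition) := by
  ext h
  have h1 : hA.coact (γ h) = Smash.of _ (γ.rTensor H (comul h)) :=
    congrArg (Smash.of hA.transposition) (LinearMap.congr_fun hγ.colinear h)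
  simp only [LinearMap.convMul_apply]
  refine h1.trans ?_
  induction comul (R := k) h using TensorProduct.induction_on with
  | zero => simp
  | add x y hx hy => simp only [map_add, hx, hy]
  | tmul h₁ h₂ => simp [← Smash.inl_mul_inr]

/-- Composition with an algebra morphism preserves convolution inverses. Thus ν ∘ γ' is inverse to ν
∘ γ = (γ ⊗ 1) * (1 ⊗ H), and multiplying by the inverse γ' ⊗ 1 of γ ⊗ 1 leaves (1 ⊗ h₁) ν(γ'(h₂)) =
γ'(h) ⊗ 1. This replaces an antipode formula for ν ∘ γ'. -/
lemma inr_mul_coact_inv (hA : IsComoduleAlgebra c s ν) (hγ : IsCleftPair c s ν γ γ') :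
    WithConv.toConv (Smash.inr hA.transposition)
        * WithConv.toConv (hA.coact.toLinearMap ∘ₗ γ')
      = WithConv.toConv ((Smash.inl hA.transposition).toLinearMap ∘ₗ γ') := by
  have h1 : WithConv.toConv (hA.coact.toLinearMap ∘ₗ γ)
      * WithConv.toConv (hA.coact.toLinearMap ∘ₗ γ') = 1 := by
    have := LinearMap.algHom_comp_convMul_distrib hA.coact (WithConv.toConv γ) (WithConv.toConv γ')
    rw [hγ.conv_right] at this
    refine (congrArg WithConv.toConv this).symm.trans ?_
    ext h
    simp [LinearMap.convOne_def]
  have h2 : WithConv.toConv ((Smash.inl hA.transposition).toLinearMap ∘ₗ γ')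
      * WithConv.toConv ((Smash.inl hA.transposition).toLinearMap ∘ₗ γ) = 1 := by
    have := LinearMap.algHom_comp_convMul_distrib (Smash.inl hA.transposition)
      (WithConv.toConv γ') (WithConv.toConv γ)
    rw [hγ.conv_left] at this
    refine (congrArg WithConv.toConv this).symm.trans ?_
    ext h
    simp [LinearMap.convOne_def]
  rw [hγ.coact_comp hA] at h1
  rw [← mul_one (WithConv.toConv ((Smash.inl hA.transposition).toLinearMap ∘ₗ γ')), ← h1,
    ← mul_assoc, ← mul_assoc, h2, one_mul]

/-- By multiplicativity and coassociativity, ν(a₀ γ'(a₁)) = (a₀ ⊗ a₁) ν(γ'(a₂)), and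
`inr_mul_coact_inv` collapses this to a₀ γ'(a₁) ⊗ 1. -/
lemma cleftProj_mem (hA : IsComoduleAlgebra c s ν) (hγ : IsCleftPair c s ν γ γ') (a : A) :
    cleftProj ν γ' a ∈ coinvariants hA := by
  have h0 : ∀ h : H, mul' k _ (TensorProduct.map (Smash.inr hA.transposition)
      (hA.coact.toLinearMap ∘ₗ γ') (comul h)) = Smash.inl hA.transposition (γ' h) :=
    fun h => LinearMap.congr_fun (congrArg WithConv.ofConv (hγ.inr_mul_coact_inv hA)) h
  set N : (A ⊗[k] H) ⊗[k] H →ₗ[k] Smash hA.transposition :=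
    mul' k _ ∘ₗ TensorProduct.map (Smash.of hA.transposition).toLinearMap
      (hA.coact.toLinearMap ∘ₗ γ') with hN
  have h1 : ∀ t : A ⊗[k] H, hA.coact (mulRight γ' t) = N (ν.rTensor H t) := by
    intro t
    induction t using TensorProduct.induction_on with
    | zero => simp
    | add x y hx hy => simp only [map_add, hx, hy]
    | tmul b h => simp [hN, hA.coact_apply b]
  have h2 : ∀ t : A ⊗[k] H,
      N ((TensorProduct.assoc k A H H).symm ((comul (R := k) (A := H)).lTensor A t))
        = Smash.inl hA.transposition (mulRight γ' t) := by
    intro t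
    induction t using TensorProduct.induction_on with
    | zero => simp
    | add x y hx hy => simp only [map_add, hx, hy]
    | tmul b h =>
      rw [mulRight_tmul, map_mul, ← h0, lTensor_tmul]
      induction comul (R := k) h using TensorProduct.induction_on with
      | zero => simp
      | add x y hx hy => simp only [tmul_add, map_add, mul_add, hx, hy]
      | tmul h₁ h₂ => simp [hN, ← Smash.inl_mul_inr, mul_assoc]
  have h3 := LinearMap.congr_fun hA.comodule.coassoc a
  simp only [LinearMap.comp_apply, LinearEquiv.coe_coe] at h3
  have h4 := h1 (ν a)
  rw [← (TensorProduct.assoc k A H H).symm_apply_apply (ν.rTensor H (ν a)), h3, h2] at h4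
  exact (Smash.of hA.transposition).injective h4

lemma coact_mul_left (hA : IsComoduleAlgebra c s ν) {b : A} (hb : b ∈ coinvariants hA) (a : A) :
    ν (b * a) = (b ⊗ₜ 1) * ν a := by
  have := LinearMap.congr_fun hA.mul (b ⊗ₜ a)
  simp only [LinearMap.comp_apply, mul'_apply, TensorProduct.map_tmul] at this
  rw [this, hA.mem_coinvariants.1 hb]
  induction ν a using TensorProduct.induction_on with
  | zero => simp
  | add x y hx hy => simp only [tmul_add, map_add, mul_add, hx, hy]
  | tmul d h => rw [twMul_tmul, hA.transposition.unit]; simp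

lemma mulRight_mul (γ : H →ₗ[k] A) (b : A) (t : A ⊗[k] H) :
    mulRight γ ((b ⊗ₜ 1) * t) = b * mulRight γ t := by
  induction t using TensorProduct.induction_on with
  | zero => simp
  | add x y hx hy => simp only [map_add, mul_add, hx, hy]
  | tmul d h => simp [mul_assoc]

lemma cleftProj_mul_left (hA : IsComoduleAlgebra c s ν) {b : A} (hb : b ∈ coinvariants hA)
    (a : A) : cleftProj ν γ' (b * a) = b * cleftProj ν γ' a := by
  rw [cleftProj_apply, cleftProj_apply, coact_mul_left hA hb, mulRight_mul]

lemma cleftProj_apply_cleft (hγ : IsCleftPair c s ν γ γ') (h : H) :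
    cleftProj ν γ' (γ h) = algebraMap k A (counit h) := by
  have := LinearMap.congr_fun hγ.colinear h
  simp only [LinearMap.comp_apply] at this
  rw [cleftProj_apply, this, ← hγ.conv_right_apply]
  induction comul (R := k) h using TensorProduct.induction_on with
  | zero => simp
  | add x y hx hy => simp only [map_add, hx, hy]
  | tmul d h => simp

lemma cleftProj_coinv (hA : IsComoduleAlgebra c s ν) (hγ : IsCleftPair c s ν γ γ') {b : A}
    (hb : b ∈ coinvariants hA) : cleftProj ν γ' b = b := by
  rw [cleftProj_apply, hA.mem_coinvariants.1 hb, mulRight_tmul, hγ.map_one_inv, mul_one]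

/-- The computation is a₀ γ'(a₁) γ(a₂) = a₀ ε(a₁) = a. This is the surjectivity half of the normal
basis isomorphism C ⊗ H ≅ A, c ⊗ h ↦ c γ(h). -/
lemma mulRight_cleftProj (hA : IsComoduleAlgebra c s ν) (hγ : IsCleftPair c s ν γ γ') (a : A) :
    mulRight γ ((cleftProj ν γ').rTensor H (ν a)) = a := by
  have h3 := LinearMap.congr_fun hA.comodule.coassoc a
  simp only [LinearMap.comp_apply, LinearEquiv.coe_coe] at h3
  have h1 : (cleftProj ν γ').rTensor H (ν a) = (mulRight γ').rTensor H
      ((TensorProduct.assoc k A H H).symm ((comul (R := k) (A := H)).lTensor A (ν a))) := by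
    rw [← h3, LinearEquiv.symm_apply_apply, ← LinearMap.comp_apply (rTensor H (mulRight γ')),
      ← rTensor_comp]
    rfl
  have h4 := LinearMap.congr_fun hA.comodule.counit a
  simp only [LinearMap.comp_apply, LinearEquiv.coe_coe, LinearMap.id_apply] at h4
  rw [h1]
  conv_rhs => rw [← h4]
  induction ν a using TensorProduct.induction_on with
  | zero => simp
  | add x y hx hy => simp only [map_add, hx, hy]
  | tmul b h =>
    rw [lTensor_tmul, lTensor_tmul, TensorProduct.rid_tmul, Algebra.smul_def, Algebra.commutes,
      ← hγ.conv_left_apply]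
    induction comul (R := k) h using TensorProduct.induction_on with
    | zero => simp
    | add x y hx hy => simp only [tmul_add, map_add, mul_add, hx, hy]
    | tmul d h => simp [mul_assoc]

/-- The injectivity half: ν(b γ(h)) = b γ(h₁) ⊗ h₂ for coinvariant b, and the projection sends b
γ(h₁) to b ε(h₁). -/
lemma cleftProj_mulRight (hA : IsComoduleAlgebra c s ν) (hγ : IsCleftPair c s ν γ γ')
    (t : coinvariants hA ⊗[k] H) :
    (cleftProj ν γ').rTensor H (ν (mulRight γ ((coinvariants hA).val.toLinearMap.rTensor H t)))
      = (coinvariants hA).val.toLinearMap.rTensor H t := by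
  induction t using TensorProduct.induction_on with
  | zero => simp
  | add x y hx hy => simp only [map_add, hx, hy]
  | tmul b h =>
    have h1 := LinearMap.congr_fun hγ.colinear h
    simp only [LinearMap.comp_apply] at h1
    have h2 := LinearMap.congr_fun (Coalgebra.rTensor_counit_comp_comul (R := k) (A := H)) h
    simp only [LinearMap.comp_apply, TensorProduct.mk_apply] at h2
    have h3 : ∀ w : H ⊗[k] H, (cleftProj ν γ').rTensor H (((b : A) ⊗ₜ 1) * γ.rTensor H w)
        = TensorProduct.map (LinearMap.toSpanSingleton k A (b : A)) LinearMap.id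
          ((counit (R := k) (A := H)).rTensor H w) := by
      intro w
      induction w using TensorProduct.induction_on with
      | zero => simp
      | add x y hx hy => simp only [map_add, mul_add, hx, hy]
      | tmul h₁ h₂ =>
        simp [cleftProj_mul_left hA b.2, hγ.cleftProj_apply_cleft, Algebra.smul_def,
          Algebra.commutes]
    rw [rTensor_tmul, mulRight_tmul]
    change (cleftProj ν γ').rTensor H (ν ((b : A) * γ h)) = (b : A) ⊗ₜ h
    rw [coact_mul_left hA b.2, h1, h3, h2]
    simp

/-- The projection is composed of ν, γ' and the multiplication, each of which is compatible with the
transpositions; the one for γ' is `compat_inv`. -/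
lemma compat_cleftProj (hA : IsComoduleAlgebra c s ν) (hγ : IsCleftPair c s ν γ γ') :
    (cleftProj ν γ').rTensor H ∘ₗ s = s ∘ₗ (cleftProj ν γ').lTensor H := by
  have h1 := passPair_natural (s := s) (s' := s) (f := LinearMap.id) (by simp) hγ.compat_inv
  have h2 := hA.transposition.alg_mul
  have h3 := hA.comodule.compat
  change (γ'.lTensor A).rTensor H ∘ₗ _ = _ ∘ₗ (γ'.lTensor A).lTensor H at h1
  rw [cleftProj, rTensor_comp, rTensor_comp, lTensor_comp, lTensor_comp, LinearMap.comp_assoc,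
    LinearMap.comp_assoc, h3, ← LinearMap.comp_assoc _ _ ((γ'.lTensor A).rTensor H), h1,
    ← LinearMap.comp_assoc, ← LinearMap.comp_assoc, ← h2]
  rfl

lemma coact_cleft_mul (hA : IsComoduleAlgebra c s ν) (hγ : IsCleftPair c s ν γ γ') (h : H) {b : A}
    (hb : b ∈ coinvariants hA) : ν (γ h * b) = crossAct s (mulLeft γ) (h ⊗ₜ b) := by
  have h1 := LinearMap.congr_fun hA.mul (γ h ⊗ₜ b)
  have h2 := LinearMap.congr_fun hγ.colinear h
  simp only [LinearMap.comp_apply, mul'_apply, TensorProduct.map_tmul] at h1 h2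
  rw [h1, h2, hA.mem_coinvariants.1 hb]
  simp only [crossAct, LinearMap.comp_apply, rTensor_tmul, LinearEquiv.coe_coe]
  induction comul (R := k) h using TensorProduct.induction_on with
  | zero => simp
  | add x y hx hy => simp only [add_tmul, map_add, hx, hy]
  | tmul h₁ h₂ =>
    rw [rTensor_tmul, twMul_tmul, ← Algebra.TensorProduct.one_def, mul_one,
      TensorProduct.assoc_tmul, lTensor_tmul]
    induction s (h₂ ⊗ₜ b) using TensorProduct.induction_on with
    | zero => simp
    | add x y hx hy => simp only [tmul_add, map_add, mul_add, hx, hy]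
    | tmul a' l => simp

/-- Identifies the action prescribed in the statement with h ⊗ b ↦ π(γ(h) b), the form in which its
axioms become visible. `cleftCoc_apply` does the same for the cocycle. -/
lemma cleftAct_apply (hA : IsComoduleAlgebra c s ν) (hγ : IsCleftPair c s ν γ γ') (h : H) {b : A}
    (hb : b ∈ coinvariants hA) : cleftProj ν γ' (γ h * b) = cleftAct s γ γ' (h ⊗ₜ b) := by
  rw [cleftProj_apply, hγ.coact_cleft_mul hA h hb]
  simp only [crossAct, cleftAct, LinearMap.comp_apply, rTensor_tmul, LinearEquiv.coe_coe]
  induction comul (R := k) h using TensorProduct.induction_on with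
  | zero => simp
  | add x y hx hy => simp only [add_tmul, map_add, hx, hy]
  | tmul h₁ h₂ =>
    simp only [TensorProduct.assoc_tmul, lTensor_tmul, TensorProduct.map_tmul, LinearMap.comp_apply]
    induction s (h₂ ⊗ₜ b) using TensorProduct.induction_on with
    | zero => simp
    | add x y hx hy => simp only [tmul_add, map_add, hx, hy]
    | tmul a' l => simp [mul_assoc]

lemma coact_cleft_mul_cleft (hA : IsComoduleAlgebra c s ν) (hγ : IsCleftPair c s ν γ γ')
    (h l : H) : ν (γ h * γ l) = crossCoc c (mulBoth γ) (h ⊗ₜ l) := by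
  have h1 := LinearMap.congr_fun hA.mul (γ h ⊗ₜ γ l)
  have h2 := LinearMap.congr_fun hγ.colinear h
  have h3 := LinearMap.congr_fun hγ.colinear l
  simp only [LinearMap.comp_apply, mul'_apply, TensorProduct.map_tmul] at h1 h2 h3
  rw [h1, h2, h3]
  simp only [crossCoc, comulTwo, LinearMap.comp_apply, TensorProduct.map_tmul]
  induction comul (R := k) h using TensorProduct.induction_on with
  | zero => simp
  | add x y hx hy => simp only [add_tmul, map_add, hx, hy]
  | tmul h₁ h₂ =>
  induction comul (R := k) l using TensorProduct.induction_on with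
  | zero => simp
  | add x y hx hy => simp only [tmul_add, map_add, hx, hy]
  | tmul l₁ l₂ =>
  have h4 := LinearMap.congr_fun hγ.compat (h₂ ⊗ₜ l₁)
  simp only [LinearMap.comp_apply, lTensor_tmul] at h4
  rw [rTensor_tmul, rTensor_tmul, twMul_tmul, ← h4, midMap_tmul]
  induction c (h₂ ⊗ₜ l₁) using TensorProduct.induction_on with
  | zero => simp
  | add x y hx hy => simp only [tmul_add, add_tmul, map_add, mul_add, add_mul, hx, hy]
  | tmul a' l => simp

lemma cleftCoc_apply (hA : IsComoduleAlgebra c s ν) (hγ : IsCleftPair c s ν γ γ') (h l : H) :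
    cleftProj ν γ' (γ h * γ l) = cleftCoc c γ γ' (h ⊗ₜ l) := by
  rw [cleftProj_apply, hγ.coact_cleft_mul_cleft hA h l]
  simp only [crossCoc, cleftCoc, LinearMap.comp_apply]
  induction comulTwo c (h ⊗ₜ l) using TensorProduct.induction_on with
  | zero => simp
  | add x y hx hy => simp only [map_add, hx, hy]
  | tmul h₁ h₂ => simp [mulBoth]

end IsCleftPair

end Cleft

end Braided

namespace Braided

open Coalgebra LinearMap TensorProduct

/-! ### Restriction of the transposition to the coinvariants -/

section Restriction

variable {k H A : Type*} [Field k] [Ring H] [Algebra k H] [Coalgebra k H] [Ring A] [Algebra k A]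
variable {c : H ⊗[k] H →ₗ[k] H ⊗[k] H} {s : H ⊗[k] A →ₗ[k] A ⊗[k] H}
variable {ν : A →ₗ[k] A ⊗[k] H}

lemma coinvariants_exact (hA : IsComoduleAlgebra c s ν) :
    Function.Exact (coinvariants hA).val.toLinearMap
      (ν - (TensorProduct.mk k A H).flip 1) := by
  intro a
  rw [LinearMap.sub_apply, sub_eq_zero]
  exact ⟨fun h => ⟨⟨a, h⟩, rfl⟩, by rintro ⟨b, rfl⟩; exact b.2⟩

lemma rTensor_coinvariants_injective (hA : IsComoduleAlgebra c s ν) (M : Type*) [AddCommGroup M]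
    [Module k M] : Function.Injective ((coinvariants hA).val.toLinearMap.rTensor M) :=
  Module.Flat.rTensor_preserves_injective_linearMap _ Subtype.val_injective

lemma lTensor_coinvariants_injective (hA : IsComoduleAlgebra c s ν) (M : Type*) [AddCommGroup M]
    [Module k M] : Function.Injective ((coinvariants hA).val.toLinearMap.lTensor M) :=
  Module.Flat.lTensor_preserves_injective_linearMap _ Subtype.val_injective

lemma passPair_lTensor_one (hc : ∀ h : H, c (h ⊗ₜ 1) = 1 ⊗ₜ h) (w : H ⊗[k] A) :
    passPair s c (((TensorProduct.mk k A H).flip 1).lTensor H w)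
      = ((TensorProduct.mk k A H).flip 1).rTensor H (s w) := by
  induction w using TensorProduct.induction_on with
  | zero => simp
  | add x y hx hy => simp only [map_add, hx, hy]
  | tmul h a =>
    rw [lTensor_tmul, LinearMap.flip_apply, TensorProduct.mk_apply, passPair_tmul]
    induction s (h ⊗ₜ a) using TensorProduct.induction_on with
    | zero => simp
    | add x y hx hy => simp only [add_tmul, map_add, hx, hy]
    | tmul b l => simp [hc]

/-- The coinvariants are the kernel of ν - (· ⊗ 1), and tensoring over a field preserves kernels. So
membership in C ⊗ H can be tested with ν alone. -/
lemma rTensor_mem_range_iff (hA : IsComoduleAlgebra c s ν) (t : A ⊗[k] H) :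
    t ∈ LinearMap.range ((coinvariants hA).val.toLinearMap.rTensor H)
      ↔ ν.rTensor H t = ((TensorProduct.mk k A H).flip 1).rTensor H t := by
  rw [← sub_eq_zero, ← LinearMap.sub_apply, ← rTensor_sub]
  exact (Module.Flat.rTensor_exact H (coinvariants_exact hA) t).symm

lemma lTensor_mem_range_iff (hA : IsComoduleAlgebra c s ν) (t : H ⊗[k] A) :
    t ∈ LinearMap.range ((coinvariants hA).val.toLinearMap.lTensor H)
      ↔ ν.lTensor H t = ((TensorProduct.mk k A H).flip 1).lTensor H t := by
  rw [← sub_eq_zero, ← LinearMap.sub_apply, ← lTensor_sub]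
  exact (Module.Flat.lTensor_exact H (coinvariants_exact hA) t).symm

/-- On H ⊗ C the coaction is b ↦ b ⊗ 1, and both s and c carry h past it without changing that form.
So s(H ⊗ C) lies in the kernel that cuts out C ⊗ H. -/
lemma exists_restrict (hA : IsComoduleAlgebra c s ν) (hc : ∀ h : H, c (h ⊗ₜ 1) = 1 ⊗ₜ h) :
    ∃ sC : H ⊗[k] coinvariants hA →ₗ[k] coinvariants hA ⊗[k] H,
      (coinvariants hA).val.toLinearMap.rTensor H ∘ₗ sC
        = s ∘ₗ (coinvariants hA).val.toLinearMap.lTensor H := by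
  have hmem : ∀ w, (s ∘ₗ (coinvariants hA).val.toLinearMap.lTensor H) w
      ∈ LinearMap.range ((coinvariants hA).val.toLinearMap.rTensor H) := by
    intro w
    have h1 := LinearMap.congr_fun hA.comodule.compat
      ((coinvariants hA).val.toLinearMap.lTensor H w)
    have h2 := (lTensor_mem_range_iff hA _).1 ⟨w, rfl⟩
    simp only [LinearMap.comp_apply] at h1 ⊢
    rw [rTensor_mem_range_iff, h1, h2, passPair_lTensor_one hc]
  refine ⟨(LinearEquiv.ofInjective _ (rTensor_coinvariants_injective hA H)).symm.toLinearMap ∘ₗ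
    LinearMap.codRestrict _ _ hmem, LinearMap.ext fun w => ?_⟩
  have := congrArg Subtype.val
    ((LinearEquiv.ofInjective _ (rTensor_coinvariants_injective hA H)).apply_symm_apply
      (LinearMap.codRestrict _ _ hmem w))
  exact this

lemma passPair_injective {V W : Type*} [AddCommGroup V] [Module k V] [AddCommGroup W] [Module k W]
    {s : H ⊗[k] V →ₗ[k] V ⊗[k] H} {t : H ⊗[k] W →ₗ[k] W ⊗[k] H}
    (hs : Function.Injective s) (ht : Function.Injective t) :
    Function.Injective (passPair s t) := by
  simp only [passPair, LinearMap.coe_comp, LinearEquiv.coe_coe]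
  exact (LinearEquiv.injective _).comp
    ((Module.Flat.lTensor_preserves_injective_linearMap _ ht).comp ((LinearEquiv.injective _).comp
      ((Module.Flat.rTensor_preserves_injective_linearMap _ hs).comp (LinearEquiv.injective _))))

lemma rTensor_lTensor_apply {M N P Q : Type*} [AddCommGroup M] [Module k M] [AddCommGroup N]
    [Module k N] [AddCommGroup P] [Module k P] [AddCommGroup Q] [Module k Q]
    (f : M →ₗ[k] N) (g : P →ₗ[k] Q) (x : M ⊗[k] P) :
    f.rTensor Q (g.lTensor M x) = g.lTensor N (f.rTensor P x) := by
  rw [← LinearMap.comp_apply, ← LinearMap.comp_apply, rTensor_comp_lTensor, lTensor_comp_rTensor]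

/-- All identities are inherited through the injections C ⊗ M → A ⊗ M. Only surjectivity needs an
argument of its own. -/
lemma isLeftTransposition_restrict (hA : IsComoduleAlgebra c s ν)
    (hc : ∀ h : H, c (h ⊗ₜ 1) = 1 ⊗ₜ h) (hc' : Function.Injective c)
    {sC : H ⊗[k] coinvariants hA →ₗ[k] coinvariants hA ⊗[k] H}
    (hsC : (coinvariants hA).val.toLinearMap.rTensor H ∘ₗ sC
      = s ∘ₗ (coinvariants hA).val.toLinearMap.lTensor H) : IsLeftTransposition c sC := by
  have hs := hA.transposition
  have hsC' : ∀ w, (coinvariants hA).val.toLinearMap.rTensor H (sC w)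
      = s ((coinvariants hA).val.toLinearMap.lTensor H w) := fun w => LinearMap.congr_fun hsC w
  have hpass : ∀ w, (coinvariants hA).val.toLinearMap.rTensor (H ⊗[k] H) (passTwo sC w)
      = passTwo s ((coinvariants hA).val.toLinearMap.lTensor (H ⊗[k] H) w) :=
    fun w => LinearMap.congr_fun (passTwo_natural hsC) w
  constructor
  · constructor
    · constructor
      · refine Function.Injective.of_comp (f := (coinvariants hA).val.toLinearMap.rTensor H) ?_
        rw [← LinearMap.coe_comp, hsC, LinearMap.coe_comp]
        exact hs.bijective.1.comp (lTensor_coinvariants_injective hA H)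
      · intro t
        obtain ⟨w, hw⟩ := hs.bijective.2 ((coinvariants hA).val.toLinearMap.rTensor H t)
        have h1 := LinearMap.congr_fun hA.comodule.compat w
        have h2 := (rTensor_mem_range_iff hA (s w)).1 ⟨t, hw.symm⟩
        simp only [LinearMap.comp_apply] at h1
        -- If s(w) lies in C ⊗ H, then the operator `passPair s c` takes equal values on (H ⊗ ν)(w)
        -- and on w with 1 inserted. It is injective because s and c are, so w lies in H ⊗ C.
        rw [h2, ← passPair_lTensor_one hc] at h1
        obtain ⟨w', rfl⟩ := (lTensor_mem_range_iff hA w).2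
          (passPair_injective hs.bijective.1 hc' h1.symm)
        exact ⟨w', rTensor_coinvariants_injective hA H (by rw [hsC', hw])⟩
    · intro v
      apply rTensor_coinvariants_injective hA H
      rw [hsC', lTensor_tmul, rTensor_tmul, hs.unit]
    · refine LinearMap.ext fun w => rTensor_coinvariants_injective hA H ?_
      have := LinearMap.congr_fun hs.mul ((coinvariants hA).val.toLinearMap.lTensor (H ⊗[k] H) w)
      simp only [LinearMap.comp_apply] at this ⊢
      rw [hsC', rTensor_lTensor_apply, hpass, ← this, rTensor_lTensor_apply]
    · refine LinearMap.ext fun w => Subtype.val_injective ?_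
      have := LinearMap.congr_fun hs.counit ((coinvariants hA).val.toLinearMap.lTensor H w)
      simp only [LinearMap.comp_apply, LinearEquiv.coe_coe] at this ⊢
      have h1 : ∀ t : coinvariants hA ⊗[k] k, ((TensorProduct.rid k _ t : coinvariants hA) : A)
          = TensorProduct.rid k A ((coinvariants hA).val.toLinearMap.rTensor k t) := by
        intro t
        induction t using TensorProduct.induction_on with
        | zero => simp
        | add x y hx hy => simp only [map_add, Subalgebra.coe_add, hx, hy]
        | tmul x r => simp
      have h2 : ∀ t : k ⊗[k] coinvariants hA, ((TensorProduct.lid k _ t : coinvariants hA) : A)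
          = TensorProduct.lid k A ((coinvariants hA).val.toLinearMap.lTensor k t) := by
        intro t
        induction t using TensorProduct.induction_on with
        | zero => simp
        | add x y hx hy => simp only [map_add, Subalgebra.coe_add, hx, hy]
        | tmul r x => simp
      rw [h1, h2, rTensor_lTensor_apply, hsC', this, rTensor_lTensor_apply]
    · refine LinearMap.ext fun w => rTensor_coinvariants_injective hA (H ⊗[k] H) ?_
      have := LinearMap.congr_fun hs.comul ((coinvariants hA).val.toLinearMap.lTensor H w)
      simp only [LinearMap.comp_apply] at this ⊢
      rw [rTensor_lTensor_apply, hsC', this, hpass, rTensor_lTensor_apply]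
    · refine LinearMap.ext fun w => rTensor_coinvariants_injective hA (H ⊗[k] H) ?_
      have := LinearMap.congr_fun hs.braid
        ((coinvariants hA).val.toLinearMap.lTensor (H ⊗[k] H) w)
      simp only [LinearMap.comp_apply] at this ⊢
      rw [hpass, rTensor_lTensor_apply, hpass, ← this, rTensor_lTensor_apply]
  · intro h
    apply rTensor_coinvariants_injective hA H
    rw [hsC', lTensor_tmul, rTensor_tmul]
    exact hs.alg_unit h
  · refine LinearMap.ext fun w => rTensor_coinvariants_injective hA H ?_
    have h1 := LinearMap.congr_fun hs.alg_mul ((TensorProduct.map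
      (coinvariants hA).val.toLinearMap (coinvariants hA).val.toLinearMap).lTensor H w)
    have h2 := LinearMap.congr_fun (passPair_natural hsC hsC) w
    have h3 : (coinvariants hA).val.toLinearMap ∘ₗ mul' k (coinvariants hA)
        = mul' k A ∘ₗ TensorProduct.map (coinvariants hA).val.toLinearMap
          (coinvariants hA).val.toLinearMap := TensorProduct.ext' fun a b => by simp
    simp only [LinearMap.comp_apply] at h1 h2 ⊢
    rw [hsC', ← lTensor_comp_apply, h3, lTensor_comp_apply, h1, ← h2, ← rTensor_comp_apply,
      ← rTensor_comp_apply, h3]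

end Restriction

/-! ### The weak action and the cocycle of a cleft map -/

section Associated

variable {k H A : Type*} [Field k] [Ring H] [Algebra k H] [Coalgebra k H] [Ring A] [Algebra k A]
variable {c : H ⊗[k] H →ₗ[k] H ⊗[k] H} {s : H ⊗[k] A →ₗ[k] A ⊗[k] H}
variable {ν : A →ₗ[k] A ⊗[k] H} {γ γ' : H →ₗ[k] A}

namespace IsCleftPair

/-- The projection `a ↦ a₀ γ'(a₁)` on the coinvariants. -/
noncomputable def proj (hA : IsComoduleAlgebra c s ν) (hγ : IsCleftPair c s ν γ γ') :
    A →ₗ[k] coinvariants hA where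
  toFun a := ⟨cleftProj ν γ' a, hγ.cleftProj_mem hA a⟩
  map_add' a b := Subtype.ext (map_add _ a b)
  map_smul' r a := Subtype.ext (map_smul _ r a)

lemma coe_proj (hA : IsComoduleAlgebra c s ν) (hγ : IsCleftPair c s ν γ γ') (a : A) :
    (hγ.proj hA a : A) = cleftProj ν γ' a := rfl

/-- The weak action associated with a cleft map. -/
noncomputable def weakAct (hA : IsComoduleAlgebra c s ν) (hγ : IsCleftPair c s ν γ γ') :
    H ⊗[k] coinvariants hA →ₗ[k] coinvariants hA :=
  hγ.proj hA ∘ₗ mulLeft γ ∘ₗ (coinvariants hA).val.toLinearMap.lTensor H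

/-- The cocycle associated with a cleft map. -/
noncomputable def cocycleMap (hA : IsComoduleAlgebra c s ν) (hγ : IsCleftPair c s ν γ γ') :
    H ⊗[k] H →ₗ[k] coinvariants hA :=
  hγ.proj hA ∘ₗ mulBoth γ

lemma coe_weakAct (hA : IsComoduleAlgebra c s ν) (hγ : IsCleftPair c s ν γ γ') (h : H)
    (a : coinvariants hA) : (hγ.weakAct hA (h ⊗ₜ a) : A) = cleftProj ν γ' (γ h * a) := by
  simp [weakAct, coe_proj]

lemma coe_cocycleMap (hA : IsComoduleAlgebra c s ν) (hγ : IsCleftPair c s ν γ γ') (h l : H) :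
    (hγ.cocycleMap hA (h ⊗ₜ l) : A) = cleftProj ν γ' (γ h * γ l) := by
  simp [cocycleMap, coe_proj]

variable {hA : IsComoduleAlgebra c s ν}
  {sC : H ⊗[k] coinvariants hA →ₗ[k] coinvariants hA ⊗[k] H}

lemma isAssociated (hγ : IsCleftPair c s ν γ γ')
    (hsC : (coinvariants hA).val.toLinearMap.rTensor H ∘ₗ sC
      = s ∘ₗ (coinvariants hA).val.toLinearMap.lTensor H) :
    IsAssociated hA γ γ' sC (hγ.weakAct hA) (hγ.cocycleMap hA) where
  conv_left := hγ.conv_left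
  conv_right := hγ.conv_right
  restrict := hsC
  act := TensorProduct.ext' fun h a => by
    rw [LinearMap.comp_apply, LinearMap.comp_apply, lTensor_tmul]
    exact (hγ.coe_weakAct hA h a).trans (hγ.cleftAct_apply hA h a.2)
  coc := TensorProduct.ext' fun h l => (hγ.coe_cocycleMap hA h l).trans (hγ.cleftCoc_apply hA h l)

lemma rTensor_crossAct (hγ : IsCleftPair c s ν γ γ')
    (hsC : (coinvariants hA).val.toLinearMap.rTensor H ∘ₗ sC
      = s ∘ₗ (coinvariants hA).val.toLinearMap.lTensor H) (h : H) (a : coinvariants hA) :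
    (coinvariants hA).val.toLinearMap.rTensor H (crossAct sC (hγ.weakAct hA) (h ⊗ₜ a))
      = (cleftProj ν γ').rTensor H (ν (γ h * a)) := by
  have h1 := LinearMap.congr_fun (crossAct_natural (ρ := hγ.weakAct hA)
    (ρ' := cleftProj ν γ' ∘ₗ mulLeft γ) hsC rfl) (h ⊗ₜ a)
  simp only [LinearMap.comp_apply, lTensor_tmul] at h1
  rw [h1, hγ.coact_cleft_mul hA h a.2]
  simp only [crossAct, rTensor_comp, LinearMap.comp_apply]
  rfl

lemma rTensor_crossCoc (hγ : IsCleftPair c s ν γ γ') (h l : H) :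
    (coinvariants hA).val.toLinearMap.rTensor H (crossCoc c (hγ.cocycleMap hA) (h ⊗ₜ l))
      = (cleftProj ν γ').rTensor H (ν (γ h * γ l)) := by
  rw [hγ.coact_cleft_mul_cleft hA]
  simp only [crossCoc, LinearMap.comp_apply]
  induction comulTwo c (h ⊗ₜ l) using TensorProduct.induction_on with
  | zero => simp only [LinearMap.map_zero]
  | add x y hx hy => simp only [map_add, hx, hy]
  | tmul x y =>
    simp only [TensorProduct.map_tmul, rTensor_tmul]
    rfl

/-- The map `a ⊗ h ↦ a γ(h)`, for coinvariant `a`. -/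
noncomputable def crossMul (hA : IsComoduleAlgebra c s ν) (γ : H →ₗ[k] A) :
    coinvariants hA ⊗[k] H →ₗ[k] A :=
  mulRight γ ∘ₗ (coinvariants hA).val.toLinearMap.rTensor H

lemma crossMul_tmul (γ : H →ₗ[k] A) (a : coinvariants hA) (h : H) :
    crossMul hA γ (a ⊗ₜ h) = a * γ h := by
  simp [crossMul]

/-- The element X(h ⊗ a) consists of the normal basis coordinates of γ(h) a, so multiplying out
recovers γ(h) a. `crossMul_crossCoc` says the same of F(h ⊗ l) and γ(h) γ(l). With these two facts
every axiom below becomes a statement about products in A. -/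
lemma crossMul_crossAct (hγ : IsCleftPair c s ν γ γ')
    (hsC : (coinvariants hA).val.toLinearMap.rTensor H ∘ₗ sC
      = s ∘ₗ (coinvariants hA).val.toLinearMap.lTensor H) (h : H) (a : coinvariants hA) :
    crossMul hA γ (crossAct sC (hγ.weakAct hA) (h ⊗ₜ a)) = γ h * a := by
  rw [crossMul, LinearMap.comp_apply, hγ.rTensor_crossAct hsC, hγ.mulRight_cleftProj hA]

lemma crossMul_crossCoc (hγ : IsCleftPair c s ν γ γ') (h l : H) :
    crossMul hA γ (crossCoc c (hγ.cocycleMap hA) (h ⊗ₜ l)) = γ h * γ l := by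
  rw [crossMul, LinearMap.comp_apply, hγ.rTensor_crossCoc, hγ.mulRight_cleftProj hA]

lemma mul_lTensor_cocycleMap (hγ : IsCleftPair c s ν γ γ') (u : coinvariants hA ⊗[k] H) (m : H) :
    mul' k _ ((hγ.cocycleMap hA).lTensor _ (TensorProduct.assoc k _ H H (u ⊗ₜ m)))
      = hγ.proj hA (crossMul hA γ u * γ m) := by
  induction u using TensorProduct.induction_on with
  | zero => simp only [zero_tmul, LinearMap.map_zero, LinearEquiv.map_zero, zero_mul]
  | add x y hx hy => simp only [add_tmul, map_add, add_mul, hx, hy]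
  | tmul a h =>
    apply Subtype.ext
    rw [TensorProduct.assoc_tmul, lTensor_tmul, mul'_apply, crossMul_tmul, coe_proj, mul_assoc,
      cleftProj_mul_left hA a.2, ← hγ.coe_cocycleMap hA]
    rfl

lemma mul_lTensor_weakAct (hγ : IsCleftPair c s ν γ γ') (u : coinvariants hA ⊗[k] H)
    (b : coinvariants hA) :
    mul' k _ ((hγ.weakAct hA).lTensor _ (TensorProduct.assoc k _ H _ (u ⊗ₜ b)))
      = hγ.proj hA (crossMul hA γ u * b) := by
  induction u using TensorProduct.induction_on with
  | zero => simp only [zero_tmul, LinearMap.map_zero, LinearEquiv.map_zero, zero_mul]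
  | add x y hx hy => simp only [add_tmul, map_add, add_mul, hx, hy]
  | tmul a h =>
    apply Subtype.ext
    rw [TensorProduct.assoc_tmul, lTensor_tmul, mul'_apply, crossMul_tmul, coe_proj, mul_assoc,
      cleftProj_mul_left hA a.2, ← hγ.coe_weakAct hA]
    rfl

lemma slide_crossAct_cocycleMap (hγ : IsCleftPair c s ν γ γ')
    (hsC : (coinvariants hA).val.toLinearMap.rTensor H ∘ₗ sC
      = s ∘ₗ (coinvariants hA).val.toLinearMap.lTensor H) (h : H) (w : coinvariants hA ⊗[k] H) :
    slide (crossAct sC (hγ.weakAct hA)) (hγ.cocycleMap hA) (h ⊗ₜ w)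
      = hγ.proj hA (γ h * crossMul hA γ w) := by
  induction w using TensorProduct.induction_on with
  | zero => simp only [tmul_zero, LinearMap.map_zero, mul_zero]
  | add x y hx hy => simp only [tmul_add, map_add, mul_add, hx, hy]
  | tmul a l =>
    rw [slide_tmul, hγ.mul_lTensor_cocycleMap, hγ.crossMul_crossAct hsC, crossMul_tmul, mul_assoc]

lemma compat_proj (hγ : IsCleftPair c s ν γ γ')
    (hsC : (coinvariants hA).val.toLinearMap.rTensor H ∘ₗ sC
      = s ∘ₗ (coinvariants hA).val.toLinearMap.lTensor H) :
    (hγ.proj hA).rTensor H ∘ₗ s = sC ∘ₗ (hγ.proj hA).lTensor H := by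
  refine LinearMap.ext fun w => rTensor_coinvariants_injective hA H ?_
  have h1 := LinearMap.congr_fun hsC ((hγ.proj hA).lTensor H w)
  have h2 := LinearMap.congr_fun (hγ.compat_cleftProj hA) w
  have h3 : (coinvariants hA).val.toLinearMap ∘ₗ hγ.proj hA = cleftProj ν γ' := rfl
  simp only [LinearMap.comp_apply] at h1 h2 ⊢
  rw [h1, ← rTensor_comp_apply, ← lTensor_comp_apply, h3, h2]

/-- Multiplicativity is π((γ(h) a) b) = π(γ(h) (ab)), with γ(h) a written in normal form.
Compatibility with s holds because the action is composed of γ, the multiplication and π, all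
compatible. -/
lemma isWeakAction (hγ : IsCleftPair c s ν γ γ') (hc : ∀ h : H, c (h ⊗ₜ 1) = 1 ⊗ₜ h)
    (hc' : Function.Injective c)
    (hsC : (coinvariants hA).val.toLinearMap.rTensor H ∘ₗ sC
      = s ∘ₗ (coinvariants hA).val.toLinearMap.lTensor H) :
    IsWeakAction c sC (hγ.weakAct hA) where
  transposition := isLeftTransposition_restrict hA hc hc' hsC
  one_act a := Subtype.ext <| by
    rw [coe_weakAct, hγ.map_one, one_mul, hγ.cleftProj_coinv hA a.2]
  compat := by
    have h1 := passPair_natural hγ.compat hsC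
    have h2 := hγ.compat_proj hsC
    have h3 := hA.transposition.alg_mul
    have h4 : hγ.weakAct hA = hγ.proj hA ∘ₗ mul' k A ∘ₗ
        TensorProduct.map γ (coinvariants hA).val.toLinearMap :=
      TensorProduct.ext' fun h a => by simp [weakAct]
    rw [h4, lTensor_comp, lTensor_comp, rTensor_comp, rTensor_comp, LinearMap.comp_assoc,
      LinearMap.comp_assoc, h1, ← LinearMap.comp_assoc, ← h2, LinearMap.comp_assoc,
      ← LinearMap.comp_assoc _ _ s, h3]
    rfl
  act_mul := by
    refine TensorProduct.ext' fun h w => ?_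
    induction w using TensorProduct.induction_on with
    | zero => simp only [tmul_zero, LinearMap.map_zero]
    | add x y hx hy => simp only [tmul_add, map_add, hx, hy]
    | tmul a b =>
      have h1 : mul' k _ (TensorProduct.map (hγ.weakAct hA) (hγ.weakAct hA)
          (midMap sC (comul (R := k) h ⊗ₜ (a ⊗ₜ b))))
          = mul' k _ ((hγ.weakAct hA).lTensor _ (TensorProduct.assoc k _ H _
            (crossAct sC (hγ.weakAct hA) (h ⊗ₜ a) ⊗ₜ b))) := by
        simp only [crossAct, LinearMap.comp_apply, LinearMap.rTensor_tmul]
        induction comul (R := k) h using TensorProduct.induction_on with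
        | zero => simp only [zero_tmul, LinearMap.map_zero, LinearEquiv.map_zero]
        | add x y hx hy => simp only [add_tmul, map_add, hx, hy]
        | tmul h₁ h₂ =>
          rw [midMap_tmul]
          simp only [LinearEquiv.coe_coe, TensorProduct.assoc_tmul, lTensor_tmul]
          induction sC (h₂ ⊗ₜ a) using TensorProduct.induction_on with
          | zero => simp only [zero_tmul, tmul_zero, LinearMap.map_zero, LinearEquiv.map_zero]
          | add x y hx hy => simp only [add_tmul, tmul_add, map_add, hx, hy]
          | tmul x y => simp
      simp only [LinearMap.comp_apply, lTensor_tmul, rTensor_tmul, mul'_apply]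
      rw [h1, hγ.mul_lTensor_weakAct, hγ.crossMul_crossAct hsC]
      apply Subtype.ext
      rw [coe_weakAct, coe_proj, Subalgebra.coe_mul, mul_assoc]
  act_one h := Subtype.ext <| by
    rw [coe_weakAct, Subalgebra.coe_one, mul_one, hγ.cleftProj_apply_cleft]
    rfl

/-- The cocycle identity is π applied to the two bracketings of γ(h) γ(l) γ(m), and the twisted
module identity is π applied to those of γ(h) γ(l) a. -/
lemma isCocycle (hγ : IsCleftPair c s ν γ γ')
    (hsC : (coinvariants hA).val.toLinearMap.rTensor H ∘ₗ sC
      = s ∘ₗ (coinvariants hA).val.toLinearMap.lTensor H) :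
    IsCocycle c sC (hγ.weakAct hA) (hγ.cocycleMap hA) where
  normal_left h := Subtype.ext <| by
    rw [coe_cocycleMap, hγ.map_one, one_mul, hγ.cleftProj_apply_cleft]
    rfl
  normal_right h := Subtype.ext <| by
    rw [coe_cocycleMap, hγ.map_one, mul_one, hγ.cleftProj_apply_cleft]
    rfl
  compat := by
    have h1 := passPair_natural hγ.compat hγ.compat
    have h2 := hγ.compat_proj hsC
    have h3 := hA.transposition.alg_mul
    rw [cocycleMap, mulBoth, lTensor_comp, lTensor_comp, rTensor_comp, rTensor_comp,
      LinearMap.comp_assoc, LinearMap.comp_assoc, h1, ← LinearMap.comp_assoc, ← h2,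
      LinearMap.comp_assoc, ← LinearMap.comp_assoc _ _ s, h3]
    rfl
  cocycle := by
    refine TensorProduct.ext' fun h w => ?_
    induction w using TensorProduct.induction_on with
    | zero => simp only [tmul_zero, LinearMap.map_zero]
    | add x y hx hy => simp only [tmul_add, map_add, hx, hy]
    | tmul l m =>
      rw [LinearMap.comp_apply, lTensor_tmul, hγ.slide_crossAct_cocycleMap hsC, slide_tmul,
        hγ.mul_lTensor_cocycleMap, hγ.crossMul_crossCoc, hγ.crossMul_crossCoc, mul_assoc]
  twisted := by
    refine TensorProduct.ext' fun h w => ?_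
    induction w using TensorProduct.induction_on with
    | zero => simp only [tmul_zero, LinearMap.map_zero]
    | add x y hx hy => simp only [tmul_add, map_add, hx, hy]
    | tmul l a =>
      rw [LinearMap.comp_apply, lTensor_tmul, hγ.slide_crossAct_cocycleMap hsC, slide_tmul,
        hγ.mul_lTensor_weakAct, hγ.crossMul_crossAct hsC, hγ.crossMul_crossCoc, mul_assoc]

end IsCleftPair

end Associated

end Braided

/-! ### Gaussian binomials: the alternating sum, and values at a root of unity -/

namespace GaussAux

variable {R : Type*} [CommRing R]

/-- The Pascal rule shows that the sum for i + 1 is 1 - q^i times the sum for i. The factor vanishes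
at i = 0, so every sum beyond the first is zero. -/
lemma sum_alternating (q : R) (i : ℕ) :
    ∑ j ∈ Finset.range (i + 1), (-1) ^ j * q ^ (j * (j - 1) / 2) * gaussBinom q i j
      = if i = 0 then 1 else 0 := by
  have hstep : ∀ i : ℕ, ∑ j ∈ Finset.range (i + 1 + 1),
      (-1) ^ j * q ^ (j * (j - 1) / 2) * gaussBinom q (i + 1) j
      = (1 - q ^ i) * ∑ j ∈ Finset.range (i + 1),
        (-1) ^ j * q ^ (j * (j - 1) / 2) * gaussBinom q i j := by
    intro i
    have h1 : ∑ j ∈ Finset.range (i + 1),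
        (-1) ^ j * q ^ (j * (j - 1) / 2) * gaussBinom q i j
        = ∑ j ∈ Finset.range (i + 1), (-1) ^ (j + 1) * q ^ ((j + 1) * j / 2) *
          gaussBinom q i (j + 1) + 1 := by
      have h := Finset.sum_range_succ'
        (fun j => (-1) ^ j * q ^ (j * (j - 1) / 2) * gaussBinom q i j) (i + 1)
      rw [Finset.sum_range_succ, eq_zero q i (i + 1) (by omega)] at h
      simpa [zero_right] using h
    rw [Finset.sum_range_succ']
    simp only [gaussBinom, mul_add, Finset.sum_add_distrib]
    rw [sub_mul, one_mul]
    conv_rhs => rw [h1]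
    rw [← h1, Finset.mul_sum, add_assoc, add_comm, sub_eq_add_neg, ← Finset.sum_neg_distrib]
    congr 1
    · simpa [zero_right] using h1.symm
    -- The exponent (j+1)j/2 exceeds j(j-1)/2 by j, and q^j combines with the Pascal weight q^(i-j)
    -- into q^i, independent of j.
    · refine Finset.sum_congr rfl fun j hj => ?_
      rw [Finset.mem_range] at hj
      have e : (j + 1) * (j + 1 - 1) / 2 = j * (j - 1) / 2 + j := Nat.triangle_succ j
      have e2 : q ^ i = q ^ j * q ^ (i - j) := by rw [← pow_add]; congr 1; omega
      rw [e, e2, pow_add, pow_succ]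
      ring
  induction i with
  | zero => simp [zero_right]
  | succ i ih =>
    rw [hstep, ih]
    rcases i with _ | i <;> simp

variable {k : Type*} [Field k] {q : k} {n : ℕ}

lemma qFac_ne_zero (hq : IsPrimitiveRoot q n) {m : ℕ} (hm : m < n) : qFac q m ≠ 0 := by
  induction m with
  | zero => simp [qFac]
  | succ m ih =>
    refine mul_ne_zero (ih (by omega)) fun h => ?_
    have h1 := geom_sum_mul q (m + 1)
    rw [h, zero_mul] at h1
    exact hq.pow_ne_one_of_pos_of_lt (by omega) hm (sub_eq_zero.1 h1.symm)

lemma ne_zero_of_isPrimitiveRoot (hq : IsPrimitiveRoot q n) {m a : ℕ} (hm : m < n) (ha : a ≤ m) :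
    gaussBinom q m a ≠ 0 := by
  intro h
  have := mul_qFac q m a (m - a) (by omega)
  rw [h, zero_mul] at this
  exact qFac_ne_zero hq hm this.symm

/-- The q-factorial of n contains the factor 1 + q + ⋯ + q^(n-1) = 0, whereas those of a and n - a
are nonzero. -/
lemma eq_zero_of_isPrimitiveRoot (hq : IsPrimitiveRoot q n) {a : ℕ} (ha : 0 < a) (han : a < n) :
    gaussBinom q n a = 0 := by
  have h := mul_qFac q n a (n - a) (by omega)
  obtain ⟨m, rfl⟩ : ∃ m, n = m + 1 := ⟨n - 1, by omega⟩
  rw [qFac, hq.geom_sum_eq_zero (by omega), mul_zero] at h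
  exact (mul_eq_zero.1 h).resolve_right
    (mul_ne_zero (qFac_ne_zero hq han) (qFac_ne_zero hq (by omega)))

lemma symm_of_isPrimitiveRoot (hq : IsPrimitiveRoot q n) {m a : ℕ} (hm : m < n) (ha : a ≤ m) :
    gaussBinom q m (m - a) = gaussBinom q m a := by
  have h1 := mul_qFac q m a (m - a) (by omega)
  have h2 := mul_qFac q m (m - a) a (by omega)
  refine mul_right_cancel₀ (mul_ne_zero (qFac_ne_zero hq (show a < n by omega))
    (qFac_ne_zero hq (show m - a < n by omega))) ?_
  rw [h1, mul_comm (qFac q a), h2]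

end GaussAux

/-! ### Coordinates and skew primitive elements of `H_D` -/

namespace HopfDatum

variable {k G : Type*} [Field k] [Group G] (D : HopfDatum k G)

lemma n_pos : 0 < D.n := by have := D.one_lt_n; omega

lemma isPrimitiveRoot_qp : IsPrimitiveRoot D.qp D.n :=
  IsPrimitiveRoot.coe_units_iff.2 D.prim

lemma qp_eq : D.qp = D.q * D.χ D.z := by rw [qp, Units.val_mul]

lemma mon_mul (g h : G) (m l : ℕ) :
    D.mon g m * D.mon h l = ((D.χ h : k) ^ m) • D.mon (g * h) (m + l) :=
  D.mulMap_mon g h m l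

lemma mon_zero (g : G) : D.mon g 0 = D.grp g := rfl

lemma mon_ext {M : Type*} [AddCommMonoid M] [Module k M] {f f' : D.H →ₗ[k] M}
    (h : ∀ g i, i < D.n → f (D.mon g i) = f' (D.mon g i)) : f = f' :=
  D.basis.ext fun a => by rw [← D.mon_lt a.1 a.2]; exact h a.1 a.2 a.2.2

lemma braid_mon (g h : G) {i j : ℕ} (hi : i < D.n) (hj : j < D.n) :
    D.braid (D.mon g i ⊗ₜ D.mon h j) = (D.q : k) ^ (i * j) • (D.mon h j ⊗ₜ D.mon g i) := by
  have h1 := D.mon_lt g ⟨i, hi⟩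
  have h2 := D.mon_lt h ⟨j, hj⟩
  simp only at h1 h2
  simp [h1, h2, braid]

lemma braid_tmul_one (u : D.H) : D.braid (u ⊗ₜ 1) = 1 ⊗ₜ u := by
  have : D.braid ∘ₗ (TensorProduct.mk k D.H D.H).flip 1 = TensorProduct.mk k D.H D.H 1 := by
    refine D.mon_ext fun g i hi => ?_
    simp [one_def, D.braid_mon g 1 hi D.n_pos]
  exact LinearMap.congr_fun this u

lemma braid_injective : Function.Injective D.braid := by
  have : (TensorProduct.lift (D.basis.constr k fun a => D.basis.constr k fun b =>
      ((D.q : k) ^ ((a.2 : ℕ) * b.2))⁻¹ • (D.basis b ⊗ₜ[k] D.basis a))) ∘ₗ D.braid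
      = LinearMap.id := by
    refine (D.basis.tensorProduct D.basis).ext fun ⟨a, b⟩ => ?_
    have hq : (D.q : k) ^ ((a.2 : ℕ) * b.2) ≠ 0 := pow_ne_zero _ D.q.ne_zero
    simp [braid, mul_comm (b.2 : ℕ), smul_smul]
  exact Function.LeftInverse.injective (LinearMap.congr_fun this)

/-- The coefficient of `g x ^ i`; it is zero for `i ≥ n`. -/
noncomputable def cf (g : G) (i : ℕ) : D.H →ₗ[k] k :=
  if h : i < D.n then D.basis.coord (g, ⟨i, h⟩) else 0

lemma cf_fin (g : G) (i : Fin D.n) : D.cf g i = D.basis.coord (g, i) := by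
  simp [cf]

open scoped Classical in
lemma cf_mon (g h : G) (i : ℕ) {j : ℕ} (hj : j < D.n) :
    D.cf g i (D.mon h j) = if g = h ∧ i = j then 1 else 0 := by
  have h1 := D.mon_lt h ⟨j, hj⟩
  simp only at h1
  unfold cf
  split_ifs with h2 h3 h3
  · simp [h1, h3]
  · rw [h1, Module.Basis.coord_apply, Module.Basis.repr_self, Finsupp.single_eq_of_ne]
    simp only [ne_eq, Prod.mk.injEq, Fin.mk.injEq]
    exact h3
  · omega
  · simp

lemma cf_ext {u v : D.H} (h : ∀ g i, i < D.n → D.cf g i u = D.cf g i v) : u = v := by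
  refine D.basis.ext_elem fun a => ?_
  have := h a.1 a.2 a.2.2
  rwa [D.cf_fin a.1 a.2] at this

lemma lTensor_cf_ext {B : Type*} [AddCommGroup B] [Module k B] {t u : B ⊗[k] D.H}
    (h : ∀ g i, i < D.n → (D.cf g i).lTensor B t = (D.cf g i).lTensor B u) : t = u := by
  classical
  refine (TensorProduct.equivFinsuppOfBasisRight (M := B) D.basis).injective (Finsupp.ext fun a => ?_)
  have h1 : ∀ w : B ⊗[k] D.H, TensorProduct.equivFinsuppOfBasisRight D.basis w a
      = TensorProduct.rid k B ((D.cf a.1 a.2).lTensor B w) := by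
    intro w
    induction w using TensorProduct.induction_on with
    | zero => simp
    | add x y hx hy => simp only [map_add, Finsupp.add_apply, hx, hy]
    | tmul x y => simp [D.cf_fin a.1 a.2]
  rw [h1, h1, h a.1 a.2 a.2.2]

open scoped Classical in
-- The dual form of the comultiplication: products of coordinate functionals are Gaussian multiples
-- of coordinate functionals. No bound on a + b is needed, because `cf` vanishes at exponents from n
-- on.
lemma cf_comul (g h : G) (a b : ℕ) (u : D.H) :
    LinearMap.mul' k k (TensorProduct.map (D.cf g a) (D.cf h b) (Coalgebra.comul u))
      = if h = g * D.z ^ a then gaussBinom D.qp (a + b) a * D.cf g (a + b) u else 0 := by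
  have : LinearMap.mul' k k ∘ₗ TensorProduct.map (D.cf g a) (D.cf h b) ∘ₗ Coalgebra.comul
      = if h = g * D.z ^ a then gaussBinom D.qp (a + b) a • D.cf g (a + b) else 0 := by
    refine D.mon_ext fun g' i hi => ?_
    simp only [LinearMap.comp_apply, D.comul_mon g' i hi, map_sum, map_smul,
      TensorProduct.map_tmul, LinearMap.mul'_apply]
    have h1 : ∀ j ∈ Finset.range (i + 1), gaussBinom D.qp i j • (D.cf g a (D.mon g' j) *
        D.cf h b (D.mon (g' * D.z ^ j) (i - j)))
        = if j = a then (if g = g' ∧ h = g * D.z ^ a ∧ a + b = i then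
          gaussBinom D.qp i a else 0) else 0 := by
      intro j hj
      rw [Finset.mem_range] at hj
      rw [D.cf_mon _ _ _ (show j < D.n by omega), D.cf_mon _ _ _ (show i - j < D.n by omega)]
      by_cases hja : j = a
      · subst hja
        by_cases hg : g = g'
        · subst hg
          by_cases hh : h = g * D.z ^ j
          · have : b = i - j ↔ j + b = i := by omega
            simp [hh, this]
          · simp [hh]
        · simp [hg]
      · simp [hja, Ne.symm hja]
    rw [Finset.sum_congr rfl h1, Finset.sum_ite_eq']
    by_cases hh : h = g * D.z ^ a
    · rw [if_pos hh, LinearMap.smul_apply, D.cf_mon _ _ _ hi]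
      by_cases hi' : a + b = i
      · subst hi'
        simp [hh]
      · simp [hi']
    · simp [hh]
  have h2 := LinearMap.congr_fun this u
  simp only [LinearMap.comp_apply] at h2
  rw [h2]
  split_ifs <;> simp

lemma comul_x : Coalgebra.comul (R := k) D.x = 1 ⊗ₜ D.x + D.x ⊗ₜ D.grp D.z := by
  rw [x, D.comul_mon 1 1 D.one_lt_n, Finset.sum_range_succ, Finset.sum_range_one]
  simp [GaussAux.zero_right, GaussAux.self, one_def, grp]

/-- The skew primitive elements of `H_D` are the combinations of `x` and `1 - z`. -/
lemma eq_of_comul_eq {u : D.H} (hu : Coalgebra.comul (R := k) u = 1 ⊗ₜ u + u ⊗ₜ D.grp D.z) :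
    u = D.cf 1 1 u • D.x + D.cf 1 0 u • (1 - D.grp D.z) := by
  classical
  have key : ∀ g h a b, (if h = g * D.z ^ a then gaussBinom D.qp (a + b) a * D.cf g (a + b) u
      else 0) = (if g = 1 ∧ a = 0 then 1 else 0) * D.cf h b u +
        D.cf g a u * if h = D.z ∧ b = 0 then 1 else 0 := by
    intro g h a b
    rw [← D.cf_comul, hu, map_add, map_add, TensorProduct.map_tmul, TensorProduct.map_tmul,
      LinearMap.mul'_apply, LinearMap.mul'_apply, one_def, D.cf_mon _ _ _ D.n_pos, grp,
      D.cf_mon _ _ _ D.n_pos]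
  refine D.cf_ext fun g i hi => ?_
  have hx : D.cf g i (D.cf 1 1 u • D.x + D.cf 1 0 u • (1 - D.grp D.z))
      = D.cf 1 1 u * (if g = 1 ∧ i = 1 then 1 else 0) + D.cf 1 0 u *
        ((if g = 1 ∧ i = 0 then 1 else 0) - (if g = D.z ∧ i = 0 then 1 else 0)) := by
    rw [map_add, map_smul, map_smul, map_sub, x, one_def, grp, D.cf_mon _ _ _ D.one_lt_n,
      D.cf_mon _ _ _ D.n_pos, D.cf_mon _ _ _ D.n_pos, smul_eq_mul, smul_eq_mul]
  rw [hx]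
  -- The coefficients compared are those of 1 ⊗ g for i = 0, of g ⊗ gx for i = 1, and of gx ⊗
  -- gzx^(i-1) for larger i. In the last case the binomial is nonzero since i < n.
  rcases i with _ | _ | i
  · have := key 1 g 0 0
    simp only [pow_zero, mul_one, GaussAux.self, one_mul, add_zero, and_true, if_true] at this
    simp only [and_true, zero_ne_one, and_false, if_false, mul_zero, zero_add]
    by_cases h1 : g = 1
    · subst h1
      simp only [if_true] at this ⊢
      linear_combination -this
    · simp only [h1, if_false] at this ⊢
      linear_combination -this
  · have := key g g 0 1
    by_cases h1 : g = 1
    · simp [h1]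
    · simpa [h1, GaussAux.zero_right] using this
  · have := key g (g * D.z) 1 (i + 1)
    have hne := GaussAux.ne_zero_of_isPrimitiveRoot D.isPrimitiveRoot_qp hi
      (show 1 ≤ i + 1 + 1 by omega)
    rw [show 1 + (i + 1) = i + 1 + 1 by omega] at this
    simpa [hne] using this

end HopfDatum

namespace HopfDatum

open Braided

variable {k G B : Type*} [Field k] [Group G] [Ring B] [Algebra k B] (D : HopfDatum k G)

/-! ### How x passes a homogeneous element -/

section Transposition

variable {s : D.H ⊗[k] B →ₗ[k] B ⊗[k] D.H}

/-- The group elements of `H_D` pass `b` by means of the automorphism `ζ`. -/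
def IsHomogeneous (s : D.H ⊗[k] B →ₗ[k] B ⊗[k] D.H) (ζ : G ≃* G) (b : B) : Prop :=
  ∀ h : G, s (D.grp h ⊗ₜ b) = b ⊗ₜ D.grp (ζ h)

variable {D}

lemma alpha_apply (b : B) : D.α s b = TensorProduct.rid k B ((D.cf 1 1).lTensor B (s (D.x ⊗ₜ b))) := by
  simp [α, ← D.cf_fin 1 ⟨1, D.one_lt_n⟩]

lemma cf_one_one_x : D.cf 1 1 D.x = 1 := by
  rw [x, D.cf_mon _ _ _ D.one_lt_n, if_pos ⟨rfl, rfl⟩]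

lemma cf_one_zero_x : D.cf 1 0 D.x = 0 := by
  rw [x, D.cf_mon _ _ _ D.one_lt_n, if_neg (by simp)]

lemma cf_one_one_sub : D.cf 1 1 (1 - D.grp D.z) = 0 := by
  rw [map_sub, one_def, grp, D.cf_mon _ _ _ D.n_pos, D.cf_mon _ _ _ D.n_pos]
  simp

lemma cf_one_zero_sub (hz : D.z ≠ 1) : D.cf 1 0 (1 - D.grp D.z) = 1 := by
  rw [map_sub, one_def, grp, D.cf_mon _ _ _ D.n_pos, D.cf_mon _ _ _ D.n_pos]
  simp [hz.symm]

lemma left_eq_of_tmul_eq {M : Type*} [AddCommGroup M] [Module k M] {u v u' v' : M}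
    (h : u ⊗ₜ[k] D.x + v ⊗ₜ[k] (1 - D.grp D.z) = u' ⊗ₜ[k] D.x + v' ⊗ₜ[k] (1 - D.grp D.z)) :
    u = u' := by
  have := congrArg (fun t => TensorProduct.rid k M ((D.cf 1 1).lTensor M t)) h
  simpa only [map_add, LinearMap.lTensor_tmul, cf_one_one_x, cf_one_one_sub,
    TensorProduct.rid_tmul, one_smul, zero_smul, add_zero] using this

lemma right_eq_of_tmul_eq (hz : D.z ≠ 1) {M : Type*} [AddCommGroup M] [Module k M] {u v u' v' : M}
    (h : u ⊗ₜ[k] D.x + v ⊗ₜ[k] (1 - D.grp D.z) = u' ⊗ₜ[k] D.x + v' ⊗ₜ[k] (1 - D.grp D.z)) :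
    v = v' := by
  have := congrArg (fun t => TensorProduct.rid k M ((D.cf 1 0).lTensor M t)) h
  simpa only [map_add, LinearMap.lTensor_tmul, cf_one_zero_x, cf_one_zero_sub hz,
    TensorProduct.rid_tmul, one_smul, zero_smul, zero_add] using this

/-- Since Δx = 1 ⊗ x + x ⊗ z and both 1 and z pass b unchanged, compatibility with Δ makes the H-leg
of s(x ⊗ b) satisfy the equation of `eq_of_comul_eq`. By flatness s(x ⊗ b) therefore lies in B
tensored with the span of x and 1 - z. -/
lemma exists_apply_x (hs : IsLeftSpace D.braid s) {b : B}
    (hb : s (D.grp D.z ⊗ₜ b) = b ⊗ₜ D.grp D.z) :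
    ∃ β : B, s (D.x ⊗ₜ b) = D.α s b ⊗ₜ D.x + β ⊗ₜ (1 - D.grp D.z) := by
  set t := s (D.x ⊗ₜ b) with ht
  have h1 := LinearMap.congr_fun hs.comul (D.x ⊗ₜ b)
  simp only [LinearMap.comp_apply, LinearMap.rTensor_tmul, comul_x, TensorProduct.add_tmul,
    map_add, passTwo_tmul, hb, ← ht, TensorProduct.assoc_symm_tmul] at h1
  have h2 : ∀ t : B ⊗[k] D.H, TensorProduct.assoc k B D.H D.H (s.rTensor D.H
      ((TensorProduct.assoc k D.H B D.H).symm ((1 : D.H) ⊗ₜ t)))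
      = (TensorProduct.mk k D.H D.H 1).lTensor B t := by
    intro t
    induction t using TensorProduct.induction_on with
    | zero => simp
    | add x y hx hy => simp only [TensorProduct.tmul_add, map_add, hx, hy]
    | tmul v l => simp [hs.unit]
  have h3 : ∀ t : B ⊗[k] D.H, TensorProduct.assoc k B D.H D.H (t ⊗ₜ D.grp D.z)
      = ((TensorProduct.mk k D.H D.H).flip (D.grp D.z)).lTensor B t := by
    intro t
    induction t using TensorProduct.induction_on with
    | zero => simp
    | add x y hx hy => simp only [TensorProduct.add_tmul, map_add, hx, hy]
    | tmul v l => simp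
  set φ : D.H →ₗ[k] D.H ⊗[k] D.H := Coalgebra.comul - TensorProduct.mk k D.H D.H 1
    - (TensorProduct.mk k D.H D.H).flip (D.grp D.z) with hφ
  have h4 : φ.lTensor B t = 0 := by
    rw [hφ, LinearMap.lTensor_sub, LinearMap.lTensor_sub, LinearMap.sub_apply,
      LinearMap.sub_apply, h1, h2, h3]
    abel
  obtain ⟨w, hw⟩ := (Module.Flat.lTensor_exact B (LinearMap.exact_subtype_ker_map φ) t).1 h4
  have h5 : ∀ w : B ⊗[k] LinearMap.ker φ, (LinearMap.ker φ).subtype.lTensor B w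
      = TensorProduct.rid k B ((D.cf 1 1).lTensor B ((LinearMap.ker φ).subtype.lTensor B w))
        ⊗ₜ D.x + TensorProduct.rid k B ((D.cf 1 0).lTensor B
          ((LinearMap.ker φ).subtype.lTensor B w)) ⊗ₜ (1 - D.grp D.z) := by
    intro w
    induction w using TensorProduct.induction_on with
    | zero => simp
    | add x y hx hy =>
      simp only [map_add, TensorProduct.add_tmul]
      nth_rewrite 1 [hx, hy]
      abel
    | tmul v l =>
      have h6 : Coalgebra.comul (R := k) (l : D.H) = 1 ⊗ₜ (l : D.H) + (l : D.H) ⊗ₜ D.grp D.z := by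
        have h7 : Coalgebra.comul (R := k) (l : D.H) - 1 ⊗ₜ (l : D.H) - (l : D.H) ⊗ₜ D.grp D.z = 0 :=
          LinearMap.mem_ker.1 l.2
        rwa [sub_sub, sub_eq_zero] at h7
      simp only [LinearMap.lTensor_tmul, Submodule.subtype_apply, TensorProduct.rid_tmul]
      conv_lhs => rw [D.eq_of_comul_eq h6]
      rw [TensorProduct.tmul_add, TensorProduct.tmul_smul, TensorProduct.tmul_smul,
        TensorProduct.smul_tmul', TensorProduct.smul_tmul']
  refine ⟨TensorProduct.rid k B ((D.cf 1 0).lTensor B t), ?_⟩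
  rw [alpha_apply, ← ht, ← hw]
  exact h5 w

lemma braid_x_grp (g : G) : D.braid (D.x ⊗ₜ D.grp g) = D.grp g ⊗ₜ D.x := by
  rw [x, grp, D.braid_mon _ _ D.one_lt_n D.n_pos]; simp

lemma braid_grp_x (g : G) : D.braid (D.grp g ⊗ₜ D.x) = D.x ⊗ₜ D.grp g := by
  rw [x, grp, D.braid_mon _ _ D.n_pos D.one_lt_n]; simp

lemma braid_grp_grp (g h : G) : D.braid (D.grp g ⊗ₜ D.grp h) = D.grp h ⊗ₜ D.grp g := by
  rw [grp, grp, D.braid_mon _ _ D.n_pos D.n_pos]; simp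

lemma braid_x_x : D.braid (D.x ⊗ₜ D.x) = (D.q : k) • (D.x ⊗ₜ D.x) := by
  rw [x, D.braid_mon _ _ D.one_lt_n D.one_lt_n]; simp

lemma passTwo_grp_x {b u v : B} (h : s (D.x ⊗ₜ b) = u ⊗ₜ D.x + v ⊗ₜ (1 - D.grp D.z)) (l : D.H) :
    passTwo s ((l ⊗ₜ D.x) ⊗ₜ b) = TensorProduct.assoc k B D.H D.H
      (s (l ⊗ₜ u) ⊗ₜ D.x + s (l ⊗ₜ v) ⊗ₜ (1 - D.grp D.z)) := by
  rw [passTwo_tmul, h, TensorProduct.tmul_add, map_add, TensorProduct.assoc_symm_tmul,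
    TensorProduct.assoc_symm_tmul, map_add, LinearMap.rTensor_tmul, LinearMap.rTensor_tmul]

/-- Since c(x ⊗ g) = g ⊗ x, moving x and g past b in either order gives the same result. The
coefficients of x and, for z ≠ 1, of 1 - z can then be compared. -/
lemma isHomogeneous_of_apply_x (hs : IsLeftSpace D.braid s) {ζ : G ≃* G} {b u v : B}
    (hb : D.IsHomogeneous s ζ b) (h : s (D.x ⊗ₜ b) = u ⊗ₜ D.x + v ⊗ₜ (1 - D.grp D.z)) :
    D.IsHomogeneous s ζ u ∧ (D.z ≠ 1 → D.IsHomogeneous s ζ v) := by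
  have key : ∀ g : G, s (D.grp g ⊗ₜ u) ⊗ₜ[k] D.x + s (D.grp g ⊗ₜ v) ⊗ₜ[k] (1 - D.grp D.z)
      = (u ⊗ₜ D.grp (ζ g)) ⊗ₜ[k] D.x + (v ⊗ₜ D.grp (ζ g)) ⊗ₜ[k] (1 - D.grp D.z) := by
    intro g
    apply (TensorProduct.assoc k B D.H D.H).injective
    have h1 := LinearMap.congr_fun hs.braid ((D.x ⊗ₜ D.grp g) ⊗ₜ b)
    simp only [LinearMap.comp_apply, LinearMap.rTensor_tmul, braid_x_grp] at h1
    rw [passTwo_grp_x h, passTwo_tmul, hb, TensorProduct.assoc_symm_tmul,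
      LinearMap.rTensor_tmul, h] at h1
    rw [h1]
    simp only [TensorProduct.add_tmul, map_add, TensorProduct.assoc_tmul, LinearMap.lTensor_tmul,
      TensorProduct.sub_tmul, TensorProduct.tmul_sub, map_sub, braid_x_grp, ← D.grp_one,
      braid_grp_grp]
  exact ⟨fun g => left_eq_of_tmul_eq (key g), fun hz g => right_eq_of_tmul_eq hz (key g)⟩

/-- Compute s(xz ⊗ b) directly and through xz = p zx, and compare the coefficients of z: it occurs
in (1 - z)z but not in xz, and z² ≠ z. -/
lemma chi_smul_eq (hs : IsLeftSpace D.braid s) (hz : D.z ≠ 1) {b u v : B}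
    (hb : s (D.grp D.z ⊗ₜ b) = b ⊗ₜ D.grp D.z) (hu : s (D.grp D.z ⊗ₜ u) = u ⊗ₜ D.grp D.z)
    (hv : s (D.grp D.z ⊗ₜ v) = v ⊗ₜ D.grp D.z)
    (h : s (D.x ⊗ₜ b) = u ⊗ₜ D.x + v ⊗ₜ (1 - D.grp D.z)) : v = (D.χ D.z : k) • v := by
  have h1 := hs.apply_mul D.x (D.grp D.z) b
  have h2 := hs.apply_mul (D.grp D.z) D.x b
  rw [hb, twMul_tmul, ← Algebra.TensorProduct.one_def, one_mul, h, D.x_mul_grp,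
    ← TensorProduct.smul_tmul', map_smul, h2, h, TensorProduct.tmul_add, map_add, twMul_tmul,
    twMul_tmul, hu, hv, ← Algebra.TensorProduct.one_def, one_mul, one_mul] at h1
  simp only [add_mul, Algebra.TensorProduct.tmul_mul_tmul, mul_one] at h1
  have h3 := congrArg (fun t => TensorProduct.rid k B ((D.cf D.z 0).lTensor B t)) h1
  have e1 : D.cf D.z 0 (D.grp D.z * D.x) = 0 := by
    rw [grp, x, D.mon_mul, map_smul, D.cf_mon _ _ _ (by simpa using D.one_lt_n)]; simp
  have e2 : D.cf D.z 0 (D.x * D.grp D.z) = 0 := by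
    rw [D.x_mul_grp, map_smul, e1, smul_zero]
  have e3 : D.cf D.z 0 (D.grp D.z) = 1 := by
    rw [grp, D.cf_mon _ _ _ D.n_pos]; simp
  have e4 : D.cf D.z 0 (D.grp (D.z * D.z)) = 0 := by
    rw [grp, D.cf_mon _ _ _ D.n_pos]; simp [hz]
  simp only [map_add, map_smul, LinearMap.lTensor_tmul, TensorProduct.rid_tmul, e1, e2, e3, e4,
    mul_sub, sub_mul, map_sub, grp_mul, one_mul, mul_one, zero_smul, zero_add, sub_zero,
    one_smul] at h3
  exact h3.symm

/-- If v ≠ 0, then p = 1 by `chi_smul_eq`. Writing s(x ⊗ α(b)) and s(x ⊗ v) in the same form, with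
coefficients a, β and a', β', the braiding c(x ⊗ x) = q x ⊗ x gives qβ = a', qa' = β and qβ' = β'.
Now q = qp ≠ 1 and q ≠ -1, so a' = β' = 0. Then s(x ⊗ v) = 0, contradicting injectivity. -/
lemma eq_zero_of_apply_x (hs : IsLeftSpace D.braid s) (hpq : ¬ (D.χ D.z = 1 ∧ D.q = -1))
    (hz : D.z ≠ 1) {ζ : G ≃* G} (hζ : ζ D.z = D.z) {b v : B} (hb : D.IsHomogeneous s ζ b)
    (h : s (D.x ⊗ₜ b) = D.α s b ⊗ₜ D.x + v ⊗ₜ (1 - D.grp D.z)) : v = 0 := by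
  have hz' : ∀ {b}, D.IsHomogeneous s ζ b → s (D.grp D.z ⊗ₜ b) = b ⊗ₜ D.grp D.z := by
    intro b hb
    rw [hb, hζ]
  obtain ⟨hu, hv⟩ := isHomogeneous_of_apply_x hs hb h
  replace hv := hv hz
  by_contra hv0
  have hp : (D.χ D.z : k) = 1 := by
    have h1 := chi_smul_eq hs hz (hz' hb) (hz' hu) (hz' hv) h
    by_contra hp
    have h2 : ((D.χ D.z : k) - 1) • v = 0 := by rw [sub_smul, one_smul, ← h1, sub_self]
    exact (smul_eq_zero.1 h2).elim (fun h => hp (sub_eq_zero.1 h)) hv0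
  obtain ⟨β, hβ⟩ := exists_apply_x hs (hz' hu)
  obtain ⟨β', hβ'⟩ := exists_apply_x hs (hz' hv)
  set a := D.α s (D.α s b)
  set a' := D.α s v
  have h1 := LinearMap.congr_fun hs.braid ((D.x ⊗ₜ D.x) ⊗ₜ b)
  simp only [LinearMap.comp_apply, LinearMap.rTensor_tmul, braid_x_x] at h1
  rw [← TensorProduct.smul_tmul', map_smul, passTwo_grp_x h, hβ, hβ'] at h1
  have h2 : D.braid.lTensor B (TensorProduct.assoc k B D.H D.H
        ((a ⊗ₜ D.x + β ⊗ₜ (1 - D.grp D.z)) ⊗ₜ D.x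
          + (a' ⊗ₜ D.x + β' ⊗ₜ (1 - D.grp D.z)) ⊗ₜ (1 - D.grp D.z)))
      = TensorProduct.assoc k B D.H D.H
        ((((D.q : k) • a) ⊗ₜ D.x + a' ⊗ₜ (1 - D.grp D.z)) ⊗ₜ D.x
          + (β ⊗ₜ D.x + β' ⊗ₜ (1 - D.grp D.z)) ⊗ₜ (1 - D.grp D.z)) := by
    simp only [TensorProduct.add_tmul, map_add, TensorProduct.assoc_tmul, LinearMap.lTensor_tmul,
      TensorProduct.sub_tmul, TensorProduct.tmul_sub, map_sub, braid_x_grp, ← D.grp_one,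
      braid_grp_grp, braid_x_x, braid_grp_x, TensorProduct.tmul_smul, ← TensorProduct.smul_tmul', map_smul]
    abel
  rw [h2, ← map_smul, smul_add, TensorProduct.smul_tmul', TensorProduct.smul_tmul', smul_add,
    smul_add] at h1
  replace h1 := (TensorProduct.assoc k B D.H D.H).injective h1
  have h3 := left_eq_of_tmul_eq h1
  have h4 := right_eq_of_tmul_eq hz h1
  simp only [TensorProduct.smul_tmul'] at h3 h4
  have e1 : (D.q : k) • β = a' := right_eq_of_tmul_eq hz h3
  have e2 : (D.q : k) • a' = β := left_eq_of_tmul_eq h4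
  have e3 : (D.q : k) • β' = β' := right_eq_of_tmul_eq hz h4
  -- With p = 1 the scalar q is itself a root of unity of order n > 1.
  have hq1 : (D.q : k) ≠ 1 := by
    intro hq
    have h5 := D.isPrimitiveRoot_qp
    rw [qp_eq, hq, hp, one_mul] at h5
    have h6 := h5.unique IsPrimitiveRoot.one
    have := D.one_lt_n
    omega
  have hβ'0 : β' = 0 := by
    have h2 : ((D.q : k) - 1) • β' = 0 := by rw [sub_smul, one_smul, e3, sub_self]
    exact (smul_eq_zero.1 h2).resolve_left fun h => hq1 (sub_eq_zero.1 h)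
  have ha'0 : a' = 0 := by
    have h2 : (((D.q : k) - 1) * (D.q + 1)) • a' = 0 := by
      rw [show ((D.q : k) - 1) * (D.q + 1) = D.q * D.q - 1 by ring, sub_smul, one_smul, mul_smul,
        e2, e1, sub_self]
    refine (smul_eq_zero.1 h2).resolve_left (mul_ne_zero (sub_ne_zero.2 hq1) fun h => hpq ⟨?_, ?_⟩)
    · exact Units.ext hp
    · exact Units.ext (by rw [Units.val_neg, Units.val_one]; exact eq_neg_of_add_eq_zero_left h)
  rw [hβ'0, ha'0, TensorProduct.zero_tmul, TensorProduct.zero_tmul, add_zero] at hβ'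
  have h7 := hs.bijective.1 (hβ'.trans (map_zero s).symm)
  have h8 := congrArg (fun t => TensorProduct.lid k B ((D.cf 1 1).rTensor B t)) h7
  simp only [LinearMap.rTensor_tmul, cf_one_one_x, TensorProduct.lid_tmul, one_smul,
    map_zero] at h8
  exact hv0 h8

lemma apply_x (hs : IsLeftSpace D.braid s) (hpq : ¬ (D.χ D.z = 1 ∧ D.q = -1))
    {ζ : G ≃* G} (hζ : ζ D.z = D.z) {b : B} (hb : D.IsHomogeneous s ζ b) :
    s (D.x ⊗ₜ b) = D.α s b ⊗ₜ D.x ∧ D.IsHomogeneous s ζ (D.α s b) := by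
  obtain ⟨v, hv⟩ := exists_apply_x hs (b := b) (by rw [hb, hζ])
  refine ⟨?_, (isHomogeneous_of_apply_x hs hb hv).1⟩
  by_cases hz : D.z = 1
  · rw [hv, hz, grp_one, sub_self, TensorProduct.tmul_zero, add_zero]
  · rw [hv, eq_zero_of_apply_x hs hpq hz hζ hb hv, TensorProduct.zero_tmul, add_zero]

lemma apply_mon (hs : IsLeftSpace D.braid s) (hpq : ¬ (D.χ D.z = 1 ∧ D.q = -1))
    {ζ : G ≃* G} (hζ : ζ D.z = D.z) {b : B} (hb : D.IsHomogeneous s ζ b) (g : G) (i : ℕ) :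
    s (D.mon g i ⊗ₜ b) = ((D.α s) ^ i) b ⊗ₜ D.mon (ζ g) i := by
  have h1 : ∀ i b, D.IsHomogeneous s ζ b → s ((D.x ^ i) ⊗ₜ b) = ((D.α s) ^ i) b ⊗ₜ (D.x ^ i) ∧
      D.IsHomogeneous s ζ (((D.α s) ^ i) b) := by
    intro i
    induction i with
    | zero => exact fun b hb => ⟨by simp [hs.unit], by simpa using hb⟩
    | succ i ih =>
      intro b hb
      obtain ⟨h1, h2⟩ := apply_x hs hpq hζ hb
      obtain ⟨h3, h4⟩ := ih _ h2
      refine ⟨?_, by rwa [pow_succ, Module.End.mul_apply]⟩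
      rw [pow_succ, hs.apply_mul, h1, twMul_tmul, h3, ← Algebra.TensorProduct.one_def, one_mul,
        Algebra.TensorProduct.tmul_mul_tmul, mul_one, pow_succ, Module.End.mul_apply]
  obtain ⟨h2, h3⟩ := h1 i b hb
  rw [← D.grp_mul_x_pow, hs.apply_mul, h2, twMul_tmul, h3, ← Algebra.TensorProduct.one_def,
    one_mul, Algebra.TensorProduct.tmul_mul_tmul, mul_one, D.grp_mul_x_pow]

end Transposition

/-! ### Determination of the coaction from degree and U -/

section Coaction

variable {D} {s : D.H ⊗[k] B →ₗ[k] B ⊗[k] D.H} {ν : B →ₗ[k] B ⊗[k] D.H}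

/-- The coefficient of `g x ^ i` in the coaction, for an arbitrary exponent `i`. -/
noncomputable def coactCoeff (D : HopfDatum k G) (ν : B →ₗ[k] B ⊗[k] D.H) (g : G) (i : ℕ) :
    B →ₗ[k] B :=
  (TensorProduct.rid k B).toLinearMap ∘ₗ (D.cf g i).lTensor B ∘ₗ ν

lemma coactCoeff_fin (g : G) (i : Fin D.n) : D.coactCoeff ν g i = D.coactComp ν g i := by
  rw [coactCoeff, cf_fin, coactComp]

open scoped Classical in
-- Coassociativity in coordinates, via `cf_comul`.
lemma coactCoeff_comp (hν : IsComodule D.braid s ν) (g h : G) (i j : ℕ) (b : B) :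
    D.coactCoeff ν g i (D.coactCoeff ν h j b) = if h = g * D.z ^ i then
      gaussBinom D.qp (i + j) i • D.coactCoeff ν g (i + j) b else 0 := by
  have h1 := LinearMap.congr_fun hν.coassoc b
  simp only [LinearMap.comp_apply, LinearEquiv.coe_coe] at h1
  set φ : D.H ⊗[k] D.H →ₗ[k] k := LinearMap.mul' k k ∘ₗ TensorProduct.map (D.cf g i) (D.cf h j)
  have h2 : ∀ t : B ⊗[k] D.H, TensorProduct.rid k B (φ.lTensor B
      (TensorProduct.assoc k B D.H D.H (ν.rTensor D.H t)))
      = D.coactCoeff ν g i (TensorProduct.rid k B ((D.cf h j).lTensor B t)) := by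
    intro t
    induction t using TensorProduct.induction_on with
    | zero => simp only [LinearMap.map_zero, LinearEquiv.map_zero]
    | add x y hx hy => simp only [map_add, hx, hy]
    | tmul v l =>
      simp only [LinearMap.rTensor_tmul, LinearMap.lTensor_tmul, TensorProduct.rid_tmul,
        map_smul, coactCoeff, LinearMap.comp_apply, LinearEquiv.coe_coe]
      induction ν v using TensorProduct.induction_on with
      | zero => simp only [TensorProduct.zero_tmul, LinearMap.map_zero, LinearEquiv.map_zero, smul_zero]
      | add x y hx hy => simp only [TensorProduct.add_tmul, map_add, smul_add, hx, hy]
      | tmul w m => simp [φ, smul_smul, mul_comm]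
  have h3 : ∀ t : B ⊗[k] D.H, TensorProduct.rid k B (φ.lTensor B
      ((Coalgebra.comul (R := k) (A := D.H)).lTensor B t)) = if h = g * D.z ^ i then
      gaussBinom D.qp (i + j) i • TensorProduct.rid k B ((D.cf g (i + j)).lTensor B t) else 0 := by
    intro t
    induction t using TensorProduct.induction_on with
    | zero => simp only [LinearMap.map_zero, LinearEquiv.map_zero, smul_zero, ite_self]
    | add x y hx hy =>
      simp only [map_add, hx, hy]
      split_ifs <;> simp
    | tmul v l =>
      simp only [LinearMap.lTensor_tmul, TensorProduct.rid_tmul, φ, LinearMap.comp_apply,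
        D.cf_comul]
      split_ifs <;> simp [smul_smul]
  have h4 := h2 (ν b)
  rw [h1, h3] at h4
  exact h4.symm

/-- The composition rules determine all coefficients: b = U^g_0(b) leaves one term of x-degree 0 and
at most one of x-degree 1, at gz⁻¹. Higher ones are obtained from U_1, whose value is coinvariant.
It is applied with u = 0 to b_g and with u = 1, g = z to b_x. -/
lemma coact_eq [Fintype G] (hν : IsComodule D.braid s ν) {g : G} {b u : B}
    (hb : D.coactComp ν g ⟨0, D.n_pos⟩ b = b) (hu : D.U ν b = u) (hu' : ν u = u ⊗ₜ 1) :
    ν b = b ⊗ₜ D.grp g + u ⊗ₜ D.mon (g * D.z⁻¹) 1 := by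
  classical
  rw [← coactCoeff_fin] at hb
  have h0 : ∀ h, D.coactCoeff ν h 0 b = if g = h then b else 0 := by
    intro h
    have := coactCoeff_comp hν h g 0 0 b
    simp only [pow_zero, mul_one, add_zero, GaussAux.self, one_smul] at this
    rw [hb] at this
    by_cases hgh : g = h
    · subst hgh
      simpa using hb
    · simpa [hgh] using this
  have h1 : ∀ h, D.coactCoeff ν h 1 b = if h = g * D.z⁻¹ then u else 0 := by
    have h2 : ∀ h, h ≠ g * D.z⁻¹ → D.coactCoeff ν h 1 b = 0 := by
      intro h hh
      have := coactCoeff_comp hν h g 1 0 b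
      rw [hb, if_neg] at this
      · exact this
      · rintro rfl
        simp at hh
    intro h
    split_ifs with hh
    · subst hh
      rw [← hu, U, LinearMap.sum_apply, Finset.sum_eq_single (g * D.z⁻¹)]
      · rw [← coactCoeff_fin]
      · intro h _ hh
        rw [← coactCoeff_fin]
        exact h2 h hh
      · simp
    · exact h2 h hh
  -- U_{i+1} applied to U_1(b) is a nonzero multiple of U_{i+2}(b), and it vanishes because a
  -- coinvariant has no coefficient at a positive power of x.
  have h2 : ∀ h i, i + 2 < D.n → D.coactCoeff ν h (i + 2) b = 0 := by
    intro h i hi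
    have := coactCoeff_comp hν h (h * D.z ^ (i + 1)) (i + 1) 1 b
    rw [if_pos rfl, h1] at this
    have hu0 : D.coactCoeff ν h (i + 1) u = 0 := by
      simp only [coactCoeff, LinearMap.comp_apply, hu', LinearMap.lTensor_tmul, one_def,
        D.cf_mon _ _ _ D.n_pos]
      simp
    have hne := GaussAux.ne_zero_of_isPrimitiveRoot D.isPrimitiveRoot_qp hi
      (show i + 1 ≤ i + 2 by omega)
    have h3 : gaussBinom D.qp (i + 2) (i + 1) • D.coactCoeff ν h (i + 2) b = 0 := by
      rw [← this]
      split_ifs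
      · exact hu0
      · simp
    exact (smul_eq_zero.1 h3).resolve_left hne
  refine D.lTensor_cf_ext fun h i hi => (TensorProduct.rid k B).injective ?_
  change D.coactCoeff ν h i b = _
  rw [map_add, LinearMap.lTensor_tmul, LinearMap.lTensor_tmul, map_add, TensorProduct.rid_tmul,
    TensorProduct.rid_tmul, grp, D.cf_mon _ _ _ D.n_pos, D.cf_mon _ _ _ D.one_lt_n]
  rcases i with _ | _ | i
  · rw [h0]; simp [eq_comm]
  · rw [h1]; simp
  · rw [h2 _ _ hi]; simp

end Coaction

end HopfDatum

/-! ### Cleft systems: the coaction on monomials and the convolution inverse of γ -/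

namespace HopfDatum

open Braided

variable {k G B : Type*} [Field k] [Group G] [Ring B] [Algebra k B] {D : HopfDatum k G}
variable {s : D.H ⊗[k] B →ₗ[k] B ⊗[k] D.H} {ν : B →ₗ[k] B ⊗[k] D.H}

/-- The families `b_g`, `b_x` of elements of a comodule algebra, described by the values of the
transposition and of the coaction. -/
structure IsCleftSystem (s : D.H ⊗[k] B →ₗ[k] B ⊗[k] D.H) (ν : B →ₗ[k] B ⊗[k] D.H)
    (bg : G → Bˣ) (bx : B) : Prop where
  one : bg 1 = 1
  apply_bg : ∀ (g h : G) (i : ℕ), s (D.mon h i ⊗ₜ (bg g : B)) = (bg g : B) ⊗ₜ D.mon h i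
  apply_bx : ∀ (h : G) (i : ℕ), s (D.mon h i ⊗ₜ bx) = ((D.q : k) ^ i • bx) ⊗ₜ D.mon h i
  coact_bg : ∀ g : G, ν (bg g : B) = (bg g : B) ⊗ₜ D.grp g
  coact_bx : ν bx = bx ⊗ₜ D.grp D.z + 1 ⊗ₜ D.x

lemma isCleftSystem [Fintype G] (hpq : ¬ (D.χ D.z = 1 ∧ D.q = -1))
    (hB : IsComoduleAlgebra D.braid s ν) {bg : G → Bˣ} {bx : B} (h_one : bg 1 = 1)
    (ha : ∀ g : G, (bg g : B) ∈ D.component s ν g (MulEquiv.refl G) ⊓ LinearMap.ker (D.U ν))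
    (hb : bx ∈ D.component s ν D.z (MulEquiv.refl G) ∧ D.U ν bx = 1)
    (hc : D.α s bx = (D.q : k) • bx) (hd : ∀ g : G, D.α s (bg g : B) = bg g) :
    D.IsCleftSystem s ν bg bx where
  one := h_one
  apply_bg g h i := by
    have h1 : ∀ i : ℕ, ((D.α s) ^ i) (bg g : B) = bg g := by
      intro i
      induction i with
      | zero => rfl
      | succ i ih => rw [pow_succ, Module.End.mul_apply, hd, ih]
    rw [apply_mon hB.transposition.toIsLeftSpace hpq (ζ := MulEquiv.refl G) rfl (ha g).1.1, h1]
    rfl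
  apply_bx h i := by
    have h1 : ∀ i : ℕ, ((D.α s) ^ i) bx = (D.q : k) ^ i • bx := by
      intro i
      induction i with
      | zero => simp
      | succ i ih => rw [pow_succ, Module.End.mul_apply, hc, map_smul, ih, smul_smul, pow_succ']
    rw [apply_mon hB.transposition.toIsLeftSpace hpq (ζ := MulEquiv.refl G) rfl hb.1.1, h1]
    rfl
  coact_bg g := by
    have h1 := coact_eq hB.comodule (ha g).1.2 (LinearMap.mem_ker.1 (ha g).2) (by simp)
    simpa using h1
  coact_bx := by
    have h1 := coact_eq hB.comodule hb.1.2 hb.2 hB.one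
    simpa [x] using h1

lemma inr_one (hs : IsLeftTransposition D.braid s) : Smash.inr hs (1 : D.H) = 1 := rfl

lemma inr_grp_mul_inr_mon (hs : IsLeftTransposition D.braid s) (g h : G) (i : ℕ) :
    Smash.inr hs (D.grp g) * Smash.inr hs (D.mon h i) = Smash.inr hs (D.mon (g * h) i) := by
  rw [Smash.inr_mul_inr, grp, mon_mul]; simp

lemma inr_grp_mul_inr_grp (hs : IsLeftTransposition D.braid s) (g h : G) :
    Smash.inr hs (D.grp g) * Smash.inr hs (D.grp h) = Smash.inr hs (D.grp (g * h)) := by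
  rw [Smash.inr_mul_inr, grp_mul]

section Smash

variable (hB : IsComoduleAlgebra D.braid s ν)

local notation "ιB" => Smash.inl (IsComoduleAlgebra.transposition hB)
local notation "ιH" => Smash.inr (IsComoduleAlgebra.transposition hB)

lemma mem_coinvariants_of_coact {b : B} (h : hB.coact b = ιB b) : b ∈ coinvariants hB :=
  (Smash.of hB.transposition).injective h

lemma coact_eq_iff {b : B} {t : B ⊗[k] D.H} :
    hB.coact b = Smash.of hB.transposition t ↔ ν b = t :=
  (Smash.of hB.transposition).injective.eq_iff (a := ν b) (b := t)

/-- The pairs `(u, g)` such that the unit `u` commutes with `H` in `B ⊗_s H` and its coaction is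
`u ⊗ g`. -/
def grouplikes : Subgroup (Bˣ × G) where
  carrier := {p | (∀ v : D.H, Commute (ιH v) (ιB (p.1 : B))) ∧
    hB.coact (p.1 : B) = ιB (p.1 : B) * ιH (D.grp p.2)}
  mul_mem' := by
    rintro ⟨u, g⟩ ⟨v, h⟩ ⟨h1, h2⟩ ⟨h3, h4⟩
    refine ⟨fun w => ?_, ?_⟩
    · simp only [Prod.mk_mul_mk, Units.val_mul, map_mul]
      exact (h1 w).mul_right (h3 w)
    · simp only [Prod.mk_mul_mk, Units.val_mul, map_mul] at h2 h4 ⊢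
      rw [h2, h4, mul_assoc, ← mul_assoc (ιH _), (h3 _).eq, mul_assoc, inr_grp_mul_inr_grp,
        mul_assoc]
  one_mem' := ⟨fun v => by simp, by simp [grp_one, inr_one]⟩
  inv_mem' := by
    rintro ⟨u, g⟩ ⟨h1, h2⟩
    have h3 : ∀ w, Commute (ιH w) (ιB ((u⁻¹ : Bˣ) : B)) := fun w =>
      Commute.units_inv_right (u := Units.map (ιB : B →* Smash hB.transposition) u) (h1 w)
    refine ⟨h3, ?_⟩
    -- The coaction of u⁻¹ and the expected element are inverses of ν(u) on opposite sides, hence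
    -- equal.
    refine left_inv_eq_right_inv (a := hB.coact (u : B)) ?_ ?_
    · simp only [Prod.inv_mk, ← map_mul, Units.inv_mul, map_one]
    · simp only [Prod.inv_mk] at h2 ⊢
      rw [h2, mul_assoc, ← mul_assoc (ιH _), (h3 _).eq, mul_assoc, inr_grp_mul_inr_grp,
        ← mul_assoc, ← map_mul]
      simp [grp_one, inr_one]

variable {hB} in
lemma coact_of_mem {u : Bˣ} {g : G} (h : (u, g) ∈ grouplikes hB) :
    hB.coact (u : B) = ιB (u : B) * ιH (D.grp g) := h.2

variable {hB} in
lemma commute_of_mem {u : Bˣ} {g : G} (h : (u, g) ∈ grouplikes hB) (v : D.H) :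
    ιH v * ιB (u : B) = ιB (u : B) * ιH v := (h.1 v).eq

variable {hB} in
lemma coe_mem_coinvariants {u : Bˣ} (h : (u, 1) ∈ grouplikes hB) : (u : B) ∈ coinvariants hB := by
  refine mem_coinvariants_of_coact hB ?_
  rw [coact_of_mem h, grp_one, inr_one, mul_one]

variable {hB} in
-- Coinvariance becomes a computation in G: if ν(b) = b ⊗ g, a unit from `grouplikes` of degree g⁻¹
-- brings b into the coinvariants.
lemma mul_mem_coinvariants {b : B} {u : Bˣ} {g h : G} (hb : hB.coact b = ιB b * ιH (D.grp g))
    (hu : (u, h) ∈ grouplikes hB) (hgh : g * h = 1) : b * u ∈ coinvariants hB := by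
  refine mem_coinvariants_of_coact hB ?_
  rw [map_mul, hb, coact_of_mem hu, mul_assoc, ← mul_assoc (ιH _), commute_of_mem hu, mul_assoc,
    inr_grp_mul_inr_grp, hgh, grp_one, inr_one, mul_one, map_mul]

end Smash

namespace IsCleftSystem

variable {bg : G → Bˣ} {bx : B} (hB : IsComoduleAlgebra D.braid s ν)

local notation "ιB" => Smash.inl (IsComoduleAlgebra.transposition hB)
local notation "ιH" => Smash.inr (IsComoduleAlgebra.transposition hB)

lemma mem_grouplikes (hb : D.IsCleftSystem s ν bg bx) (g : G) : (bg g, g) ∈ grouplikes hB := by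
  refine ⟨fun v => ?_, ?_⟩
  · have : s ∘ₗ (TensorProduct.mk k D.H B).flip (bg g : B) = TensorProduct.mk k B D.H (bg g : B) :=
      D.mon_ext fun h i _ => hb.apply_bg g h i
    rw [Commute, SemiconjBy, Smash.inl_mul_inr, Smash.inr_mul_inl]
    exact congrArg _ (LinearMap.congr_fun this v)
  · rw [Smash.inl_mul_inr, coact_eq_iff]
    exact hb.coact_bg g

lemma mem_grouplikes_inv (hb : D.IsCleftSystem s ν bg bx) (g : G) :
    ((bg g)⁻¹, g⁻¹) ∈ grouplikes hB :=
  inv_mem (hb.mem_grouplikes hB g)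

lemma coact_apply_bx (hb : D.IsCleftSystem s ν bg bx) :
    hB.coact bx = ιB bx * ιH (D.grp D.z) + ιH D.x := by
  rw [Smash.inl_mul_inr, Smash.inr_apply, ← map_add, coact_eq_iff]
  exact hb.coact_bx

lemma inr_mon_mul (hb : D.IsCleftSystem s ν bg bx) (g : G) (i l : ℕ) :
    ιH (D.mon g i) * ιB (bx ^ l) = (D.q : k) ^ (i * l) • (ιB (bx ^ l) * ιH (D.mon g i)) := by
  induction l with
  | zero => simp
  | succ l ih =>
    have h1 : ιH (D.mon g i) * ιB bx = (D.q : k) ^ i • (ιB bx * ιH (D.mon g i)) := by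
      rw [Smash.inr_mul_inl, hb.apply_bx, Smash.inl_mul_inr, ← TensorProduct.smul_tmul', map_smul]
    rw [pow_succ, map_mul, ← mul_assoc, ih, smul_mul_assoc, mul_assoc, h1, mul_smul_comm,
      smul_smul, mul_assoc, mul_add, mul_one, pow_add]

/-- The q-binomial theorem for Y + X with XY = qp YX: q arises when x passes b_x, and p when x
passes z. All exponents are allowed, since `mon` reduces powers of x; the case i = n serves for
b_x^n. -/
lemma coact_bx_pow (hb : D.IsCleftSystem s ν bg bx) (i : ℕ) :
    hB.coact (bx ^ i) = ∑ j ∈ Finset.range (i + 1), gaussBinom D.qp i j •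
      (ιB (bx ^ j) * ιH (D.mon (D.z ^ j) (i - j))) := by
  induction i with
  | zero =>
    simp only [zero_add, Finset.sum_range_one, pow_zero, GaussAux.zero_right, map_one, one_smul,
      one_mul]
    rfl
  | succ i ih =>
    have h1 : ∀ j ∈ Finset.range (i + 1), gaussBinom D.qp i j •
        (ιB (bx ^ j) * ιH (D.mon (D.z ^ j) (i - j))) * hB.coact bx
        = (D.qp ^ (i - j) * gaussBinom D.qp i j) •
            (ιB (bx ^ (j + 1)) * ιH (D.mon (D.z ^ (j + 1)) (i - j)))
          + gaussBinom D.qp i j • (ιB (bx ^ j) * ιH (D.mon (D.z ^ j) (i + 1 - j))) := by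
      intro j hj
      rw [Finset.mem_range] at hj
      have h2 := hb.inr_mon_mul hB (D.z ^ j) (i - j) 1
      rw [pow_one, mul_one] at h2
      rw [hb.coact_apply_bx, mul_add, smul_mul_assoc, smul_mul_assoc, mul_assoc, mul_assoc,
        ← mul_assoc (ιH _) (ιB _), h2, smul_mul_assoc, mul_assoc, Smash.inr_mul_inr,
        Smash.inr_mul_inr, grp, x, mon_mul, mon_mul, map_one, Units.val_one, one_pow, one_smul,
        mul_one, add_zero, ← pow_succ, show i - j + 1 = i + 1 - j by omega, map_smul,
        mul_smul_comm, mul_smul_comm, mul_smul_comm, smul_smul, smul_smul, ← mul_assoc (ιB _),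
        ← map_mul, ← pow_succ, qp_eq, mul_pow]
      congr 2
      ring
    rw [pow_succ, map_mul, ih, Finset.sum_mul, Finset.sum_congr rfl h1, Finset.sum_add_distrib,
      Finset.sum_range_succ' _ (i + 1)]
    -- Shifts the index by one, adding the zero term j = i + 1, so that the two sums combine by the
    -- Pascal rule.
    have h3 : ∑ j ∈ Finset.range (i + 1), gaussBinom D.qp i j •
        (ιB (bx ^ j) * ιH (D.mon (D.z ^ j) (i + 1 - j)))
        = ∑ j ∈ Finset.range (i + 1), gaussBinom D.qp i (j + 1) •
          (ιB (bx ^ (j + 1)) * ιH (D.mon (D.z ^ (j + 1)) (i + 1 - (j + 1))))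
          + gaussBinom D.qp i 0 • (ιB (bx ^ 0) * ιH (D.mon (D.z ^ 0) (i + 1 - 0))) := by
      rw [← Finset.sum_range_succ' (fun j => gaussBinom D.qp i j •
        (ιB (bx ^ j) * ιH (D.mon (D.z ^ j) (i + 1 - j)))), Finset.sum_range_succ _ (i + 1),
        GaussAux.eq_zero D.qp i (i + 1) (by omega), zero_smul, add_zero]
    rw [h3, ← add_assoc, ← Finset.sum_add_distrib, GaussAux.zero_right, GaussAux.zero_right]
    congr 1
    refine Finset.sum_congr rfl fun j _ => ?_
    rw [Nat.add_sub_add_right, ← add_smul, gaussBinom]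

lemma coact_mul (hb : D.IsCleftSystem s ν bg bx) (g : G) (i : ℕ) :
    hB.coact (bg g * bx ^ i) = ∑ j ∈ Finset.range (i + 1), gaussBinom D.qp i j •
      (ιB (bg g * bx ^ j) * ιH (D.mon (g * D.z ^ j) (i - j))) := by
  rw [map_mul, hb.coact_bx_pow, coact_of_mem (hb.mem_grouplikes hB g), Finset.mul_sum]
  refine Finset.sum_congr rfl fun j _ => ?_
  have h2 := hb.inr_mon_mul hB g 0 j
  rw [zero_mul, pow_zero, one_smul, mon_zero] at h2
  rw [mul_smul_comm, mul_assoc, ← mul_assoc (ιH _), h2, mul_assoc, inr_grp_mul_inr_mon,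
    ← mul_assoc, ← map_mul]

end IsCleftSystem

/-- The scalar `(-1) ^ i (qp) ^ (i (i - 1) / 2)`. -/
def invCoeff (D : HopfDatum k G) (i : ℕ) : k := (-1) ^ i * D.qp ^ (i * (i - 1) / 2)

/-- The convolution inverse of `gamma bg bx`. -/
noncomputable def gammaInv (D : HopfDatum k G) (bg : G → Bˣ) (bx : B) : D.H →ₗ[k] B :=
  D.basis.constr k fun a => D.invCoeff a.2 •
    (bx ^ (a.2 : ℕ) * (((bg (a.1 * D.z ^ (a.2 : ℕ)))⁻¹ : Bˣ) : B))

lemma gamma_mon (bg : G → Bˣ) (bx : B) (g : G) {i : ℕ} (hi : i < D.n) :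
    D.gamma bg bx (D.mon g i) = bg g * bx ^ i := by
  have := D.mon_lt g ⟨i, hi⟩
  simp only at this
  rw [this, gamma, Module.Basis.constr_basis]

lemma gammaInv_mon (bg : G → Bˣ) (bx : B) (g : G) {i : ℕ} (hi : i < D.n) :
    D.gammaInv bg bx (D.mon g i) = D.invCoeff i • (bx ^ i * (((bg (g * D.z ^ i))⁻¹ : Bˣ) : B)) := by
  have := D.mon_lt g ⟨i, hi⟩
  simp only at this
  rw [this, gammaInv, Module.Basis.constr_basis]

/-- Source of the λ-terms of σ: x^n = λ(z^n - 1) is applied once, and the two resulting group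
elements give the two inverses. -/
lemma gammaInv_mon_add (bg : G → Bˣ) (bx : B) (g : G) {i : ℕ} (hi : i < D.n) :
    D.gammaInv bg bx (D.mon g (i + D.n)) = (D.lam * D.invCoeff i) •
      (bx ^ i * (((bg (g * D.z ^ (i + D.n)))⁻¹ : Bˣ) : B)
        - bx ^ i * (((bg (g * D.z ^ i))⁻¹ : Bˣ) : B)) := by
  rw [mon_add, map_smul, map_sub, gammaInv_mon _ _ _ hi, gammaInv_mon _ _ _ hi, mul_assoc g,
    ← pow_add, add_comm D.n, ← smul_sub, smul_smul]

lemma sum_invCoeff (i : ℕ) :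
    ∑ j ∈ Finset.range (i + 1), gaussBinom D.qp i j * D.invCoeff j = if i = 0 then 1 else 0 := by
  rw [← GaussAux.sum_alternating D.qp i]
  exact Finset.sum_congr rfl fun j _ => mul_comm _ _

lemma sum_invCoeff_reflect {i : ℕ} (hi : i < D.n) :
    ∑ j ∈ Finset.range (i + 1), gaussBinom D.qp i j * D.invCoeff (i - j)
      = if i = 0 then 1 else 0 := by
  rw [← sum_invCoeff (D := D), ← Finset.sum_range_reflect]
  refine Finset.sum_congr rfl fun j hj => ?_
  rw [Finset.mem_range] at hj
  rw [show i + 1 - 1 - j = i - j by omega,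
    GaussAux.symm_of_isPrimitiveRoot D.isPrimitiveRoot_qp hi (by omega),
    show i - (i - j) = j by omega]

lemma mon_ext₂ {M : Type*} [AddCommGroup M] [Module k M] {f f' : D.H ⊗[k] D.H →ₗ[k] M}
    (h : ∀ g i g' j, i < D.n → j < D.n →
      f (D.mon g i ⊗ₜ D.mon g' j) = f' (D.mon g i ⊗ₜ D.mon g' j)) : f = f' :=
  (D.basis.tensorProduct D.basis).ext fun ⟨a, b⟩ => by
    rw [Module.Basis.tensorProduct_apply, ← D.mon_lt a.1 a.2, ← D.mon_lt b.1 b.2]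
    exact h _ _ _ _ a.2.2 b.2.2

namespace IsCleftSystem

variable {bg : G → Bˣ} {bx : B}

/-- In γ' * γ the units b_{gz^j} cancel in the middle; in γ * γ' the outer factor b_{gz^i}⁻¹ is
common to all terms. Either way the alternating Gaussian sum remains, reflected in the second case.
-/
lemma isCleftPair (hB : IsComoduleAlgebra D.braid s ν) (hb : D.IsCleftSystem s ν bg bx) :
    IsCleftPair D.braid s ν (D.gamma bg bx) (D.gammaInv bg bx) where
  conv_left := congrArg WithConv.toConv <| D.mon_ext fun g i hi => by
    simp only [LinearMap.comp_apply, D.comul_mon g i hi, D.counit_mon g i hi, map_sum, map_smul,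
      TensorProduct.map_tmul, LinearMap.mul'_apply, Algebra.linearMap_apply]
    have h1 : ∀ j ∈ Finset.range (i + 1), gaussBinom D.qp i j • (D.gammaInv bg bx (D.mon g j) *
        D.gamma bg bx (D.mon (g * D.z ^ j) (i - j)))
        = (gaussBinom D.qp i j * D.invCoeff j) • bx ^ i := by
      intro j hj
      rw [Finset.mem_range] at hj
      rw [gammaInv_mon _ _ _ (by omega), gamma_mon _ _ _ (by omega), smul_mul_assoc, mul_assoc,
        Units.inv_mul_cancel_left, ← pow_add, show j + (i - j) = i by omega, smul_smul]
    rw [Finset.sum_congr rfl h1, ← Finset.sum_smul, sum_invCoeff]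
    split_ifs with h0 <;> simp [h0]
  conv_right := congrArg WithConv.toConv <| D.mon_ext fun g i hi => by
    simp only [LinearMap.comp_apply, D.comul_mon g i hi, D.counit_mon g i hi, map_sum, map_smul,
      TensorProduct.map_tmul, LinearMap.mul'_apply, Algebra.linearMap_apply]
    have h1 : ∀ j ∈ Finset.range (i + 1), gaussBinom D.qp i j • (D.gamma bg bx (D.mon g j) *
        D.gammaInv bg bx (D.mon (g * D.z ^ j) (i - j)))
        = (gaussBinom D.qp i j * D.invCoeff (i - j)) •
          (bg g * bx ^ i * (((bg (g * D.z ^ i))⁻¹ : Bˣ) : B)) := by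
      intro j hj
      rw [Finset.mem_range] at hj
      rw [gammaInv_mon _ _ _ (by omega), gamma_mon _ _ _ (by omega), mul_smul_comm, smul_smul,
        ← mul_assoc, mul_assoc (bg g : B), ← pow_add, show j + (i - j) = i by omega,
        mul_assoc g, ← pow_add, show j + (i - j) = i by omega]
    rw [Finset.sum_congr rfl h1, ← Finset.sum_smul, sum_invCoeff_reflect hi]
    split_ifs with h0 <;> simp [h0]
  colinear := D.mon_ext fun g i hi => by
    refine (Smash.of hB.transposition).injective ?_
    rw [LinearMap.comp_apply, gamma_mon _ _ _ hi, LinearMap.comp_apply, D.comul_mon g i hi]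
    refine (hb.coact_mul hB g i).trans ?_
    rw [map_sum, map_sum]
    refine Finset.sum_congr rfl fun j hj => ?_
    rw [Finset.mem_range] at hj
    rw [map_smul, map_smul, LinearMap.rTensor_tmul, gamma_mon _ _ _ (by omega), Smash.inl_mul_inr]
  compat := mon_ext₂ fun g i h j hi hj => by
    refine (Smash.of hB.transposition).injective ?_
    rw [LinearMap.comp_apply, LinearMap.comp_apply, D.braid_mon _ _ hi hj, map_smul,
      LinearMap.rTensor_tmul, LinearMap.lTensor_tmul, gamma_mon _ _ _ hj, ← Smash.inr_mul_inl,
      map_mul, ← mul_assoc, commute_of_mem (hb.mem_grouplikes hB h), mul_assoc,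
      hb.inr_mon_mul hB, mul_smul_comm, ← mul_assoc, ← map_mul, Smash.inl_mul_inr, map_smul]
  compat_inv := mon_ext₂ fun g i h j hi hj => by
    refine (Smash.of hB.transposition).injective ?_
    rw [LinearMap.comp_apply, LinearMap.comp_apply, D.braid_mon _ _ hi hj, map_smul,
      LinearMap.rTensor_tmul, LinearMap.lTensor_tmul, gammaInv_mon _ _ _ hj,
      TensorProduct.tmul_smul, map_smul s, ← TensorProduct.smul_tmul', map_smul, map_smul,
      map_smul, ← Smash.inr_mul_inl, map_mul, ← mul_assoc,
      hb.inr_mon_mul hB, smul_mul_assoc, mul_assoc,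
      commute_of_mem (hb.mem_grouplikes_inv hB _), ← mul_assoc, ← map_mul, Smash.inl_mul_inr,
      smul_comm]
  map_one := by rw [one_def, gamma_mon _ _ _ D.n_pos, hb.one]; simp
  map_one_inv := by
    rw [one_def, gammaInv_mon _ _ _ D.n_pos]
    simp [hb.one, invCoeff]

end IsCleftSystem

end HopfDatum

/-! ### The basis, the coinvariant elements and the explicit formulas -/

namespace HopfDatum

open Braided

variable {k G B : Type*} [Field k] [Group G] [Ring B] [Algebra k B] {D : HopfDatum k G}
variable {s : D.H ⊗[k] B →ₗ[k] B ⊗[k] D.H} {ν : B →ₗ[k] B ⊗[k] D.H}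

namespace IsCleftSystem

variable {bg : G → Bˣ} {bx : B} {hB : IsComoduleAlgebra D.braid s ν}

lemma gamma_basis (g : G) (i : Fin D.n) :
    D.gamma bg bx (D.basis (g, i)) = bg g * bx ^ (i : ℕ) := by
  rw [gamma, Module.Basis.constr_basis]

/-- A relation is an element of C ⊗ H that the normal basis map kills; the map is injective, so its
coordinates vanish. -/
lemma linearIndependent [Fintype G] (hb : D.IsCleftSystem s ν bg bx) :
    LinearIndependent (coinvariants hB)
      (fun a : G × Fin D.n => (bg a.1 : B) * bx ^ (a.2 : ℕ)) := by
  rw [Fintype.linearIndependent_iff]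
  intro f hf a
  set t : coinvariants hB ⊗[k] D.H := ∑ e, f e ⊗ₜ D.basis e with ht
  have h1 : mulRight (D.gamma bg bx) ((coinvariants hB).val.toLinearMap.rTensor D.H t) = 0 := by
    rw [ht, map_sum, map_sum, ← hf]
    refine Finset.sum_congr rfl fun e _ => ?_
    rw [LinearMap.rTensor_tmul, mulRight_tmul, gamma_basis]
    rfl
  have h2 := (hb.isCleftPair hB).cleftProj_mulRight hB t
  rw [h1, map_zero, map_zero] at h2
  have h3 : t = 0 := rTensor_coinvariants_injective hB D.H (by rw [← h2, map_zero])
  have h4 : TensorProduct.rid k _ ((D.basis.coord a).lTensor _ t) = f a := by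
    rw [ht, map_sum, map_sum, Finset.sum_eq_single a]
    · simp
    · intro e _ he
      simp [Finsupp.single_eq_of_ne he.symm]
    · simp
  rw [← h4, h3, map_zero, map_zero]

lemma span_eq_top [Fintype G] (hb : D.IsCleftSystem s ν bg bx) :
    ⊤ ≤ Submodule.span (coinvariants hB)
      (Set.range fun a : G × Fin D.n => (bg a.1 : B) * bx ^ (a.2 : ℕ)) := by
  have h1 : ∀ t : B ⊗[k] D.H, mulRight (D.gamma bg bx)
      ((cleftProj ν (D.gammaInv bg bx)).rTensor D.H t) ∈ Submodule.span (coinvariants hB)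
        (Set.range fun a : G × Fin D.n => (bg a.1 : B) * bx ^ (a.2 : ℕ)) := by
    intro t
    induction t using TensorProduct.induction_on with
    | zero => simp
    | add x y hx hy => rw [map_add, map_add]; exact add_mem hx hy
    | tmul b h =>
      rw [LinearMap.rTensor_tmul, mulRight_tmul, ← D.basis.sum_repr h, map_sum, Finset.mul_sum]
      refine sum_mem fun a _ => ?_
      rw [map_smul, gamma_basis, mul_smul_comm, ← smul_mul_assoc]
      exact Submodule.smul_mem _ (D.basis.repr h a • (hb.isCleftPair hB).proj hB b)
        (Submodule.subset_span ⟨a, rfl⟩)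
  intro b _
  rw [← (hb.isCleftPair hB).mulRight_cleftProj hB b]
  exact h1 (ν b)

lemma exists_basis [Fintype G] (hb : D.IsCleftSystem s ν bg bx) :
    ∃ b : Module.Basis (G × Fin D.n) (coinvariants hB) B,
      ∀ (g : G) (i : Fin D.n), b (g, i) = (bg g : B) * bx ^ (i : ℕ) :=
  ⟨Module.Basis.mk hb.linearIndependent hb.span_eq_top, fun g i => by
    rw [Module.Basis.mk_apply]⟩

lemma exists_unit_coinvariants (hb : D.IsCleftSystem s ν bg bx) (g : G) :
    ∃ u : (coinvariants hB)ˣ, ((u : coinvariants hB) : B) = (bg g : B) ^ orderOf g := by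
  have h1 := pow_mem (hb.mem_grouplikes hB g) (orderOf g)
  rw [Prod.pow_mk, pow_orderOf_eq_one] at h1
  have h2 := inv_mem h1
  rw [Prod.inv_mk, inv_one] at h2
  refine ⟨⟨⟨_, coe_mem_coinvariants h1⟩, ⟨_, coe_mem_coinvariants h2⟩, ?_, ?_⟩, ?_⟩
  · exact Subtype.ext (show ((bg g ^ orderOf g : Bˣ) : B) * _ = 1 from Units.mul_inv _)
  · exact Subtype.ext (show _ * ((bg g ^ orderOf g : Bˣ) : B) = 1 from
      Units.inv_mul (bg g ^ orderOf g))
  · exact Units.val_pow_eq_pow_val _ _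

/-- The x-terms of the coactions of b_x b_g and χ(g) b_g b_x agree because xg = χ(g) gx. The
difference therefore has pure degree gz, which the two inverse units remove. -/
lemma commutator_mem (hb : D.IsCleftSystem s ν bg bx) (g : G) :
    (bx * (bg g : B) - (D.χ g : k) • ((bg g : B) * bx)) * ((bg g)⁻¹ : Bˣ) *
      ((bg D.z)⁻¹ : Bˣ) ∈ coinvariants hB := by
  have hz : D.z * g = g * D.z := (Subgroup.mem_center_iff.1 D.z_central g).symm
  have h0 : hB.coact (bx * (bg g : B) - (D.χ g : k) • ((bg g : B) * bx))
      = Smash.inl hB.transposition (bx * (bg g : B) - (D.χ g : k) • ((bg g : B) * bx))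
        * Smash.inr hB.transposition (D.grp (g * D.z)) := by
    have h2 := hb.inr_mon_mul hB g 0 1
    rw [zero_mul, pow_zero, one_smul, mon_zero, pow_one] at h2
    have h3 : hB.coact (bx * bg g) = Smash.inl hB.transposition (bx * bg g) *
        Smash.inr hB.transposition (D.grp (g * D.z)) + (D.χ g : k) •
        (Smash.inl hB.transposition (bg g) * Smash.inr hB.transposition (D.grp g * D.x)) := by
      rw [map_mul, hb.coact_apply_bx hB, coact_of_mem (hb.mem_grouplikes hB g), add_mul, mul_assoc,
        ← mul_assoc (Smash.inr _ _), commute_of_mem (hb.mem_grouplikes hB g), mul_assoc,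
        inr_grp_mul_inr_grp, hz, ← mul_assoc, ← map_mul (Smash.inl hB.transposition),
        ← mul_assoc (Smash.inr _ D.x), commute_of_mem (hb.mem_grouplikes hB g), mul_assoc,
        Smash.inr_mul_inr, x_mul_grp, map_smul, mul_smul_comm]
    have h4 : hB.coact (bg g * bx) = Smash.inl hB.transposition (bg g * bx) *
        Smash.inr hB.transposition (D.grp (g * D.z)) +
        Smash.inl hB.transposition (bg g) * Smash.inr hB.transposition (D.grp g * D.x) := by
      rw [map_mul, hb.coact_apply_bx hB, coact_of_mem (hb.mem_grouplikes hB g), mul_add, mul_assoc,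
        ← mul_assoc (Smash.inr _ _), h2, mul_assoc, inr_grp_mul_inr_grp, ← mul_assoc,
        ← map_mul (Smash.inl hB.transposition), mul_assoc, Smash.inr_mul_inr]
    rw [map_sub, map_smul, h3, h4, map_sub, map_smul, sub_mul, smul_mul_assoc, smul_add]
    abel
  have h1 := mul_mem (hb.mem_grouplikes_inv hB g) (hb.mem_grouplikes_inv hB D.z)
  have h2 := mul_mem_coinvariants h0 h1 (by rw [← hz]; group)
  rwa [Units.val_mul, ← mul_assoc] at h2

lemma bx_pow_mem (hb : D.IsCleftSystem s ν bg bx) (hx : D.x ^ D.n = 0) :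
    bx ^ D.n * ((bg D.z ^ ((orderOf D.z : ℤ) - (D.n : ℤ)) : Bˣ) : B) ∈ coinvariants hB := by
  have h0 : hB.coact (bx ^ D.n) = Smash.inl hB.transposition (bx ^ D.n)
      * Smash.inr hB.transposition (D.grp (D.z ^ D.n)) := by
    -- At the primitive root qp the inner binomials vanish, and the term j = 0 carries x^n = 0. Only
    -- b_x^n ⊗ z^n survives.
    rw [hb.coact_bx_pow hB, Finset.sum_eq_single D.n]
    · rw [GaussAux.self, one_smul, Nat.sub_self, mon_zero]
    · intro j hj hjn
      rw [Finset.mem_range] at hj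
      rcases Nat.eq_zero_or_pos j with rfl | hj0
      · rw [Nat.sub_zero, pow_zero, pow_zero, ← x_pow, hx, map_zero, mul_zero, smul_zero]
      · rw [GaussAux.eq_zero_of_isPrimitiveRoot D.isPrimitiveRoot_qp hj0 (by omega), zero_smul]
    · simp
  have h1 := zpow_mem (hb.mem_grouplikes hB D.z) ((orderOf D.z : ℤ) - (D.n : ℤ))
  refine mul_mem_coinvariants h0 h1 ?_
  change D.z ^ D.n * D.z ^ ((orderOf D.z : ℤ) - (D.n : ℤ)) = 1
  rw [← zpow_natCast, ← zpow_add, add_sub_cancel, zpow_natCast, pow_orderOf_eq_one]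

lemma weakAct_formula (hb : D.IsCleftSystem s ν bg bx) (hpq : ¬ (D.χ D.z = 1 ∧ D.q = -1))
    (g : G) {i : ℕ} (hi : i < D.n) {ζ : G ≃* G} (hζ : ζ D.z = D.z) (c : coinvariants hB)
    (hc : D.IsHomogeneous s ζ (c : B)) :
    ((hb.isCleftPair hB).weakAct hB (D.mon g i ⊗ₜ c) : B) =
      ∑ j ∈ Finset.range (i + 1),
        ((-1) ^ j * D.qp ^ (j * (j - 1) / 2) * gaussBinom D.qp i j : k) •
          ((bg g : B) * bx ^ (i - j) * ((D.α s) ^ j) (c : B) * bx ^ j *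
            ((bg (ζ g * D.z ^ i))⁻¹ : Bˣ)) := by
  rw [IsCleftPair.coe_weakAct, (hb.isCleftPair hB).cleftAct_apply hB _ c.2]
  simp only [cleftAct, LinearMap.comp_apply, LinearMap.rTensor_tmul, D.comul_mon g i hi,
    TensorProduct.sum_tmul, map_sum, LinearEquiv.coe_coe]
  -- In the formula j counts the powers of x that pass c, the second leg of Δ, while `comul_mon`
  -- indexes by the first leg.
  rw [← Finset.sum_range_reflect]
  refine Finset.sum_congr rfl fun j hj => ?_
  rw [Finset.mem_range] at hj
  rw [show i + 1 - 1 - j = i - j by omega, ← TensorProduct.smul_tmul', map_smul,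
    TensorProduct.assoc_tmul, map_smul, map_smul, TensorProduct.map_tmul, LinearMap.mul'_apply,
    LinearMap.comp_apply, LinearMap.comp_apply, show i - (i - j) = j by omega,
    apply_mon hB.transposition.toIsLeftSpace hpq hζ hc, LinearMap.lTensor_tmul,
    LinearMap.mul'_apply, gamma_mon _ _ _ (show i - j < D.n by omega),
    gammaInv_mon _ _ _ (show j < D.n by omega),
    GaussAux.symm_of_isPrimitiveRoot D.isPrimitiveRoot_qp hi (by omega), mul_smul_comm,
    mul_smul_comm, smul_smul, map_mul, map_pow, hζ, mul_assoc (ζ g), ← pow_add,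
    show i - j + j = i by omega, mul_comm (gaussBinom _ _ _), invCoeff]
  simp only [mul_assoc]

/-- The power (qp)^((m-i)j) combines q^((m-i)j) from braiding x^(m-i) past hx^j with p^((m-i)j) from
χ(hz^j)^(m-i) in the product of H. -/
lemma cocycleMap_formula (hb : D.IsCleftSystem s ν bg bx) (g h : G) {m r : ℕ} (hm : m < D.n)
    (hr : r < D.n) :
    ((hb.isCleftPair hB).cocycleMap hB (D.mon g m ⊗ₜ D.mon h r) : B) =
      ∑ i ∈ Finset.range (m + 1), ∑ j ∈ Finset.range (r + 1) with m + r - i - j < D.n,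
        D.cocCoeff h m r i j (m + r - i - j) •
          ((bg g : B) * bx ^ i * (bg h : B) * bx ^ (m + r - i) *
            ((bg (g * h * D.z ^ (m + r)))⁻¹ : Bˣ))
      + D.lam •
        ∑ i ∈ Finset.range (m + 1), ∑ j ∈ Finset.range (r + 1) with D.n ≤ m + r - i - j,
          D.cocCoeff h m r i j (m + r - i - j - D.n) •
            ((bg g : B) * bx ^ i * (bg h : B) * bx ^ (m + r - i - D.n) *
              ((bg (g * h * D.z ^ (m + r)))⁻¹ : Bˣ))
      - D.lam •
        ∑ i ∈ Finset.range (m + 1), ∑ j ∈ Finset.range (r + 1) with D.n ≤ m + r - i - j,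
          D.cocCoeff h m r i j (m + r - i - j - D.n) •
            ((bg g : B) * bx ^ i * (bg h : B) * bx ^ (m + r - i - D.n) *
              ((bg (g * h * D.z ^ (m + r - D.n)))⁻¹ : Bˣ)) := by
  have hz : ∀ (l : ℕ) (y : G), D.z ^ l * y = y * D.z ^ l := fun l y =>
    (Subgroup.mem_center_iff.1 (Subgroup.pow_mem _ D.z_central l) y).symm
  rw [IsCleftPair.coe_cocycleMap, (hb.isCleftPair hB).cleftCoc_apply hB]
  simp only [cleftCoc, comulTwo, LinearMap.comp_apply, D.comul_mon g m hm, D.comul_mon h r hr,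
    TensorProduct.map_tmul, TensorProduct.sum_tmul, TensorProduct.tmul_sum, map_sum,
    Finset.smul_sum, Finset.sum_filter, ← Finset.sum_add_distrib, ← Finset.sum_sub_distrib]
  rw [Finset.sum_comm]
  refine Finset.sum_congr rfl fun i hi => Finset.sum_congr rfl fun j hj => ?_
  rw [Finset.mem_range] at hi hj
  have hξ : m - i + (r - j) = m + r - i - j := by omega
  have e1 : g * D.z ^ i * (h * D.z ^ j) = g * h * D.z ^ (i + j) := by
    rw [mul_assoc g, ← mul_assoc _ h, hz, pow_add]; simp only [mul_assoc]
  simp only [← TensorProduct.smul_tmul', TensorProduct.tmul_smul, map_smul]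
  rw [midMap_tmul, D.braid_mon _ _ (show m - i < D.n by omega) (show j < D.n by omega),
    ← TensorProduct.smul_tmul', map_smul, TensorProduct.tmul_smul, map_smul,
    TensorProduct.assoc_tmul, TensorProduct.assoc_symm_tmul]
  simp only [map_smul, TensorProduct.map_tmul, LinearMap.comp_apply, LinearMap.mul'_apply,
    mon_mul, e1, hξ, gamma_mon bg bx g (show i < D.n by omega),
    gamma_mon bg bx h (show j < D.n by omega), mul_smul_comm, smul_smul]
  by_cases hlt : m + r - i - j < D.n
  · rw [if_pos hlt, if_neg (by omega), if_neg (by omega), smul_zero, add_zero, sub_zero,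
      gammaInv_mon _ _ _ hlt, mul_smul_comm, smul_smul, mul_assoc (g * h), ← pow_add,
      show i + j + (m + r - i - j) = m + r by omega,
      show m + r - i = j + (m + r - i - j) by omega, pow_add bx j]
    congr 1
    · rw [cocCoeff, invCoeff, qp_eq, map_mul, map_pow, Units.val_mul, Units.val_pow_eq_pow_val,
        show j + (m + r - i - j) - j = m + r - i - j by omega, mul_pow, pow_add]
      ring
    · simp only [Nat.add_sub_cancel_left, mul_assoc]
  -- Since m, r < n, the exponent ξ is below 2n, so a single reduction by x^n = λ(z^n - 1) leaves e
  -- = ξ - n < n.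
  · obtain ⟨e, he⟩ : ∃ e, m + r - i - j = e + D.n := ⟨m + r - i - j - D.n, by omega⟩
    rw [if_neg hlt, if_pos (by omega), if_pos (by omega), he, gammaInv_mon_add _ _ _ (by omega),
      mul_smul_comm, smul_smul, mul_assoc (g * h), mul_assoc (g * h), ← pow_add, ← pow_add,
      show i + j + (e + D.n) = m + r by omega, show i + j + e = m + r - D.n by omega,
      show m + r - i - D.n = j + e by omega, pow_add bx j, Nat.add_sub_cancel, zero_add,
      ← smul_sub, ← smul_sub, smul_smul]
    congr 1
    · rw [cocCoeff, invCoeff, qp_eq, map_mul, map_pow, Units.val_mul, Units.val_pow_eq_pow_val,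
        mul_pow, pow_add]
      ring
    · rw [mul_sub]
      simp only [mul_assoc]

end IsCleftSystem

end HopfDatum

theorem mainTheorem10 {k G B : Type*} [Field k] [Group G] [Fintype G] [Ring B] [Algebra k B]
    (D : HopfDatum k G) (hpq : ¬ (D.χ D.z = 1 ∧ D.q = -1))
    (s : D.H ⊗[k] B →ₗ[k] B ⊗[k] D.H) (ν : B →ₗ[k] B ⊗[k] D.H)
    (hB : Braided.IsComoduleAlgebra D.braid s ν)
    (bg : G → Bˣ) (bx : B) (h_one : bg 1 = 1)
    (ha : ∀ g : G, (bg g : B) ∈ D.component s ν g (MulEquiv.refl G) ⊓ LinearMap.ker (D.U ν))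
    (hb : bx ∈ D.component s ν D.z (MulEquiv.refl G) ∧ D.U ν bx = 1)
    (hc : D.α s bx = (D.q : k) • bx)
    (hd : ∀ g : G, D.α s (bg g : B) = bg g) :
    -- `B` is a free left module over the coinvariants, with basis `b_g b_x ^ i`
    (∃ b : Module.Basis (G × Fin D.n) (Braided.coinvariants hB) B,
      ∀ (g : G) (i : Fin D.n), b (g, i) = (bg g : B) * bx ^ (i : ℕ)) ∧
    -- the elements `a_g`, `c_g` and `b`
    (∀ g : G, ∃ u : (Braided.coinvariants hB)ˣ,
      ((u : Braided.coinvariants hB) : B) = (bg g : B) ^ orderOf g) ∧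
    (∀ g : G, (bx * (bg g : B) - (D.χ g : k) • ((bg g : B) * bx)) * ((bg g)⁻¹ : Bˣ) *
      ((bg D.z)⁻¹ : Bˣ) ∈ Braided.coinvariants hB) ∧
    (D.x ^ D.n = 0 → bx ^ D.n * ((bg D.z ^ ((orderOf D.z : ℤ) - (D.n : ℤ)) : Bˣ) : B) ∈
      Braided.coinvariants hB) ∧
    -- the cleft map `γ`, the associated weak action `ρ` and the associated cocycle `σ`
    Braided.IsCleftMap D.braid s ν (D.gamma bg bx) ∧
    ∃ (γ' : D.H →ₗ[k] B)
      (sC : D.H ⊗[k] Braided.coinvariants hB →ₗ[k] Braided.coinvariants hB ⊗[k] D.H)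
      (ρ : D.H ⊗[k] Braided.coinvariants hB →ₗ[k] Braided.coinvariants hB)
      (σ : D.H ⊗[k] D.H →ₗ[k] Braided.coinvariants hB),
      Braided.IsAssociated hB (D.gamma bg bx) γ' sC ρ σ ∧
      Braided.IsWeakAction D.braid sC ρ ∧
      Braided.IsCocycle D.braid sC ρ σ ∧
      (∀ (g : G) (i : ℕ), i < D.n → ∀ ζ ∈ D.autGroup, ∀ c : Braided.coinvariants hB,
        (c : B) ∈ D.component s ν 1 ζ ⊓ LinearMap.ker (D.U ν) →
        (ρ ((D.grp g * D.x ^ i) ⊗ₜ[k] c) : B) =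
          ∑ j ∈ Finset.range (i + 1),
            ((-1) ^ j * D.qp ^ (j * (j - 1) / 2) * gaussBinom D.qp i j : k) •
              ((bg g : B) * bx ^ (i - j) * ((D.α s) ^ j) (c : B) * bx ^ j *
                ((bg (ζ g * D.z ^ i))⁻¹ : Bˣ))) ∧
      (∀ (g h : G) (m r : ℕ), m < D.n → r < D.n →
        (σ ((D.grp g * D.x ^ m) ⊗ₜ[k] (D.grp h * D.x ^ r)) : B) =
          ∑ i ∈ Finset.range (m + 1), ∑ j ∈ Finset.range (r + 1) with m + r - i - j < D.n,
            D.cocCoeff h m r i j (m + r - i - j) •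
              ((bg g : B) * bx ^ i * (bg h : B) * bx ^ (m + r - i) *
                ((bg (g * h * D.z ^ (m + r)))⁻¹ : Bˣ))
          + D.lam •
            ∑ i ∈ Finset.range (m + 1), ∑ j ∈ Finset.range (r + 1) with D.n ≤ m + r - i - j,
              D.cocCoeff h m r i j (m + r - i - j - D.n) •
                ((bg g : B) * bx ^ i * (bg h : B) * bx ^ (m + r - i - D.n) *
                  ((bg (g * h * D.z ^ (m + r)))⁻¹ : Bˣ))
          - D.lam •
            ∑ i ∈ Finset.range (m + 1), ∑ j ∈ Finset.range (r + 1) with D.n ≤ m + r - i - j,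
              D.cocCoeff h m r i j (m + r - i - j - D.n) •
                ((bg g : B) * bx ^ i * (bg h : B) * bx ^ (m + r - i - D.n) *
                  ((bg (g * h * D.z ^ (m + r - D.n)))⁻¹ : Bˣ))) := by
  have hb' := HopfDatum.isCleftSystem hpq hB h_one ha hb hc hd
  have hγ := hb'.isCleftPair hB
  obtain ⟨sC, hsC⟩ := Braided.exists_restrict hB D.braid_tmul_one
  refine ⟨hb'.exists_basis, hb'.exists_unit_coinvariants, hb'.commutator_mem, hb'.bx_pow_mem,
    ⟨hγ.colinear, hγ.compat, ⟨⟨_, _, hγ.conv_right, hγ.conv_left⟩, rfl⟩⟩,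
    D.gammaInv bg bx, sC, hγ.weakAct hB, hγ.cocycleMap hB, hγ.isAssociated hsC,
    hγ.isWeakAction D.braid_tmul_one D.braid_injective hsC, hγ.isCocycle hsC, ?_, ?_⟩
  · intro g i hi ζ hζ c hc
    rw [D.grp_mul_x_pow]
    exact hb'.weakAct_formula hpq g hi hζ.1 c hc.1.1
  · intro g h m r hm hr
    rw [D.grp_mul_x_pow, D.grp_mul_x_pow]
    exact hb'.cocycleMap_formula g h hm hr
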